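/- Let $M$ be a complex manifold of complex dimension $n$ with complex structure $J$. A *special complex manifold* $(M,J,\nabla)$ is such an $M$ with a flat torsion-free connection $\nabla$ on its real tangent bundle satisfying $d^\nabla J=0$, i.e. $(\nabla_XJ)Y=(\nabla_YJ)X$ for all vector fields $X,Y$. A *special symplectic manifold* $(M,J,\nabla,\omega)$ is a special complex manifold with a symplectic form $\omega$ such that $\nabla\omega=0$; it is *special Kähler* if moreover $\omega(J\cdot,J\cdot)=\omega$ (the metric $\omega(J\cdot,\cdot)$ may be indefinite). A function $f$ on an open subset is *affine* if $\nabla df=0$, and an *affine local coordinate system* is a system of local coordinates $(x^1,\dots,x^n,y_1,\dots,y_n)$ all of whose members are affine functions. On a special symplectic manifold it is a *real special coordinate system* if $\omega=2\sum_i dx^i\wedge dy_i$. A *conjugate pair of special coordinates* is a pair of holomorphic local coordinate systems $(z^1,\dots,z^n)$ and $(w_1,\dots,w_n)$ such that $(\operatorname{Re}z^1,\dots,\operatorname{Re}z^n,\operatorname{Re}w_1,\dots,\operatorname{Re}w_n)$ is a real special coordinate system. **Theorem 1.** (i) A special symplectic manifold admits a real special coordinate system near any point. It is unique up to an affine symplectic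 transformation: any two real special coordinate systems differ, on every connected open subset on which both are defined, by a transformation $u\mapsto Au+b$ with $A\in \mathrm{Sp}(2n,\mathbb R)$ and $b\in\mathbb R^{2n}$; and composing a real special coordinate system with such a transformation gives a real special coordinate system. (ii) Any affine local coordinate system $(x^1,\dots,x^n,y_1,\dots,y_n)$ on a special complex manifold admits, near each point of its domain, a holomorphic extension, i.e. there exist holomorphic functions $z^i$ and $w_j$ with $\operatorname{Re}z^i=x^i$ and $\operatorname{Re}w_j=y_j$. The extension is unique up to purely imaginary translations: two extensions over the same connected open set differ by the addition of purely imaginary constants to the $z^i$ and $w_j$, and adding such constants to an extension gives an extension. (iii) Near any point of a special Kähler manifold there exists a real special coordinate system which admits a holomorphic extension to a conjugate pair of special coordinates. -/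

import Mathlib

open Bundle VectorField
open scoped Manifold ContDiff Matrix

noncomputable section

namespace SpecialGeometry

variable {n : ℕ} {M : Type*} [TopologicalSpace M] [ChartedSpace (Fin n → ℂ) M]

/-- The real analytic manifold underlying a complex manifold. -/
instance instIsManifoldReal [IsManifold 𝓘(ℂ, Fin n → ℂ) ω M] :
    IsManifold 𝓘(ℝ, Fin n → ℂ) ω M := by
  refine isManifold_of_contDiffOn _ _ _ fun e e' he he' => ?_
  have h := (contDiffGroupoid ω 𝓘(ℂ, Fin n → ℂ)).compatible he he'
  rw [contDiffGroupoid, mem_groupoid_of_pregroupoid] at h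
  have h1 : ContDiffOn ℂ ω _ _ := h.1
  exact h1.restrict_scalars ℝ

variable [IsManifold 𝓘(ℂ, Fin n → ℂ) ω M]

variable (n M) in
/-- A (Koszul) connection on the real tangent bundle of the complex manifold `M`;
`D Y x (X x)` is the value of `∇_X Y` at `x`. -/
abbrev Connection :=
  CovariantDerivative 𝓘(ℝ, Fin n → ℂ) (Fin n → ℂ)
    (TangentSpace 𝓘(ℝ, Fin n → ℂ) : M → Type _)

variable (n M) in
/-- (Not necessarily smooth) sections of the real tangent bundle. -/
abbrev VField := Π x : M, TangentSpace 𝓘(ℝ, Fin n → ℂ) x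

/-- `X` is a smooth vector field on the set `U`. -/
def SmoothOn (X : VField n M) (U : Set M) : Prop :=
  ContMDiffOn 𝓘(ℝ, Fin n → ℂ) (𝓘(ℝ, Fin n → ℂ).tangent) ∞
    (fun x => (⟨x, X x⟩ : TangentBundle 𝓘(ℝ, Fin n → ℂ) M)) U

/-- The differential of `f : M → ℝ` at `x`, applied to a tangent vector. -/
def dAt (f : M → ℝ) (x : M) (v : TangentSpace 𝓘(ℝ, Fin n → ℂ) x) : ℝ :=
  mvfderiv 𝓘(ℝ, Fin n → ℂ) f x v

/-- The function `X f`, the derivative of `f` along the vector field `X`. -/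
def lieD (X : VField n M) (f : M → ℝ) (x : M) : ℝ := dAt f x (X x)

/-- The complex structure `J`. The tangent space at `x` is `ℂⁿ` by means of the preferred
holomorphic chart at `x`, and `J` is multiplication by `i` there; since the coordinate changes are
holomorphic, every holomorphic chart gives the same `J`. -/
def J (x : M) : TangentSpace 𝓘(ℝ, Fin n → ℂ) x →L[ℝ] TangentSpace 𝓘(ℝ, Fin n → ℂ) x :=
  (Complex.I • ContinuousLinearMap.id ℝ (Fin n → ℂ) : (Fin n → ℂ) →L[ℝ] (Fin n → ℂ))

/-- The vector field `J X`. -/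
def JField (X : VField n M) : VField n M := fun x => J x (X x)

/-- The vector field `∇_X Y`. -/
def nabla (D : Connection n M) (X Y : VField n M) : VField n M := fun x => D Y x (X x)

/-- The curvature `R(X, Y) Z = ∇_X ∇_Y Z - ∇_Y ∇_X Z - ∇_[X, Y] Z`. -/
def curvature (D : Connection n M) (X Y Z : VField n M) : VField n M :=
  nabla D X (nabla D Y Z) - nabla D Y (nabla D X Z)
    - nabla D (mlieBracket 𝓘(ℝ, Fin n → ℂ) X Y) Z

/-- `(∇_X J) Y = ∇_X (J Y) - J (∇_X Y)`. -/
def nablaJ (D : Connection n M) (X Y : VField n M) : VField n M :=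
  nabla D X (JField Y) - JField (nabla D X Y)

/-- `(d^∇ J)(X, Y) = (∇_X J) Y - (∇_Y J) X`. -/
def dNablaJ (D : Connection n M) (X Y : VField n M) : VField n M :=
  nablaJ D X Y - nablaJ D Y X

/-- `(M, J, ∇)` is a special complex manifold: `∇` is a smooth, flat, torsion-free connection on the
real tangent bundle with `d^∇ J = 0`. -/
structure IsSpecialComplex (D : Connection n M) : Prop where
  smooth : D.ContMDiffCovariantDerivative ∞
  flat : ∀ (U : Set M) (X Y Z : VField n M), IsOpen U →
    SmoothOn X U → SmoothOn Y U → SmoothOn Z U → ∀ x ∈ U, curvature D X Y Z x = 0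
  torsion_free : D.torsion = 0
  dNablaJ_eq_zero : ∀ (U : Set M) (X Y : VField n M), IsOpen U →
    SmoothOn X U → SmoothOn Y U → ∀ x ∈ U, dNablaJ D X Y x = 0

variable (n M) in
/-- Fields of real bilinear forms on the tangent spaces. -/
abbrev BilinField :=
  Π x : M, TangentSpace 𝓘(ℝ, Fin n → ℂ) x →L[ℝ] TangentSpace 𝓘(ℝ, Fin n → ℂ) x →L[ℝ] ℝ

/-- The function `Ω(X, Y)`. -/
def evalForm (Ω : BilinField n M) (X Y : VField n M) (x : M) : ℝ := Ω x (X x) (Y x)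

/-- The exterior derivative `dΩ(X, Y, Z)` of a 2-form, by the invariant formula. -/
def extD (Ω : BilinField n M) (X Y Z : VField n M) (x : M) : ℝ :=
  lieD X (evalForm Ω Y Z) x + lieD Y (evalForm Ω Z X) x + lieD Z (evalForm Ω X Y) x
    - evalForm Ω (mlieBracket 𝓘(ℝ, Fin n → ℂ) X Y) Z x
    - evalForm Ω (mlieBracket 𝓘(ℝ, Fin n → ℂ) Y Z) X x
    - evalForm Ω (mlieBracket 𝓘(ℝ, Fin n → ℂ) Z X) Y x

/-- `Ω` is a symplectic form: a smooth, closed, pointwise nondegenerate 2-form. -/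
structure IsSymplecticForm (Ω : BilinField n M) : Prop where
  alternating : ∀ (x : M) (v : TangentSpace 𝓘(ℝ, Fin n → ℂ) x), Ω x v v = 0
  nondegenerate : ∀ (x : M) (v : TangentSpace 𝓘(ℝ, Fin n → ℂ) x), (∀ w, Ω x v w = 0) → v = 0
  smooth : ∀ (U : Set M) (X Y : VField n M), IsOpen U → SmoothOn X U → SmoothOn Y U →
    ContMDiffOn 𝓘(ℝ, Fin n → ℂ) 𝓘(ℝ, ℝ) ∞ (evalForm Ω X Y) U
  closed : ∀ (U : Set M) (X Y Z : VField n M), IsOpen U →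
    SmoothOn X U → SmoothOn Y U → SmoothOn Z U → ∀ x ∈ U, extD Ω X Y Z x = 0

/-- `∇Ω = 0`, i.e. `X (Ω(Y, Z)) = Ω(∇_X Y, Z) + Ω(Y, ∇_X Z)`. -/
def IsParallelForm (D : Connection n M) (Ω : BilinField n M) : Prop :=
  ∀ (U : Set M) (X Y Z : VField n M), IsOpen U → SmoothOn X U → SmoothOn Y U → SmoothOn Z U →
    ∀ x ∈ U, lieD X (evalForm Ω Y Z) x
      = evalForm Ω (nabla D X Y) Z x + evalForm Ω Y (nabla D X Z) x

/-- `(M, J, ∇, Ω)` is a special symplectic manifold. -/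
structure IsSpecialSymplectic (D : Connection n M)
    (Ω : BilinField n M) : Prop extends IsSpecialComplex D where
  symplectic : IsSymplecticForm Ω
  parallel : IsParallelForm D Ω

/-- `(M, J, ∇, Ω)` is a special (pseudo-)Kähler manifold: moreover `Ω` is `J`-invariant. -/
structure IsSpecialKahler (D : Connection n M)
    (Ω : BilinField n M) : Prop extends IsSpecialSymplectic D Ω where
  J_invariant : ∀ (x : M) (v w : TangentSpace 𝓘(ℝ, Fin n → ℂ) x), Ω x (J x v) (J x w) = Ω x v w

/-- The function `f`, defined on the open set `U`, is affine: it is smooth and `∇ df = 0`, i.e.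
`X (Y f) = (∇_X Y) f`. -/
def IsAffineOn (D : Connection n M) (f : M → ℝ) (U : Set M) : Prop :=
  ContMDiffOn 𝓘(ℝ, Fin n → ℂ) 𝓘(ℝ, ℝ) ∞ f U ∧
  ∀ (W : Set M) (X Y : VField n M), IsOpen W → W ⊆ U → SmoothOn X W → SmoothOn Y W →
    ∀ x ∈ W, lieD X (lieD Y f) x = lieD (nabla D X Y) f x

variable (n M) in
/-- Homeomorphisms from an open subset of `M` to an open subset of `ℝ²ⁿ`. The component with index
`Sum.inl i` is written `xⁱ` and the one with index `Sum.inr i` is written `yᵢ`. -/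
abbrev RealCoord := OpenPartialHomeomorph M (Fin n ⊕ Fin n → ℝ)

/-- `e = (x¹, …, xⁿ, y₁, …, yₙ)` is an affine local coordinate system: a diffeomorphism of an open
subset of `M` onto an open subset of `ℝ²ⁿ` whose components are affine functions. -/
structure IsAffineCoord (D : Connection n M) (e : RealCoord n M) : Prop where
  smooth : ContMDiffOn 𝓘(ℝ, Fin n → ℂ) 𝓘(ℝ, Fin n ⊕ Fin n → ℝ) ∞ e e.source
  smooth_symm : ContMDiffOn 𝓘(ℝ, Fin n ⊕ Fin n → ℝ) 𝓘(ℝ, Fin n → ℂ) ∞ e.symm e.target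
  affine : ∀ k, IsAffineOn D (fun q => e q k) e.source

/-- `e` is a real special coordinate system: it is affine and `Ω = 2 ∑ dxⁱ ∧ dyᵢ`. -/
structure IsRealSpecial (D : Connection n M) (Ω : BilinField n M) (e : RealCoord n M) : Prop
    extends IsAffineCoord D e where
  form_eq : ∀ q ∈ e.source, ∀ u v : TangentSpace 𝓘(ℝ, Fin n → ℂ) q,
    Ω q u v = 2 * ∑ i : Fin n,
      (dAt (fun r => e r (Sum.inl i)) q u * dAt (fun r => e r (Sum.inr i)) q v
        - dAt (fun r => e r (Sum.inl i)) q v * dAt (fun r => e r (Sum.inr i)) q u)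

/-- `F = (z¹, …, zⁿ, w₁, …, wₙ)` is a holomorphic extension over the open set `V` of
`e = (x¹, …, xⁿ, y₁, …, yₙ)`: its components are holomorphic on `V`, and `Re zⁱ = xⁱ`,
`Re wⱼ = yⱼ` there. -/
def IsHolomorphicExtension (e : RealCoord n M) (V : Set M) (F : M → (Fin n ⊕ Fin n → ℂ)) : Prop :=
  MDifferentiableOn 𝓘(ℂ, Fin n → ℂ) 𝓘(ℂ, Fin n ⊕ Fin n → ℂ) F V ∧
  ∀ q ∈ V, ∀ k, (F q k).re = e q k

/-- `z = (z¹, …, zⁿ)` is a system of holomorphic local coordinates: a biholomorphic map of an open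
subset of `M` onto an open subset of `ℂⁿ`. -/
def IsHolomorphicCoord (z : OpenPartialHomeomorph M (Fin n → ℂ)) : Prop :=
  z.MDifferentiable 𝓘(ℂ, Fin n → ℂ) 𝓘(ℂ, Fin n → ℂ)

/-- `z` and `w` are holomorphic local coordinates whose real parts make up the real special
coordinate system `e`; so `(z, w)` is a conjugate pair of special coordinates that extends `e`. -/
structure IsConjugatePairExtending (D : Connection n M) (Ω : BilinField n M) (e : RealCoord n M)
    (z w : OpenPartialHomeomorph M (Fin n → ℂ)) : Prop where
  real_special : IsRealSpecial D Ω e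
  holomorphic_z : IsHolomorphicCoord z
  holomorphic_w : IsHolomorphicCoord w
  source_z : z.source = e.source
  source_w : w.source = e.source
  re_z : ∀ q ∈ e.source, ∀ i, (z q i).re = e q (Sum.inl i)
  re_w : ∀ q ∈ e.source, ∀ i, (w q i).re = e q (Sum.inr i)

end SpecialGeometry

end

/-! In a holomorphic chart the connection becomes a field Γ of bilinear maps, and the hypotheses
become pointwise identities. Vanishing torsion is Γ(u,v) = Γ(v,u) (`christoffel_symm`), flatness is
the symmetry in u, v of ∂_uΓ(v,w) + Γ(u,Γ(v,w)) (`christoffel_flat`), and, once Γ is symmetric, d^∇J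
= 0 is Γ(u,iv) = Γ(v,iu) (`christoffel_I`). A function f is affine exactly when d²f(u,v) =
df(Γ(u,v)).

Existence rests on the local solvability of integrable linear systems dU = AU
(`exists_fundamental_solution`), proved by Picard iteration along rays while controlling how far the
differential of each iterate is from A times that iterate. The equation of parallel coframes and the
Poincaré lemma are both instances; together they give affine functions with any prescribed
differential at a point (`exists_affine_of_flat`).

(i) Prescribe a linear symplectic coframe at p. Then ω and 2∑dxⁱ∧dyᵢ are both parallel and agree at
p, hence near p (`eq_of_parallel`). If e' = h∘e are two affine systems, the common equation d² = d∘Γ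
forces d²h = 0 (`fderiv_fderiv_coordChange`), so h is affine on connected sets; comparing the two
expressions of ω at one point makes its linear part symplectic.

(ii) For affine x the 1-form dx∘J is closed, because d²x(u,iv) = dx(Γ(u,iv)) is symmetric. If H is a
primitive, then x − iH is holomorphic (`exists_holomorphic_extension`). Two extensions differ by a
holomorphic map with zero real part, which is locally constant.

(iii) The extension (z,w) exists by (ii), but dz is injective only if no nonzero v has dx(v) =
dx(iv) = 0, and similarly for dw. When ω is J-invariant, the symplectic basis at p can be chosen
with every b_i a real multiple of J a_i, even for an indefinite metric
(`canExtend_of_complexStructure`). Then dz and dw are invertible at p (`eq_zero_of_adapted_frame`)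
and the inverse function theorem applies. -/

noncomputable section

namespace SpecialGeometry

/-! ### Integrable linear systems: one step of radial Picard iteration -/

section Frobenius

/-- Differentiation under the integral sign for a continuously differentiable integrand. -/
theorem hasFDerivAt_integral_of_continuous {E F : Type*} [NormedAddCommGroup E] [NormedSpace ℝ E]
    [FiniteDimensional ℝ E] [NormedAddCommGroup F] [NormedSpace ℝ F]
    {G : E → ℝ → F} {G' : E → ℝ → E →L[ℝ] F}
    (hG : Continuous fun q : E × ℝ => G q.1 q.2) (hG' : Continuous fun q : E × ℝ => G' q.1 q.2)
    (h : ∀ x t, HasFDerivAt (fun y => G y t) (G' x t) x) (x : E) :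
    HasFDerivAt (fun y => ∫ t in (0:ℝ)..1, G y t) (∫ t in (0:ℝ)..1, G' x t) x := by
  have : ProperSpace E := FiniteDimensional.proper ℝ E
  obtain ⟨C, hC⟩ := ((isCompact_closedBall x 1).prod (isCompact_Icc (a := (0:ℝ)) (b := 1))
    ).exists_bound_of_continuousOn hG'.continuousOn
  refine (intervalIntegral.hasFDerivAt_integral_of_dominated_of_fderiv_le (bound := fun _ => C)
    (Metric.closedBall_mem_nhds x one_pos) (.of_forall fun y => ?_) ?_ ?_ ?_ ?_ ?_)
  · exact (hG.comp (Continuous.prodMk_right y)).aestronglyMeasurable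
  · exact (hG.comp (Continuous.prodMk_right x)).intervalIntegrable _ _
  · exact (hG'.comp (Continuous.prodMk_right x)).aestronglyMeasurable
  · refine .of_forall fun t ht y hy => hC (y, t) ⟨hy, ?_⟩
    rw [Set.uIoc_of_le zero_le_one] at ht
    exact ⟨ht.1.le, ht.2⟩
  · exact intervalIntegrable_const
  · exact .of_forall fun t _ y _ => h y t

theorem smul_mem_ball_zero {E : Type*} [NormedAddCommGroup E] [NormedSpace ℝ E] {r : ℝ} {x : E}
    (hx : x ∈ Metric.ball (0 : E) r) {t : ℝ} (h0 : 0 ≤ t) (h1 : t ≤ 1) :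
    t • x ∈ Metric.ball (0 : E) r := by
  rw [mem_ball_zero_iff] at hx ⊢
  rw [norm_smul, Real.norm_of_nonneg h0]
  nlinarith [norm_nonneg x]

variable {E 𝔸 : Type*} [NormedAddCommGroup E] [NormedSpace ℝ E]
  [NormedRing 𝔸] [NormedAlgebra ℝ 𝔸]

/-- The product `h ↦ B h * u` of an algebra-valued linear form with an element of the algebra. -/
def mulForm (B : E →L[ℝ] 𝔸) (u : 𝔸) : E →L[ℝ] 𝔸 :=
  ((ContinuousLinearMap.mul ℝ 𝔸).flip u) ∘L B

@[simp]
theorem mulForm_apply (B : E →L[ℝ] 𝔸) (u : 𝔸) (h : E) : mulForm B u h = B h * u := rfl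

theorem norm_mulForm_le (B : E →L[ℝ] 𝔸) (u : 𝔸) : ‖mulForm B u‖ ≤ ‖B‖ * ‖u‖ := by
  refine ContinuousLinearMap.opNorm_le_bound _ (by positivity) fun h => ?_
  calc ‖B h * u‖ ≤ ‖B h‖ * ‖u‖ := norm_mul_le _ _
    _ ≤ ‖B‖ * ‖h‖ * ‖u‖ := by gcongr; exact B.le_opNorm h
    _ = ‖B‖ * ‖u‖ * ‖h‖ := by ring

theorem isBoundedBilinearMap_mulForm :
    IsBoundedBilinearMap ℝ fun p : (E →L[ℝ] 𝔸) × 𝔸 => mulForm p.1 p.2 where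
  add_left _ _ _ := by ext; simp [add_mul]
  smul_left _ _ _ := by ext; simp
  add_right _ _ _ := by ext; simp [mul_add]
  smul_right _ _ _ := by ext; simp
  bound := ⟨1, one_pos, fun B u => by simpa using norm_mulForm_le B u⟩

theorem continuous_mulForm {X : Type*} [TopologicalSpace X] {B : X → E →L[ℝ] 𝔸} {u : X → 𝔸}
    (hB : Continuous B) (hu : Continuous u) : Continuous fun x => mulForm (B x) (u x) :=
  isBoundedBilinearMap_mulForm.continuous.comp (hB.prodMk hu)

theorem hasDerivAt_mulForm {B : ℝ → E →L[ℝ] 𝔸} {u : ℝ → 𝔸} {B' : E →L[ℝ] 𝔸} {u' : 𝔸} {t : ℝ}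
    (hB : HasDerivAt B B' t) (hu : HasDerivAt u u' t) :
    HasDerivAt (fun t => mulForm (B t) (u t)) (mulForm (B t) u' + mulForm B' (u t)) t := by
  have h : HasDerivAt (fun t => (ContinuousLinearMap.mul ℝ 𝔸).flip (u t))
      ((ContinuousLinearMap.mul ℝ 𝔸).flip u') t :=
    ((ContinuousLinearMap.mul ℝ 𝔸).flip.hasFDerivAt (x := u t)).comp_hasDerivAt t hu
  exact h.clm_comp hB

attribute [irreducible] mulForm

/-- The radial integral operator whose fixed points solve `dU = A U`, `U 0 = 1` along rays. -/
def radialStep (A : E → E →L[ℝ] 𝔸) (U : E → 𝔸) (x : E) : 𝔸 :=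
  1 + ∫ t in (0:ℝ)..1, A (t • x) x * U (t • x)

variable {A : E → E →L[ℝ] 𝔸} {A' : E → E →L[ℝ] E →L[ℝ] 𝔸} {r C : ℝ}

/-- The segment from 0 to `x` stays in the ball, where `‖A (t • x) x‖ ≤ C * r ≤ 1 / 4`; hence the
integral operator contracts sup-norm distances by a factor of four. -/
theorem norm_radialStep_sub_le (hA : Continuous A) {U V : E → 𝔸} (hU : Continuous U)
    (hV : Continuous V) (hC : ∀ x ∈ Metric.ball (0 : E) r, ‖A x‖ ≤ C) (hCr : C * r ≤ 1 / 4)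
    {δ : ℝ} (hUV : ∀ x ∈ Metric.ball (0 : E) r, ‖U x - V x‖ ≤ δ) :
    ∀ x ∈ Metric.ball (0 : E) r, ‖radialStep A U x - radialStep A V x‖ ≤ δ / 4 := by
  intro x hx
  have hint : ∀ W : E → 𝔸, Continuous W →
      IntervalIntegrable (fun t : ℝ => A (t • x) x * W (t • x)) MeasureTheory.volume 0 1 := by
    intro W hW
    have hs : Continuous fun t : ℝ => t • x := continuous_id.smul continuous_const
    exact (((hA.comp hs).clm_apply continuous_const).mul (hW.comp hs)).intervalIntegrable _ _
  have : radialStep A U x - radialStep A V x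
      = ∫ t in (0:ℝ)..1, A (t • x) x * (U (t • x) - V (t • x)) := by
    simp only [radialStep, mul_sub]
    rw [intervalIntegral.integral_sub (hint U hU) (hint V hV)]
    abel
  rw [this]
  have hb : ∀ t ∈ Set.uIoc (0:ℝ) 1, ‖A (t • x) x * (U (t • x) - V (t • x))‖ ≤ δ / 4 := by
    intro t ht
    rw [Set.uIoc_of_le zero_le_one] at ht
    have hm := smul_mem_ball_zero hx ht.1.le ht.2
    have h1 := hC _ hm
    have h2 := hUV _ hm
    have hx' : ‖x‖ ≤ r := by rw [mem_ball_zero_iff] at hx; exact hx.le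
    have hC0 : 0 ≤ C := (norm_nonneg _).trans h1
    have hδ : 0 ≤ δ := (norm_nonneg _).trans h2
    have hr : 0 ≤ r := (norm_nonneg _).trans hx'
    have h3 : ‖A (t • x) x‖ ≤ C * r := ((A (t • x)).le_opNorm x).trans (by gcongr)
    calc ‖A (t • x) x * (U (t • x) - V (t • x))‖
        ≤ ‖A (t • x) x‖ * ‖U (t • x) - V (t • x)‖ := norm_mul_le _ _
      _ ≤ C * r * δ := by gcongr
      _ ≤ 1 / 4 * δ := by gcongr
      _ = δ / 4 := by ring
  simpa using intervalIntegral.norm_integral_le_of_norm_le_const hb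

/-- The derivative of the integrand of `radialStep`. -/
def radialDeriv (A : E → E →L[ℝ] 𝔸) (A' : E → E →L[ℝ] E →L[ℝ] 𝔸) (U : E → 𝔸)
    (U' : E → E →L[ℝ] 𝔸) (x : E) (t : ℝ) : E →L[ℝ] 𝔸 :=
  mulForm (t • (A' (t • x)).flip x + A (t • x)) (U (t • x))
    + (ContinuousLinearMap.mul ℝ 𝔸 (A (t • x) x)) ∘L (t • U' (t • x))

theorem continuous_radialDeriv (hA : Continuous A) (hA' : Continuous A')
    {U : E → 𝔸} {U' : E → E →L[ℝ] 𝔸} (hU : Continuous U) (hU' : Continuous U') :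
    Continuous fun q : E × ℝ => radialDeriv A A' U U' q.1 q.2 := by
  have h1 : Continuous fun q : E × ℝ => q.2 • q.1 := continuous_snd.smul continuous_fst
  have h2 : Continuous fun q : E × ℝ => A (q.2 • q.1) := hA.comp h1
  have h3 : Continuous fun q : E × ℝ => U (q.2 • q.1) := hU.comp h1
  have h4 : Continuous fun q : E × ℝ => U' (q.2 • q.1) := hU'.comp h1
  have h5 : Continuous fun q : E × ℝ => (A' (q.2 • q.1)).flip :=
    (ContinuousLinearMap.flipₗᵢ ℝ E E 𝔸).continuous.comp (hA'.comp h1)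
  refine (continuous_mulForm ((continuous_snd.smul (h5.clm_apply continuous_fst)).add h2) h3).add ?_
  exact ((ContinuousLinearMap.mul ℝ 𝔸).continuous.comp
    (h2.clm_apply continuous_fst)).clm_comp (continuous_snd.smul h4)

theorem hasFDerivAt_radial (hA : ∀ x, HasFDerivAt A (A' x) x) {U : E → 𝔸} {U' : E → E →L[ℝ] 𝔸}
    (hU : ∀ x, HasFDerivAt U (U' x) x) (x : E) (t : ℝ) :
    HasFDerivAt (fun y => A (t • y) y * U (t • y)) (radialDeriv A A' U U' x t) x := by
  have hs : HasFDerivAt (fun y : E => t • y) (t • ContinuousLinearMap.id ℝ E) x :=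
    (hasFDerivAt_id x).const_smul t
  have h0 := (hA (t • x)).comp x hs
  have h1 := h0.clm_apply (hasFDerivAt_id x)
  have h2 := (hU (t • x)).comp x hs
  refine (h1.mul' h2).congr_fderiv ?_
  ext h
  simp [radialDeriv]
  rw [add_comm]
  simp [add_comm, add_mul]

theorem hasDerivAt_radial (hA : ∀ x, HasFDerivAt A (A' x) x) {U : E → 𝔸} {U' : E → E →L[ℝ] 𝔸}
    (hU : ∀ x, HasFDerivAt U (U' x) x) (x : E) (t : ℝ) :
    HasDerivAt (fun t : ℝ => t • mulForm (A (t • x)) (U (t • x)))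
      (mulForm (A (t • x)) (U (t • x)) + t • (mulForm (A' (t • x) x) (U (t • x))
        + mulForm (A (t • x)) (U' (t • x) x))) t := by
  have hs : HasDerivAt (fun t : ℝ => t • x) x t := by
    simpa using (hasDerivAt_id t).smul_const x
  have h1 : HasDerivAt (fun t : ℝ => A (t • x)) (A' (t • x) x) t :=
    (hA (t • x)).comp_hasDerivAt t hs
  have h2 : HasDerivAt (fun t : ℝ => U (t • x)) (U' (t • x) x) t :=
    (hU (t • x)).comp_hasDerivAt t hs
  refine ((hasDerivAt_id t).smul (hasDerivAt_mulForm h1 h2)).congr_deriv ?_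
  rw [id, one_smul, add_comm (mulForm (A (t • x)) (U (t • x))), add_comm (mulForm (A (t • x)) (U' (t • x) x))]

/-- Integrability enters here, and only to exchange the two arguments of `A'`. It shows that the
derivative of the integrand is d/dt of t·A(tx)U(tx) up to terms linear in the defect U' − AU, so no
uncontrolled derivative of `A` survives. -/
theorem radialDeriv_sub {U : E → 𝔸} {U' : E → E →L[ℝ] 𝔸} {x : E} {t : ℝ}
    (hint : ∀ u v, A' (t • x) u v + A (t • x) v * A (t • x) u
      = A' (t • x) v u + A (t • x) u * A (t • x) v) :
    radialDeriv A A' U U' x t - (mulForm (A (t • x)) (U (t • x))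
        + t • (mulForm (A' (t • x) x) (U (t • x)) + mulForm (A (t • x)) (U' (t • x) x)))
      = t • ((ContinuousLinearMap.mul ℝ 𝔸 (A (t • x) x)) ∘L
          (U' (t • x) - mulForm (A (t • x)) (U (t • x)))
        - mulForm (A (t • x)) ((U' (t • x) - mulForm (A (t • x)) (U (t • x))) x)) := by
  ext h
  have e : A' (t • x) h x = A' (t • x) x h
      + A (t • x) h * A (t • x) x - A (t • x) x * A (t • x) h := by
    rw [← hint h x, add_sub_cancel_right]
  simp only [radialDeriv, _root_.sub_apply, _root_.add_apply,
    ContinuousLinearMap.flip_apply, _root_.smul_apply, mulForm_apply,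
    ContinuousLinearMap.comp_apply, ContinuousLinearMap.mul_apply', e, mul_sub, add_mul,
    sub_mul, smul_mul_assoc, mul_smul_comm, smul_add, smul_sub, mul_assoc]
  abel

attribute [irreducible] radialDeriv

theorem norm_defect_le {x : E} (hC : ‖A x‖ ≤ C) {ρ k : ℝ} {R : E →L[ℝ] 𝔸}
    (hR : ‖R‖ ≤ ρ) {y : E} (hy : ‖y‖ ≤ k) :
    ‖(ContinuousLinearMap.mul ℝ 𝔸 (A x y)) ∘L R - mulForm (A x) (R y)‖ ≤ 2 * (C * k * ρ) := by
  have hC0 : 0 ≤ C := (norm_nonneg _).trans hC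
  have hρ0 : 0 ≤ ρ := (norm_nonneg _).trans hR
  have hk0 : 0 ≤ k := (norm_nonneg _).trans hy
  have e1 : ‖(ContinuousLinearMap.mul ℝ 𝔸 (A x y)) ∘L R‖ ≤ C * k * ρ := by
    refine (ContinuousLinearMap.opNorm_comp_le _ _).trans ?_
    gcongr
    refine (ContinuousLinearMap.opNorm_mul_apply_le ℝ 𝔸 _).trans ?_
    exact ((A x).le_opNorm y).trans (by gcongr)
  have e2 : ‖mulForm (A x) (R y)‖ ≤ C * k * ρ := by
    refine (norm_mulForm_le _ _).trans ?_
    calc _ ≤ C * (ρ * k) := by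
          gcongr
          exact (R.le_opNorm y).trans (by gcongr)
      _ = C * k * ρ := by ring
  linarith [norm_sub_le ((ContinuousLinearMap.mul ℝ 𝔸 (A x y)) ∘L R) (mulForm (A x) (R y))]

variable [FiniteDimensional ℝ E] [CompleteSpace 𝔸]

/-- With V the new iterate, V' − AV = A(U − V) + ∫ (terms linear in the defect U' − AU). The first
summand is at most `C * δ`; the second is at most 2·(C r)·ρ ≤ ρ/2. So the defect is halved up to an
error governed by the convergence of the iterates. -/
theorem radialStep_hasFDerivAt (hA : ∀ x, HasFDerivAt A (A' x) x) (hA' : Continuous A')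
    (hC : ∀ x ∈ Metric.ball (0 : E) r, ‖A x‖ ≤ C) (hCr : C * r ≤ 1 / 4)
    (hint : ∀ x ∈ Metric.ball (0 : E) r, ∀ u v,
      A' x u v + A x v * A x u = A' x v u + A x u * A x v)
    {U : E → 𝔸} {U' : E → E →L[ℝ] 𝔸} (hU : ∀ x, HasFDerivAt U (U' x) x) (hU' : Continuous U')
    {δ ρ : ℝ} (hδ : ∀ x ∈ Metric.ball (0 : E) r, ‖U x - radialStep A U x‖ ≤ δ)
    (hρ : ∀ x ∈ Metric.ball (0 : E) r, ‖U' x - mulForm (A x) (U x)‖ ≤ ρ) :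
    ∃ V' : E → E →L[ℝ] 𝔸, Continuous V' ∧
      (∀ x, HasFDerivAt (radialStep A U) (V' x) x) ∧
      ∀ x ∈ Metric.ball (0 : E) r,
        ‖V' x - mulForm (A x) (radialStep A U x)‖ ≤ C * δ + ρ / 2 := by
  have hAc : Continuous A := continuous_iff_continuousAt.2 fun x => (hA x).continuousAt
  have hUc : Continuous U := continuous_iff_continuousAt.2 fun x => (hU x).continuousAt
  have hG'c := continuous_radialDeriv hAc hA' hUc hU'
  have hGc : Continuous fun q : E × ℝ => A (q.2 • q.1) q.1 * U (q.2 • q.1) :=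
    ((hAc.comp (continuous_snd.smul continuous_fst)).clm_apply continuous_fst).mul
      (hUc.comp (continuous_snd.smul continuous_fst))
  have hder := hasFDerivAt_integral_of_continuous hGc hG'c (hasFDerivAt_radial hA hU)
  have hder' : ∀ x, HasFDerivAt (radialStep A U)
      (∫ t in (0:ℝ)..1, radialDeriv A A' U U' x t) x := fun x => (hder x).const_add 1
  have hcont : Continuous fun x => ∫ t in (0:ℝ)..1, radialDeriv A A' U U' x t :=
    intervalIntegral.continuous_parametric_intervalIntegral_of_continuous' hG'c 0 1
  refine ⟨_, hcont, hder', fun x hx => ?_⟩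
  have hx' : ‖x‖ ≤ r := by rw [mem_ball_zero_iff] at hx; exact hx.le
  -- The derivative of t·A(tx)U(tx): its integral over [0,1] is the endpoint value A(x)U(x), which
  -- is what has to be split off from the differential of the new iterate.
  set P' : ℝ → E →L[ℝ] 𝔸 := fun t => mulForm (A (t • x)) (U (t • x))
    + t • (mulForm (A' (t • x) x) (U (t • x)) + mulForm (A (t • x)) (U' (t • x) x)) with hP'
  have hP'c : Continuous P' := by
    have hs : Continuous fun t : ℝ => t • x := continuous_id.smul continuous_const
    have h1 := continuous_mulForm (hAc.comp hs) (hUc.comp hs)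
    have h2 := continuous_mulForm ((hA'.comp hs).clm_apply (continuous_const (y := x))) (hUc.comp hs)
    have h3 := continuous_mulForm (hAc.comp hs) ((hU'.comp hs).clm_apply (continuous_const (y := x)))
    have h4 := h2.add h3
    have h5 := continuous_id.smul h4
    exact h1.add h5
  have hPint : ∫ t in (0:ℝ)..1, P' t = mulForm (A x) (U x) := by
    rw [intervalIntegral.integral_eq_sub_of_hasDerivAt (fun t _ => hasDerivAt_radial hA hU x t)
      (hP'c.intervalIntegrable _ _)]
    ext h
    simp only [_root_.sub_apply, _root_.smul_apply, one_smul, zero_smul,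
      sub_zero]
  have hGx : Continuous fun t => radialDeriv A A' U U' x t :=
    hG'c.comp (Continuous.prodMk_right x)
  have hdiff : (∫ t in (0:ℝ)..1, radialDeriv A A' U U' x t) - mulForm (A x) (U x)
      = ∫ t in (0:ℝ)..1, (radialDeriv A A' U U' x t - P' t) := by
    rw [intervalIntegral.integral_sub (hGx.intervalIntegrable _ _)
      (hP'c.intervalIntegrable _ _), hPint]
  have hb : ∀ t ∈ Set.uIoc (0:ℝ) 1, ‖radialDeriv A A' U U' x t - P' t‖ ≤ ρ / 2 := by
    intro t ht
    rw [Set.uIoc_of_le zero_le_one] at ht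
    have hm := smul_mem_ball_zero hx ht.1.le ht.2
    have h2 := hρ _ hm
    have hρ0 : 0 ≤ ρ := (norm_nonneg _).trans h2
    rw [radialDeriv_sub (hint _ hm), norm_smul, Real.norm_of_nonneg ht.1.le]
    have e3 := norm_defect_le (hC _ hm) h2 hx'
    have e4 : C * r * ρ ≤ 1 / 4 * ρ := by gcongr
    calc _ ≤ 1 * (2 * (C * r * ρ)) := by gcongr; exact ht.2
      _ ≤ ρ / 2 := by linarith
  have hI : ‖∫ t in (0:ℝ)..1, (radialDeriv A A' U U' x t - P' t)‖ ≤ ρ / 2 := by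
    simpa using intervalIntegral.norm_integral_le_of_norm_le_const hb
  have hsplit : (∫ t in (0:ℝ)..1, radialDeriv A A' U U' x t) - mulForm (A x) (radialStep A U x)
      = mulForm (A x) (U x - radialStep A U x)
        + ∫ t in (0:ℝ)..1, (radialDeriv A A' U U' x t - P' t) := by
    rw [← hdiff]
    ext h
    simp [mul_sub]
  rw [hsplit]
  refine (norm_add_le _ _).trans (add_le_add ?_ hI)
  refine (norm_mulForm_le _ _).trans ?_
  have h1 := hC x hx
  have h2 := hδ x hx
  have hC0 : 0 ≤ C := (norm_nonneg _).trans h1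
  gcongr

end Frobenius

/-! ### Local fundamental solutions of integrable systems -/

section FrobeniusExistence

open Filter Topology

variable {E 𝔸 : Type*} [NormedAddCommGroup E] [NormedSpace ℝ E] [FiniteDimensional ℝ E]
  [NormedRing 𝔸] [NormedAlgebra ℝ 𝔸] [CompleteSpace 𝔸]

omit [FiniteDimensional ℝ E] [CompleteSpace 𝔸] in
theorem radialStep_zero_apply (A : E → E →L[ℝ] 𝔸) : radialStep A 0 = fun _ => 1 := by
  funext x
  simp [radialStep]

/-- The Picard iterates starting from 1 converge geometrically, and so do their defects to 0. The
differentials therefore converge uniformly to AU, and the limit may be differentiated termwise. -/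
theorem exists_fundamental_solution_of_bound {A : E → E →L[ℝ] 𝔸} {A' : E → E →L[ℝ] E →L[ℝ] 𝔸}
    {r C : ℝ} (hA : ∀ x, HasFDerivAt A (A' x) x) (hA' : Continuous A') (hC0 : 0 ≤ C)
    (hC : ∀ x ∈ Metric.ball (0 : E) r, ‖A x‖ ≤ C) (hCr : C * r ≤ 1 / 4)
    (hint : ∀ x ∈ Metric.ball (0 : E) r, ∀ u v,
      A' x u v + A x v * A x u = A' x v u + A x u * A x v) :
    ∃ U : E → 𝔸, U 0 = 1 ∧ ∀ x ∈ Metric.ball (0 : E) r, HasFDerivAt U (mulForm (A x) (U x)) x := by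
  have hAc : Continuous A := continuous_iff_continuousAt.2 fun x => (hA x).continuousAt
  set u : ℕ → E → 𝔸 := fun m => (radialStep A)^[m] (fun _ => 1) with hu
  have hu0 : u 0 = fun _ => 1 := rfl
  have husucc : ∀ m, u (m + 1) = radialStep A (u m) := fun m => Function.iterate_succ_apply' _ _ _
  set N : ℝ := ‖(1 : 𝔸)‖ with hN
  have hN0 : 0 ≤ N := norm_nonneg _
  -- The defect bound ρ_m satisfies ρ_{m+1} ≤ CN(1/4)^m + ρ_m/2. The ansatz ρ_m = 4CN(3/4)^m closes
  -- the induction, since CN(3/4)^m + 2CN(3/4)^m = 4CN(3/4)^{m+1}.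
  have main : ∀ m, (∀ x ∈ Metric.ball (0 : E) r, ‖u m x - u (m + 1) x‖ ≤ N * (1 / 4) ^ m) ∧
      ∃ U' : E → E →L[ℝ] 𝔸, Continuous U' ∧ (∀ x, HasFDerivAt (u m) (U' x) x) ∧
        ∀ x ∈ Metric.ball (0 : E) r,
          ‖U' x - mulForm (A x) (u m x)‖ ≤ 4 * C * N * (3 / 4) ^ m := by
    intro m
    induction m with
    | zero =>
      refine ⟨fun x hx => ?_, 0, continuous_const, fun x => ?_, fun x hx => ?_⟩
      -- The radial step maps 0 to the constant 1, so the first difference of iterates is the image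
      -- of the pair 0, 1, which lie at distance N.
      · have h := norm_radialStep_sub_le hAc (U := 0) (V := fun _ => 1) continuous_const
          continuous_const hC hCr (δ := N) (fun y _ => by simp [hN]) x hx
        rw [husucc, hu0]
        rw [radialStep_zero_apply] at h
        simp only [pow_zero, mul_one]
        linarith
      · rw [hu0]; exact hasFDerivAt_const _ _
      · rw [hu0]
        simp only [Pi.zero_apply, zero_sub, norm_neg, pow_zero, mul_one]
        refine (norm_mulForm_le _ _).trans ?_
        have := hC x hx
        calc ‖A x‖ * N ≤ C * N := by gcongr
          _ ≤ 4 * C * N := by nlinarith [mul_nonneg hC0 hN0]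
    | succ m ih =>
      obtain ⟨h1, U', hU'c, hU', hR⟩ := ih
      have huc : Continuous (u m) := continuous_iff_continuousAt.2 fun x => (hU' x).continuousAt
      obtain ⟨V', hV'c, hV', hRV⟩ := radialStep_hasFDerivAt hA hA' hC hCr hint hU' hU'c
        (δ := N * (1 / 4) ^ m) (ρ := 4 * C * N * (3 / 4) ^ m)
        (fun x hx => by rw [← husucc]; exact h1 x hx) hR
      have huc' : Continuous (u (m + 1)) := by
        rw [husucc]; exact continuous_iff_continuousAt.2 fun x => (hV' x).continuousAt
      refine ⟨fun x hx => ?_, V', hV'c, fun x => by rw [husucc]; exact hV' x, fun x hx => ?_⟩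
      · have h := norm_radialStep_sub_le hAc huc huc' hC hCr h1 x hx
        rw [husucc (m + 1), husucc m] at *
        refine h.trans (le_of_eq ?_)
        rw [pow_succ]; ring
      · rw [husucc]
        refine (hRV x hx).trans ?_
        have hp : (1 / 4 : ℝ) ^ m ≤ (3 / 4) ^ m := by gcongr; norm_num
        have hCN : 0 ≤ C * N := mul_nonneg hC0 hN0
        calc C * (N * (1 / 4) ^ m) + 4 * C * N * (3 / 4) ^ m / 2
            = C * N * (1 / 4) ^ m + 2 * (C * N) * (3 / 4) ^ m := by ring
          _ ≤ C * N * (3 / 4) ^ m + 2 * (C * N) * (3 / 4) ^ m := by gcongr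
          _ = 4 * C * N * (3 / 4) ^ (m + 1) := by rw [pow_succ]; ring
  choose hdist U' hU'c hU' hR using main
  have hd : ∀ x ∈ Metric.ball (0 : E) r, ∀ m, dist (u m x) (u (m + 1) x) ≤ N * (1 / 4) ^ m :=
    fun x hx m => by rw [dist_eq_norm]; exact hdist m x hx
  have hlim : ∀ x, ∃ a, x ∈ Metric.ball (0 : E) r → Tendsto (fun m => u m x) atTop (𝓝 a) := by
    intro x
    by_cases hx : x ∈ Metric.ball (0 : E) r
    · obtain ⟨a, ha⟩ := cauchySeq_tendsto_of_complete
        (cauchySeq_of_le_geometric (1 / 4) N (by norm_num) (hd x hx))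
      exact ⟨a, fun _ => ha⟩
    · exact ⟨1, fun h => absurd h hx⟩
  choose U₀ hU₀ using hlim
  have hbound : ∀ m, ∀ x ∈ Metric.ball (0 : E) r, ‖u m x - U₀ x‖ ≤ N * (1 / 4) ^ m / (1 - 1 / 4) :=
    fun m x hx => by
      rw [← dist_eq_norm]
      exact dist_le_of_le_geometric_of_tendsto (1 / 4) N (by norm_num) (hd x hx) (hU₀ x hx) m
  have hunif : TendstoUniformlyOn U' (fun x => mulForm (A x) (U₀ x)) atTop
      (Metric.ball (0 : E) r) := by
    rw [Metric.tendstoUniformlyOn_iff]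
    intro ε hε
    have hz : Tendsto (fun m : ℕ => 4 * C * N * (3 / 4 : ℝ) ^ m + C * (N * (1 / 4) ^ m / (1 - 1 / 4)))
        atTop (𝓝 0) := by
      have h1 := tendsto_pow_atTop_nhds_zero_of_lt_one (r := (3 / 4 : ℝ)) (by norm_num) (by norm_num)
      have h2 := tendsto_pow_atTop_nhds_zero_of_lt_one (r := (1 / 4 : ℝ)) (by norm_num) (by norm_num)
      simpa using (h1.const_mul (4 * C * N)).add (((h2.const_mul N).div_const (1 - 1 / 4)).const_mul C)
    filter_upwards [hz.eventually_lt_const hε] with m hm x hx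
    rw [dist_comm, dist_eq_norm]
    refine lt_of_le_of_lt ?_ hm
    have hs : U' m x - mulForm (A x) (U₀ x)
        = (U' m x - mulForm (A x) (u m x)) + mulForm (A x) (u m x - U₀ x) := by
      ext h
      simp [mul_sub]
    rw [hs]
    refine (norm_add_le _ _).trans (add_le_add (hR m x hx) ((norm_mulForm_le _ _).trans ?_))
    have h1 := hC x hx
    have h2 := hbound m x hx
    gcongr
  have hzero : ∀ m, u m 0 = 1 := by
    intro m
    cases m with
    | zero => rfl
    | succ m => rw [husucc]; simp [radialStep]
  by_cases hr : 0 < r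
  · refine ⟨U₀, ?_, fun x hx => hasFDerivAt_of_tendstoUniformlyOn Metric.isOpen_ball hunif
      (fun m y _ => hU' m y) (fun y hy => hU₀ y hy) hx⟩
    have h0 : Tendsto (fun m => u m 0) atTop (𝓝 (U₀ 0)) := hU₀ 0 (Metric.mem_ball_self hr)
    simp only [hzero] at h0
    exact tendsto_nhds_unique h0 tendsto_const_nhds
  · refine ⟨fun _ => 1, rfl, fun x hx => ?_⟩
    rw [Metric.ball_eq_empty.2 (not_lt.1 hr)] at hx
    exact hx.elim

-- Bootstrapping: if U is C^k, then its differential AU is C^k, so U is C^{k+1}.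
omit [FiniteDimensional ℝ E] [CompleteSpace 𝔸] in
theorem contDiffOn_of_hasFDerivAt_mulForm {A : E → E →L[ℝ] 𝔸} {U : E → 𝔸} {S : Set E}
    (hS : IsOpen S) (hA : ContDiffOn ℝ ∞ A S)
    (hU : ∀ x ∈ S, HasFDerivAt U (mulForm (A x) (U x)) x) : ContDiffOn ℝ ∞ U S := by
  rw [contDiffOn_infty]
  intro k
  induction k with
  | zero =>
    exact contDiffOn_zero.2 fun x hx => (hU x hx).continuousAt.continuousWithinAt
  | succ k ih =>
    rw [Nat.cast_succ, contDiffOn_succ_iff_fderiv_of_isOpen hS]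
    refine ⟨fun x hx => (hU x hx).differentiableAt.differentiableWithinAt, by simp, ?_⟩
    have h1 : ContDiffOn ℝ k (fun x => mulForm (A x) (U x)) S :=
      ContDiff.comp_contDiffOn (F := (E →L[ℝ] 𝔸) × 𝔸) (G := E →L[ℝ] 𝔸)
        (g := fun p : (E →L[ℝ] 𝔸) × 𝔸 => mulForm p.1 p.2) (f := fun x => (A x, U x))
        isBoundedBilinearMap_mulForm.contDiff ((contDiffOn_infty.1 hA k).prodMk ih)
    exact h1.congr fun x hx => (hU x hx).fderiv

/-- **Frobenius theorem** for linear systems: the system `dU = A U` satisfying the integrability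
condition has a smooth local fundamental solution. -/
theorem exists_fundamental_solution {A : E → E →L[ℝ] 𝔸} {y₀ : E} {R : ℝ} (hR : 0 < R)
    (hA : ContDiffOn ℝ ∞ A (Metric.ball y₀ R))
    (hint : ∀ y ∈ Metric.ball y₀ R, ∀ u v,
      fderiv ℝ A y u v + A y v * A y u = fderiv ℝ A y v u + A y u * A y v) :
    ∃ r, 0 < r ∧ r ≤ R ∧ ∃ U : E → 𝔸, U y₀ = 1 ∧ ContDiffOn ℝ ∞ U (Metric.ball y₀ r) ∧
      ∀ y ∈ Metric.ball y₀ r, HasFDerivAt U (mulForm (A y) (U y)) y := by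
  have : ProperSpace E := FiniteDimensional.proper ℝ E
  -- The cutoff makes the coefficients globally smooth, as the iteration requires, and leaves them
  -- unchanged within distance R/3 of `y₀`.
  let χ : ContDiffBump (0 : E) := ⟨R / 3, R / 2, by positivity, by linarith⟩
  let B : E → E →L[ℝ] 𝔸 := fun x => χ x • A (y₀ + x)
  have hshift : ∀ x : E, x ∈ Metric.ball (0 : E) R ↔ y₀ + x ∈ Metric.ball y₀ R := fun x => by simp
  have hBs : ContDiff ℝ ∞ B := by
    rw [contDiff_iff_contDiffAt]
    intro x
    by_cases hx : x ∈ Metric.ball (0 : E) R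
    · have h1 : ContDiffAt ℝ ∞ A (y₀ + x) :=
        hA.contDiffAt (Metric.isOpen_ball.mem_nhds ((hshift x).1 hx))
      exact χ.contDiff.contDiffAt.smul (h1.comp x (contDiffAt_const.add contDiffAt_id))
    · have hx' : x ∉ tsupport χ := by
        rw [χ.tsupport_eq]
        simp only [Metric.mem_ball, Metric.mem_closedBall, not_lt, not_le, dist_zero_right] at hx ⊢
        change R / 2 < ‖x‖
        linarith
      have : B =ᶠ[𝓝 x] fun _ => 0 := by
        filter_upwards [notMem_tsupport_iff_eventuallyEq.1 hx'] with y hy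
        ext h
        simp [B, hy]
      exact contDiffAt_const.congr_of_eventuallyEq this
  have hBd : ∀ x, HasFDerivAt B (fderiv ℝ B x) x := fun x =>
    (hBs.differentiable (by simp) x).hasFDerivAt
  have hBd' : Continuous (fderiv ℝ B) := hBs.continuous_fderiv (by simp)
  obtain ⟨C, hC⟩ := (isCompact_closedBall (0 : E) R).exists_bound_of_continuousOn
    hBs.continuous.continuousOn
  have hC0 : 0 ≤ C := (norm_nonneg _).trans (hC 0 (Metric.mem_closedBall_self hR.le))
  -- The first bound stays where the cutoff is 1; the second gives `C * r ≤ 1 / 4`, with `C + 1`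
  -- guarding against `C = 0`.
  let r := min (R / 3) (1 / (4 * (C + 1)))
  have hr : 0 < r := lt_min (by positivity) (by positivity)
  have hr3 : r ≤ R / 3 := min_le_left _ _
  have hr4 : C * r ≤ 1 / 4 := by
    have : r ≤ 1 / (4 * (C + 1)) := min_le_right _ _
    calc C * r ≤ (C + 1) * (1 / (4 * (C + 1))) := by gcongr; linarith
      _ = 1 / 4 := by field_simp
  have heq : ∀ x ∈ Metric.ball (0 : E) r, B =ᶠ[𝓝 x] fun x => A (y₀ + x) := by
    intro x hx
    have hx3 : x ∈ Metric.ball (0 : E) (R / 3) := Metric.ball_subset_ball hr3 hx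
    filter_upwards [Metric.isOpen_ball.mem_nhds hx3] with y hy
    have : χ y = 1 := χ.one_of_mem_closedBall (Metric.ball_subset_closedBall hy)
    simp [B, this]
  have hfd : ∀ x ∈ Metric.ball (0 : E) r, fderiv ℝ B x = fderiv ℝ A (y₀ + x) := by
    intro x hx
    rw [(heq x hx).fderiv_eq, fderiv_comp_add_left]
  have hballR : Metric.ball (0 : E) r ⊆ Metric.ball (0 : E) R :=
    Metric.ball_subset_ball (by linarith)
  obtain ⟨U, hU0, hU⟩ := exists_fundamental_solution_of_bound hBd hBd' hC0
    (fun x hx => hC x (Metric.ball_subset_closedBall (hballR hx))) hr4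
    (fun x hx u v => by
      rw [hfd x hx, (heq x hx).eq_of_nhds]
      exact hint _ ((hshift x).1 (hballR hx)) u v)
  have hUd : ∀ y ∈ Metric.ball y₀ r, HasFDerivAt (fun y => U (y - y₀))
      (mulForm (A y) (U (y - y₀))) y := by
    intro y hy
    have hy' : y - y₀ ∈ Metric.ball (0 : E) r := by
      rw [mem_ball_zero_iff]; rwa [mem_ball_iff_norm] at hy
    have h := hU _ hy'
    rw [(heq _ hy').eq_of_nhds, add_sub_cancel] at h
    simpa using! h.comp y ((hasFDerivAt_id y).sub_const y₀)
  exact ⟨r, hr, by linarith, fun y => U (y - y₀), by simpa using hU0,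
    contDiffOn_of_hasFDerivAt_mulForm Metric.isOpen_ball
      (hA.mono (Metric.ball_subset_ball (by linarith))) hUd, hUd⟩

end FrobeniusExistence

/-! ### Poincaré lemma, affine functions of a flat connection, unique continuation -/

section Applications

/-- The Frobenius theorem with coefficients factoring through a linear map into the algebra. -/
theorem exists_fundamental_solution_comp {E X 𝔸 : Type*} [NormedAddCommGroup E] [NormedSpace ℝ E]
    [FiniteDimensional ℝ E] [NormedRing 𝔸] [NormedAlgebra ℝ 𝔸] [CompleteSpace 𝔸]
    [NormedAddCommGroup X] [NormedSpace ℝ X] (Ψ : X →L[ℝ] 𝔸) {α : E → E →L[ℝ] X} {y₀ : E} {R : ℝ}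
    (hR : 0 < R) (hα : ContDiffOn ℝ ∞ α (Metric.ball y₀ R))
    (hint : ∀ y ∈ Metric.ball y₀ R, ∀ u v,
      Ψ (fderiv ℝ α y u v) + Ψ (α y v) * Ψ (α y u)
        = Ψ (fderiv ℝ α y v u) + Ψ (α y u) * Ψ (α y v)) :
    ∃ r, 0 < r ∧ r ≤ R ∧ ∃ U : E → 𝔸, U y₀ = 1 ∧ ContDiffOn ℝ ∞ U (Metric.ball y₀ r) ∧
      ∀ y ∈ Metric.ball y₀ r, HasFDerivAt U (mulForm (Ψ ∘L α y) (U y)) y := by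
  let Φ : (E →L[ℝ] X) →L[ℝ] (E →L[ℝ] 𝔸) := ContinuousLinearMap.compL ℝ E X 𝔸 Ψ
  have hfd : ∀ y ∈ Metric.ball y₀ R, fderiv ℝ (fun y => Φ (α y)) y = Φ ∘L fderiv ℝ α y := by
    intro y hy
    have h1 : DifferentiableAt ℝ α y :=
      (hα.contDiffAt (Metric.isOpen_ball.mem_nhds hy)).differentiableAt (by simp)
    exact (Φ.hasFDerivAt.comp y h1.hasFDerivAt).fderiv
  refine exists_fundamental_solution (A := fun y => Φ (α y)) hR (Φ.contDiff.comp_contDiffOn hα) ?_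
  intro y hy u v
  rw [hfd y hy]
  exact hint y hy u v

variable {E W : Type*} [NormedAddCommGroup E] [NormedSpace ℝ E] [FiniteDimensional ℝ E]
  [NormedAddCommGroup W] [NormedSpace ℝ W] [CompleteSpace W]

/-- Local solvability of an integrable linear system with given initial value. -/
theorem exists_solution_of_integrable {X : Type*} [NormedAddCommGroup X] [NormedSpace ℝ X]
    (Ψ : X →L[ℝ] W →L[ℝ] W) {α : E → E →L[ℝ] X} {y₀ : E} {R : ℝ}
    (hR : 0 < R) (hα : ContDiffOn ℝ ∞ α (Metric.ball y₀ R))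
    (hint : ∀ y ∈ Metric.ball y₀ R, ∀ u v w,
      Ψ (fderiv ℝ α y u v) w + Ψ (α y v) (Ψ (α y u) w)
        = Ψ (fderiv ℝ α y v u) w + Ψ (α y u) (Ψ (α y v) w)) (w₀ : W) :
    ∃ r, 0 < r ∧ r ≤ R ∧ ∃ s : E → W, s y₀ = w₀ ∧ ContDiffOn ℝ ∞ s (Metric.ball y₀ r) ∧
      ∀ y ∈ Metric.ball y₀ r, ∀ v, fderiv ℝ s y v = Ψ (α y v) (s y) := by
  obtain ⟨r, hr, hrR, U, hU0, hUs, hU⟩ := exists_fundamental_solution_comp Ψ hR hα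
    (fun y hy u v => ContinuousLinearMap.ext fun w => hint y hy u v w)
  refine ⟨r, hr, hrR, fun y => U y w₀, by simp [hU0], hUs.clm_apply contDiffOn_const,
    fun y hy v => ?_⟩
  have h : HasFDerivAt (fun y => U y w₀)
      ((ContinuousLinearMap.apply ℝ W w₀) ∘L mulForm (Ψ ∘L α y) (U y)) y :=
    (ContinuousLinearMap.apply ℝ W w₀).hasFDerivAt.comp y (hU y hy)
  rw [h.fderiv]
  simp

/-- **Poincaré lemma** for vector-valued 1-forms. -/
theorem exists_primitive_of_closed {α : E → E →L[ℝ] W} {y₀ : E} {R : ℝ} (hR : 0 < R)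
    (hα : ContDiffOn ℝ ∞ α (Metric.ball y₀ R))
    (hcl : ∀ y ∈ Metric.ball y₀ R, ∀ u v, fderiv ℝ α y u v = fderiv ℝ α y v u) :
    ∃ r, 0 < r ∧ r ≤ R ∧ ∃ G : E → W, ContDiffOn ℝ ∞ G (Metric.ball y₀ r) ∧
      ∀ y ∈ Metric.ball y₀ r, HasFDerivAt G (α y) y := by
  -- Homogenisation: the inhomogeneous equation dG = α becomes the linear system d(G,c) = (cα, 0) on
  -- `W × ℝ` with c = 1 at the centre. Products of two values of `Ψ` vanish, so its integrability
  -- condition is closedness of α.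
  let Ψ : W →L[ℝ] (W × ℝ →L[ℝ] W × ℝ) :=
    (ContinuousLinearMap.smulRightL ℝ (W × ℝ) (W × ℝ) (ContinuousLinearMap.snd ℝ W ℝ)) ∘L
      ContinuousLinearMap.inl ℝ W ℝ
  have hΨ : ∀ w z, Ψ w z = (z.2 • w, 0) := fun w z => by simp [Ψ]
  obtain ⟨r, hr, hrR, s, hs0, hs, hsd⟩ := exists_solution_of_integrable Ψ hR hα
    (fun y hy u v w => by simp [hΨ, hcl y hy u v]) (0, 1)
  have hdiff : ∀ y ∈ Metric.ball y₀ r, HasFDerivAt s (fderiv ℝ s y) y := fun y hy =>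
    ((hs.contDiffAt (Metric.isOpen_ball.mem_nhds hy)).differentiableAt (by simp)).hasFDerivAt
  have h2 : ∀ y ∈ Metric.ball y₀ r, (s y).2 = 1 := by
    have hd : ∀ y ∈ Metric.ball y₀ r, HasFDerivAt (fun y => (s y).2) (0 : E →L[ℝ] ℝ) y := by
      intro y hy
      refine ((ContinuousLinearMap.snd ℝ W ℝ).hasFDerivAt.comp y (hdiff y hy)).congr_fderiv ?_
      ext u
      simp [hΨ, hsd y hy]
    intro y hy
    have := (convex_ball y₀ r).is_const_of_fderivWithin_eq_zero (𝕜 := ℝ)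
      (f := fun y => (s y).2)
      (fun z hz => (hd z hz).differentiableAt.differentiableWithinAt)
      (fun z hz => by
        rw [fderivWithin_of_isOpen Metric.isOpen_ball hz, (hd z hz).fderiv]) hy
        (Metric.mem_ball_self hr)
    simpa [hs0] using this
  refine ⟨r, hr, hrR, fun y => (s y).1, contDiff_fst.comp_contDiffOn hs, fun y hy => ?_⟩
  refine ((ContinuousLinearMap.fst ℝ W ℝ).hasFDerivAt.comp y (hdiff y hy)).congr_fderiv ?_
  ext u
  simp [hΨ, h2 y hy, hsd y hy]

/-- A flat torsion-free connection with Christoffel symbols `Γ` has local affine functions with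
arbitrary differential at a point. -/
theorem exists_affine_of_flat {Γ : E → E →L[ℝ] E →L[ℝ] E} {y₀ : E} {R : ℝ} (hR : 0 < R)
    (hΓ : ContDiffOn ℝ ∞ Γ (Metric.ball y₀ R))
    (hsymm : ∀ y ∈ Metric.ball y₀ R, ∀ u v, Γ y u v = Γ y v u)
    (hflat : ∀ y ∈ Metric.ball y₀ R, ∀ u v w,
      fderiv ℝ Γ y u v w + Γ y u (Γ y v w) = fderiv ℝ Γ y v u w + Γ y v (Γ y u w))
    (ξ : E →L[ℝ] W) :
    ∃ r, 0 < r ∧ r ≤ R ∧ ∃ G : E → W, ContDiffOn ℝ ∞ G (Metric.ball y₀ r) ∧ fderiv ℝ G y₀ = ξ ∧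
      ∀ y ∈ Metric.ball y₀ r, ∀ u v,
        fderiv ℝ (fderiv ℝ G) y u v = fderiv ℝ G y (Γ y u v) := by
  -- The system for parallel coframes, dα(u) = α ∘ Γ(u). Precomposition reverses products, so the
  -- quadratic terms come out in the order of the flatness identity. Symmetry of Γ then makes α
  -- closed.
  obtain ⟨r, hr, hrR, α, hα0, hα, hαd⟩ := exists_solution_of_integrable
    (ContinuousLinearMap.compL ℝ E E W).flip hR hΓ
    (fun y hy u v w => by
      ext h
      have := hflat y hy u v h
      simp only [ContinuousLinearMap.flip_apply, ContinuousLinearMap.compL_apply,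
        _root_.add_apply, ContinuousLinearMap.comp_apply, ← map_add]
      rw [this]) ξ
  obtain ⟨r', hr', hrr', G, hG, hGd⟩ := exists_primitive_of_closed hr hα (fun y hy u v => by
    rw [hαd y hy, hαd y hy]
    simp only [ContinuousLinearMap.flip_apply, ContinuousLinearMap.compL_apply,
      ContinuousLinearMap.comp_apply]
    rw [hsymm y (Metric.ball_subset_ball hrR hy)])
  refine ⟨r', hr', hrr'.trans hrR, G, hG, ?_, fun y hy u v => ?_⟩
  · rw [(hGd y₀ (Metric.mem_ball_self hr')).fderiv, hα0]
  · have : fderiv ℝ G =ᶠ[nhds y] α := by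
      filter_upwards [Metric.isOpen_ball.mem_nhds hy] with z hz using (hGd z hz).fderiv
    rw [this.fderiv_eq, hαd y (Metric.ball_subset_ball hrr' hy), this.eq_of_nhds]
    rfl

/-- A function on a convex open set whose differential is bounded by a multiple of its norm and
which vanishes at a point vanishes. -/
theorem eq_zero_of_norm_fderiv_le {E W : Type*} [NormedAddCommGroup E] [NormedSpace ℝ E]
    [NormedAddCommGroup W] [NormedSpace ℝ W] {S : Set E} (hS : Convex ℝ S)
    {H : E → W} {H' : E → E →L[ℝ] W} {K : ℝ} {y₀ : E} (h₀ : y₀ ∈ S) (hH0 : H y₀ = 0)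
    (hH : ∀ y ∈ S, HasFDerivAt H (H' y) y) (hK : ∀ y ∈ S, ‖H' y‖ ≤ K * ‖H y‖) :
    ∀ y ∈ S, H y = 0 := by
  intro y hy
  have hmem : ∀ t ∈ Set.Icc (0:ℝ) 1, y₀ + t • (y - y₀) ∈ S := fun t ht =>
    hS.add_smul_sub_mem h₀ hy ht
  have hd : ∀ t ∈ Set.Icc (0:ℝ) 1, HasDerivAt (fun t : ℝ => H (y₀ + t • (y - y₀)))
      (H' (y₀ + t • (y - y₀)) (y - y₀)) t := by
    intro t ht
    have hs : HasDerivAt (fun t : ℝ => y₀ + t • (y - y₀)) (y - y₀) t := by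
      simpa using ((hasDerivAt_id t).smul_const (y - y₀)).const_add y₀
    exact (hH _ (hmem t ht)).comp_hasDerivAt t hs
  -- Grönwall's inequality for the restriction of `H` to the segment from `y₀` to `y`.
  have := eq_zero_of_abs_deriv_le_mul_abs_self_of_eq_zero_right
    (f := fun t : ℝ => H (y₀ + t • (y - y₀))) (f' := fun t => H' (y₀ + t • (y - y₀)) (y - y₀))
    (K := K * ‖y - y₀‖) (a := 0) (b := 1)
    (fun t ht => (hd t ht).continuousAt.continuousWithinAt)
    (fun t ht => (hd t ⟨ht.1, ht.2.le⟩).hasDerivWithinAt) (by simpa using hH0)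
    (fun t ht => by
      refine ((H' _).le_opNorm _).trans ?_
      have := hK _ (hmem t ⟨ht.1, ht.2.le⟩)
      calc _ ≤ (K * ‖H (y₀ + t • (y - y₀))‖) * ‖y - y₀‖ := by gcongr
        _ = _ := by ring) 1 (by simp)
  simpa using this

end Applications

/-! ### Linear symplectic bases, possibly adapted to a complex structure -/

section SymplecticBasis

variable {V : Type*} [NormedAddCommGroup V] [NormedSpace ℝ V]

/-- A partial symplectic basis of an alternating form, with a relation imposed on each pair. -/
structure IsSymplecticFamily (σ : V →L[ℝ] V →L[ℝ] ℝ) (P : V → V → Prop) {k : ℕ}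
    (a b : Fin k → V) : Prop where
  aa : ∀ i j, σ (a i) (a j) = 0
  bb : ∀ i j, σ (b i) (b j) = 0
  ab : ∀ i j, σ (a i) (b j) = if i = j then 1 else 0
  rel : ∀ i, P (a i) (b i)

/-- The symplectic complement of a family of pairs. -/
def IsOrthogonalTo (σ : V →L[ℝ] V →L[ℝ] ℝ) {k : ℕ} (a b : Fin k → V) (v : V) : Prop :=
  ∀ i, σ (a i) v = 0 ∧ σ (b i) v = 0

variable {σ : V →L[ℝ] V →L[ℝ] ℝ} {P : V → V → Prop}

theorem alternating_swap (hσ : ∀ v, σ v v = 0) (u v : V) : σ u v = - σ v u := by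
  have h := hσ (u + v)
  simp only [map_add, _root_.add_apply, hσ, zero_add, add_zero] at h
  linarith

namespace IsSymplecticFamily

variable {k : ℕ} {a b : Fin k → V}

/-- Symplectic Gram–Schmidt; the signs of the two sums differ because σ(a_i,b_i) = 1 while
σ(b_i,a_i) = −1. -/
theorem isOrthogonalTo_sub (hσ : ∀ v, σ v v = 0) (h : IsSymplecticFamily σ P a b) (v : V) :
    IsOrthogonalTo σ a b (v - ∑ i, σ v (b i) • a i + ∑ i, σ v (a i) • b i) := by
  intro j
  have hba : ∀ i, σ (b j) (a i) = if i = j then -1 else 0 := fun i => by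
    rw [alternating_swap hσ, h.ab]; split_ifs <;> simp
  constructor
  · simp [h.aa, h.ab, alternating_swap hσ (a j) v]
  · simp [h.bb, hba, alternating_swap hσ (b j) v]

/-- Nondegeneracy supplies a partner of `v`; projecting it to the symplectic complement does not
change its pairing with `v`, which is itself orthogonal to the family. Rescaling makes the pairing
1. -/
theorem exists_pair (hσ : ∀ v, σ v v = 0) (hnd : ∀ v, (∀ w, σ v w = 0) → v = 0)
    (h : IsSymplecticFamily σ P a b) {v : V} (hv : v ≠ 0) (hov : IsOrthogonalTo σ a b v) :
    ∃ w, IsOrthogonalTo σ a b w ∧ σ v w = 1 := by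
  obtain ⟨w, hw⟩ : ∃ w, σ v w ≠ 0 := by
    by_contra! hc
    exact hv (hnd v hc)
  refine ⟨(σ v w)⁻¹ • (w - ∑ i, σ w (b i) • a i + ∑ i, σ w (a i) • b i), fun i => ?_, ?_⟩
  · have := h.isOrthogonalTo_sub hσ w i
    rw [map_smul, map_smul, this.1, this.2]
    simp
  · have h1 : ∀ i, σ v (a i) = 0 := fun i => by rw [alternating_swap hσ, (hov i).1, neg_zero]
    have h2 : ∀ i, σ v (b i) = 0 := fun i => by rw [alternating_swap hσ, (hov i).2, neg_zero]
    simp [h1, h2, hw]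

theorem snoc (hσ : ∀ v, σ v v = 0) (h : IsSymplecticFamily σ P a b) {x y : V}
    (hx : IsOrthogonalTo σ a b x) (hy : IsOrthogonalTo σ a b y) (hxy : σ x y = 1) (hP : P x y) :
    IsSymplecticFamily σ P (Fin.snoc a x : Fin (k + 1) → V) (Fin.snoc b y : Fin (k + 1) → V) where
  aa i j := by
    induction i using Fin.lastCases with
    | last =>
      induction j using Fin.lastCases with
      | last => simp [hσ]
      | cast j => rw [alternating_swap hσ]; simp [(hx j).1]
    | cast i =>
      induction j using Fin.lastCases with
      | last => simp [(hx i).1]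
      | cast j => simp [h.aa]
  bb i j := by
    induction i using Fin.lastCases with
    | last =>
      induction j using Fin.lastCases with
      | last => simp [hσ]
      | cast j => rw [alternating_swap hσ]; simp [(hy j).2]
    | cast i =>
      induction j using Fin.lastCases with
      | last => simp [(hy i).2]
      | cast j => simp [h.bb]
  ab i j := by
    induction i using Fin.lastCases with
    | last =>
      induction j using Fin.lastCases with
      | last => simp [hxy]
      | cast j =>
        rw [alternating_swap hσ]
        simp [(hx j).2, (Fin.castSucc_lt_last j).ne']
    | cast i =>
      induction j using Fin.lastCases with
      | last => simp [(hy i).1, (Fin.castSucc_lt_last i).ne]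
      | cast j => simp [h.ab]
  rel i := by
    induction i using Fin.lastCases with
    | last => simpa using hP
    | cast i => simpa using h.rel i

end IsSymplecticFamily

/-- The hypothesis under which partial symplectic bases can be enlarged. -/
def CanExtend (σ : V →L[ℝ] V →L[ℝ] ℝ) (P : V → V → Prop) : Prop :=
  ∀ (k : ℕ) (a b : Fin k → V), IsSymplecticFamily σ P a b → ∀ v, v ≠ 0 → IsOrthogonalTo σ a b v →
    ∃ x y, IsOrthogonalTo σ a b x ∧ IsOrthogonalTo σ a b y ∧ σ x y = 1 ∧ P x y

/-- Fewer than n pairs span a proper subspace. A vector outside it has a nonzero projection to the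
symplectic complement, and there the extension hypothesis provides one more pair. -/
theorem exists_isSymplecticFamily {n : ℕ} (hn : Module.finrank ℝ V = 2 * n)
    (hσ : ∀ v, σ v v = 0) (hext : CanExtend σ P) :
    ∀ k ≤ n, ∃ a b : Fin k → V, IsSymplecticFamily σ P a b := by
  intro k
  induction k with
  | zero =>
    exact fun _ => ⟨Fin.elim0, Fin.elim0, fun i => i.elim0, fun i => i.elim0, fun i => i.elim0,
      fun i => i.elim0⟩
  | succ k ih =>
    intro hk
    obtain ⟨a, b, h⟩ := ih (by omega)
    have hspan : Submodule.span ℝ (Set.range (Sum.elim a b)) ≠ ⊤ := by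
      intro htop
      have h1 := finrank_range_le_card (R := ℝ) (Sum.elim a b)
      rw [Set.finrank, htop, finrank_top, hn] at h1
      simp at h1
      omega
    obtain ⟨v, -, hv⟩ := SetLike.exists_of_lt hspan.lt_top
    have hmem : ∀ s, Sum.elim a b s ∈ Submodule.span ℝ (Set.range (Sum.elim a b)) := fun s =>
      Submodule.subset_span ⟨s, rfl⟩
    obtain ⟨x, y, hx, hy, hxy, hP⟩ := hext k a b h _ (fun h0 => hv (by
      have : v = ∑ i, σ v (b i) • a i - ∑ i, σ v (a i) • b i := by
        rw [← sub_eq_zero, ← h0]; abel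
      rw [this]
      exact Submodule.sub_mem _
        (Submodule.sum_mem _ fun i _ => Submodule.smul_mem _ _ (hmem (Sum.inl i)))
        (Submodule.sum_mem _ fun i _ => Submodule.smul_mem _ _ (hmem (Sum.inr i)))))
      (h.isOrthogonalTo_sub hσ v)
    exact ⟨_, _, h.snoc hσ hx hy hxy hP⟩

variable [FiniteDimensional ℝ V]

/-- Existence of linear symplectic coordinates. -/
theorem exists_symplectic_equiv {n : ℕ} (hn : Module.finrank ℝ V = 2 * n)
    (hσ : ∀ v, σ v v = 0) (hext : CanExtend σ P) :
    ∃ ξ : V ≃L[ℝ] (Fin n ⊕ Fin n → ℝ),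
      (∀ u v, σ u v = ∑ i, (ξ u (Sum.inl i) * ξ v (Sum.inr i) - ξ v (Sum.inl i) * ξ u (Sum.inr i))) ∧
      ∀ i, P (ξ.symm (Pi.single (Sum.inl i) 1)) (ξ.symm (Pi.single (Sum.inr i) 1)) := by
  obtain ⟨a, b, h⟩ := exists_isSymplecticFamily hn hσ hext n le_rfl
  have hba : ∀ i j, σ (b i) (a j) = if j = i then -1 else 0 := fun i j => by
    rw [alternating_swap hσ, h.ab]; split_ifs <;> simp
  let s : (Fin n ⊕ Fin n → ℝ) →ₗ[ℝ] V := Fintype.linearCombination ℝ (Sum.elim a b)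
  have hs : ∀ c, s c = ∑ i, c (Sum.inl i) • a i + ∑ i, c (Sum.inr i) • b i := fun c => by
    simp [s, Fintype.linearCombination_apply]
  -- Pairing with the dual members of the family recovers the coefficients, which yields both
  -- injectivity and the formula for σ.
  have hl : ∀ c i, σ (s c) (b i) = c (Sum.inl i) := fun c i => by simp [hs, h.ab, h.bb]
  have hr : ∀ c i, σ (s c) (a i) = - c (Sum.inr i) := fun c i => by
    simp [hs, h.aa, hba]
  have hinj : Function.Injective s := by
    intro c d hcd
    funext k
    rcases k with i | i
    · rw [← hl c, hcd, hl]
    · rw [← neg_inj, ← hr c, hcd, hr]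
  let e : (Fin n ⊕ Fin n → ℝ) ≃ₗ[ℝ] V := LinearEquiv.ofInjectiveOfFinrankEq s hinj (by simp [hn]; ring)
  have he : ∀ c, e c = s c := fun c => rfl
  refine ⟨e.symm.toContinuousLinearEquiv, fun u v => ?_, fun i => ?_⟩
  · obtain ⟨c, rfl⟩ := e.surjective u
    obtain ⟨d, rfl⟩ := e.surjective v
    simp only [LinearEquiv.coe_toContinuousLinearEquiv', LinearEquiv.symm_apply_apply]
    have h1 : σ (e c) (e d) = ∑ i, d (Sum.inl i) * -c (Sum.inr i)
        + ∑ i, d (Sum.inr i) * c (Sum.inl i) := by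
      rw [he, he, hs d]
      simp only [map_add, map_sum, map_smul, hl, hr, smul_eq_mul]
    rw [h1]
    rw [← Finset.sum_add_distrib]
    exact Finset.sum_congr rfl fun i _ => by ring
  · have h1 : e (Pi.single (Sum.inl i) 1) = a i := by simp [he, s]
    have h2 : e (Pi.single (Sum.inr i) 1) = b i := by simp [he, s]
    have := h.rel i
    rw [← h1, ← h2] at this
    exact this

omit [FiniteDimensional ℝ V] in
theorem canExtend_of_nondegenerate (hσ : ∀ v, σ v v = 0) (hnd : ∀ v, (∀ w, σ v w = 0) → v = 0) :
    CanExtend σ fun _ _ => True := by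
  intro k a b h v hv hov
  obtain ⟨w, hw, hvw⟩ := h.exists_pair hσ hnd hv hov
  exact ⟨v, w, hov, hw, hvw, trivial⟩

-- The complement is stable under `j`, and the quadratic form σ(x, jx) does not vanish identically
-- on it. Any x with σ(x, jx) ≠ 0 can be paired with a multiple of jx; the sign of this number is
-- irrelevant, so indefinite metrics are covered.
omit [FiniteDimensional ℝ V] in
theorem canExtend_of_complexStructure (hσ : ∀ v, σ v v = 0)
    (hnd : ∀ v, (∀ w, σ v w = 0) → v = 0) (j : V →L[ℝ] V) (hj : ∀ v, j (j v) = -v)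
    (hinv : ∀ u v, σ (j u) (j v) = σ u v) : CanExtend σ fun x y => ∃ c : ℝ, y = c • j x := by
  have hadj : ∀ u v, σ u (j v) = - σ (j u) v := fun u v => by
    rw [← hinv, hj, map_neg]
  intro k a b h v hv hov
  -- Each b_i is a nonzero multiple of j a_i, so orthogonality to a_i and to b_i are exchanged by
  -- `j`.
  have hJ : ∀ x, IsOrthogonalTo σ a b x → IsOrthogonalTo σ a b (j x) := by
    intro x hx i
    obtain ⟨c, hc⟩ := h.rel i
    have hc0 : c ≠ 0 := by
      rintro rfl
      have := h.ab i i
      rw [hc] at this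
      simp at this
    have h1 := (hx i).2
    rw [hc, map_smul, _root_.smul_apply, smul_eq_mul, mul_eq_zero] at h1
    have h1' := h1.resolve_left hc0
    refine ⟨by rw [hadj, h1', neg_zero], ?_⟩
    rw [hc, map_smul, _root_.smul_apply, hinv, (hx i).1, smul_zero]
  obtain ⟨w, hw, hvw⟩ := h.exists_pair hσ hnd hv hov
  have hsum : ∀ {x y}, IsOrthogonalTo σ a b x → IsOrthogonalTo σ a b y →
      IsOrthogonalTo σ a b (x + y) := fun {x y} hx hy i =>
    ⟨by rw [map_add, (hx i).1, (hy i).1, add_zero], by rw [map_add, (hx i).2, (hy i).2, add_zero]⟩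
  -- Polarisation: if the quadratic form vanished at v, at jw and at v + jw, its cross term σ(v,
  -- jjw) + σ(jw, jv) = −2 would be zero.
  obtain ⟨x, hx, hgx⟩ : ∃ x, IsOrthogonalTo σ a b x ∧ σ x (j x) ≠ 0 := by
    by_contra! hc
    have h1 := hc v hov
    have h2 := hc (j w) (hJ w hw)
    have h3 := hc (v + j w) (hsum hov (hJ w hw))
    have h4 : σ v (j (j w)) = -1 := by rw [hj, map_neg, hvw]
    have h5 : σ (j w) (j v) = -1 := by rw [hinv, alternating_swap hσ, hvw]
    simp only [map_add, _root_.add_apply, h1, h2, h4, h5] at h3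
    norm_num at h3
  refine ⟨x, (σ x (j x))⁻¹ • j x, hx, fun i => ?_, ?_, _, rfl⟩
  · rw [map_smul, map_smul, (hJ x hx i).1, (hJ x hx i).2]; simp
  · simp [hgx]

end SymplecticBasis

/-! ### Tangent vectors, fields and functions in a chart -/

section Coordinates

open Filter Topology

variable {n : ℕ} {M : Type*} [TopologicalSpace M] [ChartedSpace (Fin n → ℂ) M]
  [IsManifold 𝓘(ℂ, Fin n → ℂ) ω M]

/-- The components of tangent vectors at `q` in the preferred chart at `p`. -/
def coordMap (p q : M) : TangentSpace 𝓘(ℝ, Fin n → ℂ) q →L[ℝ] (Fin n → ℂ) :=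
  (trivializationAt (Fin n → ℂ) (TangentSpace 𝓘(ℝ, Fin n → ℂ) : M → Type _) p).continuousLinearMapAt
    ℝ q

/-- The tangent vector at `q` with given components in the preferred chart at `p`. -/
def coordInv (p q : M) : (Fin n → ℂ) →L[ℝ] TangentSpace 𝓘(ℝ, Fin n → ℂ) q :=
  (trivializationAt (Fin n → ℂ) (TangentSpace 𝓘(ℝ, Fin n → ℂ) : M → Type _) p).symmL ℝ q

/-- The vector field with given constant components in the preferred chart at `p`. -/
def frame (p : M) (v : Fin n → ℂ) : VField n M := fun q => coordInv p q v

/-- The components of a vector field in the preferred chart at `p`. -/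
def fieldRep (p : M) (X : VField n M) (y : Fin n → ℂ) : Fin n → ℂ :=
  coordMap p ((chartAt (Fin n → ℂ) p).symm y) (X ((chartAt (Fin n → ℂ) p).symm y))

/-- The expression of a function in the preferred chart at `p`. -/
def funRep {W : Type*} (p : M) (f : M → W) (y : Fin n → ℂ) : W :=
  f ((chartAt (Fin n → ℂ) p).symm y)

variable {p q : M}

theorem coordMap_coordInv (hq : q ∈ (chartAt (Fin n → ℂ) p).source) (v : Fin n → ℂ) :
    coordMap p q (coordInv p q v) = v :=
  Trivialization.continuousLinearMapAt_symmL _ (by simpa using hq) v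

theorem coordInv_coordMap (hq : q ∈ (chartAt (Fin n → ℂ) p).source)
    (v : TangentSpace 𝓘(ℝ, Fin n → ℂ) q) : coordInv p q (coordMap p q v) = v :=
  Trivialization.symmL_continuousLinearMapAt _ (by simpa using hq) v

theorem coordMap_eq_mfderiv (hq : q ∈ (chartAt (Fin n → ℂ) p).source) :
    coordMap p q = mfderiv 𝓘(ℝ, Fin n → ℂ) 𝓘(ℝ, Fin n → ℂ) (chartAt (Fin n → ℂ) p) q := by
  have := TangentBundle.continuousLinearMapAt_trivializationAt (I := 𝓘(ℝ, Fin n → ℂ)) hq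
  simpa [coordMap] using this

theorem contMDiffAt_field_iff (hq : q ∈ (chartAt (Fin n → ℂ) p).source) {X : VField n M} {k : ℕ∞ω} :
    ContMDiffAt 𝓘(ℝ, Fin n → ℂ) (𝓘(ℝ, Fin n → ℂ).tangent) k
      (fun x => (⟨x, X x⟩ : TangentBundle 𝓘(ℝ, Fin n → ℂ) M)) q ↔
    ContMDiffAt 𝓘(ℝ, Fin n → ℂ) 𝓘(ℝ, Fin n → ℂ) k (fun x => coordMap p x (X x)) q := by
  have hb : q ∈ (trivializationAt (Fin n → ℂ)
      (TangentSpace 𝓘(ℝ, Fin n → ℂ) : M → Type _) p).baseSet := by simpa using hq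
  have : ContMDiffVectorBundle k (Fin n → ℂ) (TangentSpace 𝓘(ℝ, Fin n → ℂ) : M → Type _)
      𝓘(ℝ, Fin n → ℂ) := by
    have : IsManifold 𝓘(ℝ, Fin n → ℂ) (k + 1) M :=  IsManifold.of_le (n := ω) le_top
    infer_instance
  refine ((trivializationAt (Fin n → ℂ) (TangentSpace 𝓘(ℝ, Fin n → ℂ) : M → Type _)
    p).contMDiffAt_section_iff hb).trans ?_
  refine Filter.EventuallyEq.contMDiffAt_iff ?_
  filter_upwards [(chartAt (Fin n → ℂ) p).open_source.mem_nhds hq] with x hx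
  exact (Trivialization.continuousLinearMapAt_apply_of_mem ℝ _ (by simpa using hx) _).symm

theorem mdifferentiableAt_field_iff (hq : q ∈ (chartAt (Fin n → ℂ) p).source) {X : VField n M} :
    MDifferentiableAt 𝓘(ℝ, Fin n → ℂ) (𝓘(ℝ, Fin n → ℂ).tangent)
      (fun x => (⟨x, X x⟩ : TangentBundle 𝓘(ℝ, Fin n → ℂ) M)) q ↔
    MDifferentiableAt 𝓘(ℝ, Fin n → ℂ) 𝓘(ℝ, Fin n → ℂ) (fun x => coordMap p x (X x)) q := by
  have hb : q ∈ (trivializationAt (Fin n → ℂ)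
      (TangentSpace 𝓘(ℝ, Fin n → ℂ) : M → Type _) p).baseSet := by simpa using hq
  refine ((trivializationAt (Fin n → ℂ) (TangentSpace 𝓘(ℝ, Fin n → ℂ) : M → Type _)
    p).mdifferentiableAt_section_iff _ _ hb).trans ?_
  refine Filter.EventuallyEq.mdifferentiableAt_iff ?_
  filter_upwards [(chartAt (Fin n → ℂ) p).open_source.mem_nhds hq] with x hx
  exact (Trivialization.continuousLinearMapAt_apply_of_mem ℝ _ (by simpa using hx) _).symm

variable {W : Type*} [NormedAddCommGroup W] [NormedSpace ℝ W]

theorem contMDiffAt_iff_funRep (hq : q ∈ (chartAt (Fin n → ℂ) p).source) {f : M → W} {k : ℕ∞ω} :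
    ContMDiffAt 𝓘(ℝ, Fin n → ℂ) 𝓘(ℝ, W) k f q ↔
      ContDiffAt ℝ k (funRep p f) (chartAt (Fin n → ℂ) p q) := by
  have : IsManifold 𝓘(ℝ, Fin n → ℂ) k M :=  IsManifold.of_le (n := ω) le_top
  rw [contMDiffAt_iff_source_of_mem_source (x := p) hq]
  simp only [mfld_simps, contMDiffWithinAt_univ]
  exact contMDiffAt_iff_contDiffAt

theorem mdifferentiableAt_iff_funRep (hq : q ∈ (chartAt (Fin n → ℂ) p).source) {f : M → W} :
    MDifferentiableAt 𝓘(ℝ, Fin n → ℂ) 𝓘(ℝ, W) f q ↔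
      DifferentiableAt ℝ (funRep p f) (chartAt (Fin n → ℂ) p q) := by
  rw [← mdifferentiableWithinAt_univ, mdifferentiableWithinAt_iff_source_of_mem_source (x := p) hq]
  simp only [mfld_simps, mdifferentiableWithinAt_univ]
  exact mdifferentiableAt_iff_differentiableAt

theorem mfderiv_eq_fderiv_funRep (hq : q ∈ (chartAt (Fin n → ℂ) p).source) {f : M → W}
    (hf : MDifferentiableAt 𝓘(ℝ, Fin n → ℂ) 𝓘(ℝ, W) f q) (v : TangentSpace 𝓘(ℝ, Fin n → ℂ) q) :
    mvfderiv 𝓘(ℝ, Fin n → ℂ) f q v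
      = fderiv ℝ (funRep p f) (chartAt (Fin n → ℂ) p q) (coordMap p q v) := by
  have h1 : MDifferentiableAt 𝓘(ℝ, Fin n → ℂ) 𝓘(ℝ, Fin n → ℂ) (chartAt (Fin n → ℂ) p) q :=
    mdifferentiableAt_atlas (chart_mem_atlas _ p) hq
  have h2 := (mdifferentiableAt_iff_funRep hq).1 hf
  have heq : f =ᶠ[𝓝 q] funRep p f ∘ chartAt (Fin n → ℂ) p := by
    filter_upwards [(chartAt (Fin n → ℂ) p).open_source.mem_nhds hq] with x hx
    simp [funRep, (chartAt (Fin n → ℂ) p).left_inv hx]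
  have h3 := (h2.hasFDerivAt.hasMFDerivAt.comp q h1.hasMFDerivAt).congr_of_eventuallyEq heq
  rw [mvfderiv, h3.mfderiv, coordMap_eq_mfderiv hq]
  rfl

theorem dAt_eq_fderiv (hq : q ∈ (chartAt (Fin n → ℂ) p).source) {f : M → ℝ}
    (hf : MDifferentiableAt 𝓘(ℝ, Fin n → ℂ) 𝓘(ℝ, ℝ) f q) (v : TangentSpace 𝓘(ℝ, Fin n → ℂ) q) :
    dAt f q v = fderiv ℝ (funRep p f) (chartAt (Fin n → ℂ) p q) (coordMap p q v) :=
  mfderiv_eq_fderiv_funRep hq hf v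

/-- The chart components at `q` are the real derivative of a transition map between holomorphic
charts, which is complex linear. -/
theorem coordMap_J (hq : q ∈ (chartAt (Fin n → ℂ) p).source) (v : TangentSpace 𝓘(ℝ, Fin n → ℂ) q) :
    coordMap p q (J q v) = Complex.I • coordMap p q v := by
  have h := TangentBundle.continuousLinearMapAt_trivializationAt_eq_core (I := 𝓘(ℝ, Fin n → ℂ)) hq
  have hd : DifferentiableAt ℂ (chartAt (Fin n → ℂ) p ∘ (chartAt (Fin n → ℂ) q).symm)
      (chartAt (Fin n → ℂ) q q) := by
    have h1 := (contDiffGroupoid ω 𝓘(ℂ, Fin n → ℂ)).compatible (chart_mem_atlas (Fin n → ℂ) q)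
      (chart_mem_atlas (Fin n → ℂ) p)
    rw [contDiffGroupoid, mem_groupoid_of_pregroupoid] at h1
    have h2 : ContDiffOn ℂ ω _ _ := h1.1
    refine (h2.contDiffAt (x := chartAt (Fin n → ℂ) q q) ?_).differentiableAt (by simp)
    refine IsOpen.mem_nhds ?_ ?_
    · simpa using ((chartAt (Fin n → ℂ) q).symm.trans (chartAt (Fin n → ℂ) p)).open_source
    · simp [hq]
  have h3 : (coordMap p q : (Fin n → ℂ) →L[ℝ] (Fin n → ℂ)) = fderiv ℝ (chartAt (Fin n → ℂ) p ∘ (chartAt (Fin n → ℂ) q).symm)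
      (chartAt (Fin n → ℂ) q q) := by
    rw [tangentBundleCore_coordChange] at h
    simp only [mfld_simps, fderivWithin_univ] at h
    exact h
  have h4 : fderiv ℝ (chartAt (Fin n → ℂ) p ∘ (chartAt (Fin n → ℂ) q).symm) (chartAt (Fin n → ℂ) q q)
      = (fderiv ℂ (chartAt (Fin n → ℂ) p ∘ (chartAt (Fin n → ℂ) q).symm)
        (chartAt (Fin n → ℂ) q q)).restrictScalars ℝ := hd.fderiv_restrictScalars ℝ
  have h5 : ∀ (L : (Fin n → ℂ) →L[ℝ] (Fin n → ℂ)) (L' : (Fin n → ℂ) →L[ℂ] (Fin n → ℂ))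
      (v : Fin n → ℂ), L = L'.restrictScalars ℝ → L (Complex.I • v) = Complex.I • L v := by
    rintro _ L' v rfl
    exact L'.map_smul Complex.I v
  exact h5 _ _ v (Eq.trans h3 h4)

end Coordinates

/-! ### The connection in a chart: Christoffel symbols -/

section ConnectionCoordinates

open Filter Topology

variable {n : ℕ} {M : Type*} [TopologicalSpace M] [ChartedSpace (Fin n → ℂ) M]
  [IsManifold 𝓘(ℂ, Fin n → ℂ) ω M] {p q : M}

theorem mdifferentiableAt_field_iff_fieldRep (hq : q ∈ (chartAt (Fin n → ℂ) p).source)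
    {X : VField n M} :
    MDifferentiableAt 𝓘(ℝ, Fin n → ℂ) (𝓘(ℝ, Fin n → ℂ).tangent)
      (fun x => (⟨x, X x⟩ : TangentBundle 𝓘(ℝ, Fin n → ℂ) M)) q ↔
    DifferentiableAt ℝ (fieldRep p X) (chartAt (Fin n → ℂ) p q) :=
  (mdifferentiableAt_field_iff hq).trans (mdifferentiableAt_iff_funRep hq)

theorem contMDiffAt_field_iff_fieldRep (hq : q ∈ (chartAt (Fin n → ℂ) p).source)
    {X : VField n M} {k : ℕ∞ω} :
    ContMDiffAt 𝓘(ℝ, Fin n → ℂ) (𝓘(ℝ, Fin n → ℂ).tangent) k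
      (fun x => (⟨x, X x⟩ : TangentBundle 𝓘(ℝ, Fin n → ℂ) M)) q ↔
    ContDiffAt ℝ k (fieldRep p X) (chartAt (Fin n → ℂ) p q) :=
  (contMDiffAt_field_iff hq).trans (contMDiffAt_iff_funRep hq)

theorem fieldRep_chartAt (hq : q ∈ (chartAt (Fin n → ℂ) p).source) (X : VField n M) :
    fieldRep p X (chartAt (Fin n → ℂ) p q) = coordMap p q (X q) := by
  have h : (chartAt (Fin n → ℂ) p).symm (chartAt (Fin n → ℂ) p q) = q :=
    (chartAt (Fin n → ℂ) p).left_inv hq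
  -- The tangent space depends on the base point, so the equality of points is substituted in a
  -- statement generalised over `q'`.
  have : ∀ q', q' = q → (coordMap p q' (X q') : Fin n → ℂ) = coordMap p q (X q) := by
    rintro _ rfl; rfl
  exact this _ h

theorem fieldRep_frame {y : Fin n → ℂ} (hy : y ∈ (chartAt (Fin n → ℂ) p).target) (v : Fin n → ℂ) :
    fieldRep p (frame p v : VField n M) y = v :=
  coordMap_coordInv ((chartAt (Fin n → ℂ) p).map_target hy) v

theorem fieldRep_frame_eventuallyEq (hq : q ∈ (chartAt (Fin n → ℂ) p).source) (v : Fin n → ℂ) :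
    fieldRep p (frame p v : VField n M) =ᶠ[𝓝 (chartAt (Fin n → ℂ) p q)] fun _ => v := by
  filter_upwards [(chartAt (Fin n → ℂ) p).open_target.mem_nhds
    ((chartAt (Fin n → ℂ) p).map_source hq)] with y hy using fieldRep_frame hy v

theorem contMDiffAt_frame (hq : q ∈ (chartAt (Fin n → ℂ) p).source) (v : Fin n → ℂ) {k : ℕ∞ω} :
    ContMDiffAt 𝓘(ℝ, Fin n → ℂ) (𝓘(ℝ, Fin n → ℂ).tangent) k
      (fun x => (⟨x, frame p v x⟩ : TangentBundle 𝓘(ℝ, Fin n → ℂ) M)) q :=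
  (contMDiffAt_field_iff_fieldRep hq).2
    (contDiffAt_const.congr_of_eventuallyEq (fieldRep_frame_eventuallyEq hq v))

theorem smoothOn_frame (p : M) (v : Fin n → ℂ) :
    SmoothOn (frame p v : VField n M) (chartAt (Fin n → ℂ) p).source :=
  fun _ hq => (contMDiffAt_frame hq v).contMDiffWithinAt

theorem mdifferentiableAt_frame (hq : q ∈ (chartAt (Fin n → ℂ) p).source) (v : Fin n → ℂ) :
    MDifferentiableAt 𝓘(ℝ, Fin n → ℂ) (𝓘(ℝ, Fin n → ℂ).tangent)
      (fun x => (⟨x, frame p v x⟩ : TangentBundle 𝓘(ℝ, Fin n → ℂ) M)) q :=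
  (contMDiffAt_frame hq v (k := 1)).mdifferentiableAt one_ne_zero

/-- The flat connection on the domain of the preferred chart at `p`. -/
def chartConnection (p : M) (Z : VField n M) (q : M) :
    TangentSpace 𝓘(ℝ, Fin n → ℂ) q →L[ℝ] TangentSpace 𝓘(ℝ, Fin n → ℂ) q :=
  coordInv p q ∘L fderiv ℝ (fieldRep p Z) (chartAt (Fin n → ℂ) p q) ∘L coordMap p q

theorem isCovariantDerivativeOn_chartConnection (p : M) :
    IsCovariantDerivativeOn (Fin n → ℂ) (I := 𝓘(ℝ, Fin n → ℂ)) (M := M)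
      (V := fun x : M => TangentSpace 𝓘(ℝ, Fin n → ℂ) x)
      (chartConnection p) (chartAt (Fin n → ℂ) p).source where
  add {Z Z' q} hZ hZ' hq := by
    have h1 := (mdifferentiableAt_field_iff_fieldRep hq).1 hZ
    have h2 := (mdifferentiableAt_field_iff_fieldRep hq).1 hZ'
    have h3 : fieldRep p (Z + Z') = fieldRep p Z + fieldRep p Z' := by
      ext1 y; exact map_add _ _ _
    simp only [chartConnection, h3, fderiv_add h1 h2]
    rw [ContinuousLinearMap.add_comp, ContinuousLinearMap.comp_add]
  leibniz {Z g q} hZ hg hq := by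
    have h1 := (mdifferentiableAt_field_iff_fieldRep hq).1 hZ
    have h2 := (mdifferentiableAt_iff_funRep hq).1 hg
    have h3 : fieldRep p (g • Z) = fun y => funRep p g y • fieldRep p Z y := by
      ext1 y; exact (coordMap p _).map_smul _ _
    have h4 : funRep p g (chartAt (Fin n → ℂ) p q) = g q := by
      simp [funRep, (chartAt (Fin n → ℂ) p).left_inv hq]
    ext1 u
    have h5 := mfderiv_eq_fderiv_funRep hq hg u
    simp only [chartConnection, h3, fderiv_fun_smul h2 h1]
    simp only [ContinuousLinearMap.comp_apply, _root_.add_apply, _root_.smul_apply, map_add,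
      map_smul, ContinuousLinearMap.smulRight_apply, h4, fieldRep_chartAt hq]
    rw [h5]
    congr 2
    exact coordInv_coordMap hq _

variable (D : Connection n M)

/-- The Christoffel symbols of a connection in the preferred chart at `p`. -/
def christoffel (p : M) (y : Fin n → ℂ) : (Fin n → ℂ) →L[ℝ] (Fin n → ℂ) →L[ℝ] (Fin n → ℂ) :=
  LinearMap.toContinuousBilinearMap <| LinearMap.mk₂ ℝ
    -- The difference of two covariant derivatives is tensorial, hence defined on single vectors;
    -- `v` is the vector differentiated and `u` the direction.
    (fun u v => coordMap p ((chartAt (Fin n → ℂ) p).symm y)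
      ((D.isCovariantDerivativeOn (s := (chartAt (Fin n → ℂ) p).source)).difference
        (isCovariantDerivativeOn_chartConnection p) ((chartAt (Fin n → ℂ) p).symm y)
        (coordInv p _ v) (coordInv p _ u)))
    (fun _ _ _ => by simp only [map_add]) (fun _ _ _ => by simp only [map_smul])
    (fun _ _ _ => by simp only [map_add, _root_.add_apply])
    (fun _ _ _ => by simp only [map_smul, _root_.smul_apply])

theorem coordMap_connection (hq : q ∈ (chartAt (Fin n → ℂ) p).source) {Z : VField n M}
    (hZ : MDifferentiableAt 𝓘(ℝ, Fin n → ℂ) (𝓘(ℝ, Fin n → ℂ).tangent)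
      (fun x => (⟨x, Z x⟩ : TangentBundle 𝓘(ℝ, Fin n → ℂ) M)) q)
    (u : TangentSpace 𝓘(ℝ, Fin n → ℂ) q) :
    coordMap p q (D Z q u) = fderiv ℝ (fieldRep p Z) (chartAt (Fin n → ℂ) p q) (coordMap p q u)
      + christoffel D p (chartAt (Fin n → ℂ) p q) (coordMap p q u) (coordMap p q (Z q)) := by
  have key : ∀ q', q' = q → coordMap p q' ((D.isCovariantDerivativeOn
      (s := (chartAt (Fin n → ℂ) p).source)).difference
        (isCovariantDerivativeOn_chartConnection p) q'
        (coordInv p q' (coordMap p q (Z q))) (coordInv p q' (coordMap p q u)))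
      = coordMap p q (D Z q u) -
        fderiv ℝ (fieldRep p Z) (chartAt (Fin n → ℂ) p q) (coordMap p q u) := by
    rintro _ rfl
    rw [coordInv_coordMap hq, coordInv_coordMap hq, IsCovariantDerivativeOn.difference_apply _ _ hq hZ]
    rw [_root_.sub_apply, map_sub]
    congr 1
    exact coordMap_coordInv hq _
  have := key _ ((chartAt (Fin n → ℂ) p).left_inv hq)
  rw [add_comm, ← sub_eq_iff_eq_add, ← this]
  rfl

theorem coordMap_connection_frame (hq : q ∈ (chartAt (Fin n → ℂ) p).source) (v : Fin n → ℂ)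
    (u : TangentSpace 𝓘(ℝ, Fin n → ℂ) q) :
    coordMap p q (D (frame p v) q u)
      = christoffel D p (chartAt (Fin n → ℂ) p q) (coordMap p q u) v := by
  rw [coordMap_connection D hq (mdifferentiableAt_frame hq v),
    (fieldRep_frame_eventuallyEq hq v).fderiv_eq]
  simp [frame, coordMap_coordInv hq]

theorem fieldRep_nabla_frame {y : Fin n → ℂ} (hy : y ∈ (chartAt (Fin n → ℂ) p).target)
    (u v : Fin n → ℂ) :
    fieldRep p (nabla D (frame p u) (frame p v)) y = christoffel D p y u v := by
  have hq := (chartAt (Fin n → ℂ) p).map_target hy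
  have := coordMap_connection_frame D hq v (frame p u _)
  rw [(chartAt (Fin n → ℂ) p).right_inv hy] at this
  rw [fieldRep, nabla, this, frame, coordMap_coordInv hq]

variable {D}

/-- The smoothness of `D` is applied to globally smooth sections, while frames are smooth only on
the chart domain. A frame is therefore multiplied by a bump function, which by locality changes
nothing near the point. -/
theorem contDiffOn_christoffel [T2Space M] (hD : D.ContMDiffCovariantDerivative ∞) (p : M) :
    ContDiffOn ℝ ∞ (christoffel D p) (chartAt (Fin n → ℂ) p).target := by
  rw [contDiffOn_clm_apply]
  intro u
  rw [contDiffOn_clm_apply]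
  intro v y hy
  refine ContDiffAt.contDiffWithinAt ?_
  obtain ⟨q, hq, rfl⟩ : ∃ q ∈ (chartAt (Fin n → ℂ) p).source, chartAt (Fin n → ℂ) p q = y :=
    ⟨_, (chartAt (Fin n → ℂ) p).map_target hy, (chartAt (Fin n → ℂ) p).right_inv hy⟩
  have hs := (chartAt (Fin n → ℂ) p).open_source
  obtain ⟨ψ, -, hψ⟩ := (SmoothBumpFunction.nhds_basis_tsupport (I := 𝓘(ℝ, Fin n → ℂ)) q).mem_iff.1
    (hs.mem_nhds hq)
  have hMω : IsManifold 𝓘(ℝ, Fin n → ℂ) ω M := inferInstance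
  have : IsManifold 𝓘(ℝ, Fin n → ℂ) ∞ M := IsManifold.of_le (n := ω) le_top
  have : IsManifold 𝓘(ℝ, Fin n → ℂ) (∞ + 1) M := IsManifold.of_le (n := ω) le_top
  have : ContMDiffVectorBundle ∞ (Fin n → ℂ) (TangentSpace 𝓘(ℝ, Fin n → ℂ) : M → Type _)
      𝓘(ℝ, Fin n → ℂ) := inferInstance
  have h1 : ContMDiff 𝓘(ℝ, Fin n → ℂ) (𝓘(ℝ, Fin n → ℂ).tangent) (∞ + 1) (fun x =>
      (⟨x, ((ψ : M → ℝ) • (frame p v : VField n M)) x⟩ : TangentBundle 𝓘(ℝ, Fin n → ℂ) M)) :=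
    ContMDiffOn.smul_section_of_tsupport (ψ.contMDiff.contMDiffOn) hs hψ (smoothOn_frame p v)
  have h2 := (hD.contMDiff.contMDiff h1.contMDiffOn).contMDiffAt (x := q) univ_mem
  have h3 := h2.clm_bundle_apply (contMDiffAt_frame hq u)
  have h4 : ContDiffAt ℝ ∞ (fieldRep p (nabla D (frame p u) ((ψ : M → ℝ) • (frame p v : VField n M))))
      (chartAt (Fin n → ℂ) p q) := (contMDiffAt_field_iff_fieldRep hq).1 h3
  refine h4.congr_of_eventuallyEq ?_
  -- The covariant derivative is compared at all points near `q`, and at each of them the two fields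
  -- must agree on a whole neighbourhood; hence the nested quantifiers.
  have h5 : ∀ᶠ y in 𝓝 (chartAt (Fin n → ℂ) p q),
      ∀ᶠ x in 𝓝 ((chartAt (Fin n → ℂ) p).symm y), ψ x = 1 := by
    have h6 := (chartAt (Fin n → ℂ) p).continuousAt_symm
      ((chartAt (Fin n → ℂ) p).map_source hq)
    rw [ContinuousAt, (chartAt (Fin n → ℂ) p).left_inv hq] at h6
    exact h6.eventually (p := fun x' => ∀ᶠ x in 𝓝 x', ψ x = 1) ψ.eventuallyEq_one.eventually_nhds
  filter_upwards [h5, (chartAt (Fin n → ℂ) p).open_target.mem_nhds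
    ((chartAt (Fin n → ℂ) p).map_source hq)] with y hy hyt
  rw [← fieldRep_nabla_frame D hyt u v]
  simp only [fieldRep, nabla]
  congr 2
  have hq' := (chartAt (Fin n → ℂ) p).map_target hyt
  refine D.isCovariantDerivativeOn.congr_of_eventuallyEq (s := Set.univ)
    (mdifferentiableAt_frame hq' v) ((h1 _).mdifferentiableAt (by simp)) univ_mem ?_
  filter_upwards [hy] with x hx
  simp [hx]

end ConnectionCoordinates

/-! ### Torsion, curvature and d^∇J as identities for the Christoffel symbols -/

section TensorCoordinates

open Filter Topology

variable {n : ℕ} {M : Type*} [TopologicalSpace M] [ChartedSpace (Fin n → ℂ) M]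
  [IsManifold 𝓘(ℂ, Fin n → ℂ) ω M] {p q : M}

theorem coordMap_injective (hq : q ∈ (chartAt (Fin n → ℂ) p).source) {u v : TangentSpace 𝓘(ℝ, Fin n → ℂ) q}
    (h : coordMap p q u = coordMap p q v) : u = v := by
  rw [← coordInv_coordMap hq u, h, coordInv_coordMap hq]

theorem coordMap_frame (hq : q ∈ (chartAt (Fin n → ℂ) p).source) (v : Fin n → ℂ) :
    coordMap p q (frame p v q) = v := coordMap_coordInv hq v

/-- A constant vector field on a vector space. -/
def constField {E : Type*} [NormedAddCommGroup E] [NormedSpace ℝ E] (v : E) (x : E) :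
    TangentSpace 𝓘(ℝ, E) x := v

/-- Frames are pull-backs of constant fields under the chart, and brackets commute with pull-back.
This removes the bracket terms from torsion and curvature. -/
theorem mlieBracket_frame (hq : q ∈ (chartAt (Fin n → ℂ) p).source) (u v : Fin n → ℂ) :
    mlieBracket 𝓘(ℝ, Fin n → ℂ) (frame p u : VField n M) (frame p v) q = 0 := by
  have h : ∀ v : Fin n → ℂ, (frame p v : VField n M) =ᶠ[𝓝 q]
      mpullback 𝓘(ℝ, Fin n → ℂ) 𝓘(ℝ, Fin n → ℂ) (chartAt (Fin n → ℂ) p) (constField v) := by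
    intro v
    filter_upwards [(chartAt (Fin n → ℂ) p).open_source.mem_nhds hq] with x hx
    have h1 : (coordMap p x).inverse = coordInv p x := ContinuousLinearMap.inverse_eq
      (by ext1 w; exact coordMap_coordInv hx w) (by ext1 w; exact coordInv_coordMap hx w)
    rw [coordMap_eq_mfderiv hx] at h1
    exact (congrArg (fun L => L v) h1).symm
  have hf : ContMDiffAt 𝓘(ℝ, Fin n → ℂ) 𝓘(ℝ, Fin n → ℂ) ω (chartAt (Fin n → ℂ) p) q :=
    contMDiffAt_of_mem_maximalAtlas (IsManifold.chart_mem_maximalAtlas p) hq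
  have hc : ∀ v : Fin n → ℂ, MDifferentiableAt 𝓘(ℝ, Fin n → ℂ) (𝓘(ℝ, Fin n → ℂ).tangent)
      (fun x : Fin n → ℂ => (⟨x, constField v x⟩ : TangentBundle 𝓘(ℝ, Fin n → ℂ) (Fin n → ℂ)))
      (chartAt (Fin n → ℂ) p q) := fun v => by
    rw [mdifferentiableAt_section]
    simpa [constField] using! mdifferentiableAt_const
  have : IsManifold 𝓘(ℝ, Fin n → ℂ) (minSmoothness ℝ 3) M := IsManifold.of_le (n := ω) le_top
  rw [(h u).mlieBracket_vectorField_eq (h v), ← mpullback_mlieBracket (hc u) (hc v) hf le_top,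
    mpullback_apply, ← mlieBracketWithin_univ, mlieBracketWithin_eq_lieBracketWithin]
  have h0 : lieBracketWithin ℝ (fun _ => u) (fun _ => v) Set.univ (chartAt (Fin n → ℂ) p q) = 0 := by
    rw [lieBracketWithin_univ]
    have h1 : ∀ v : Fin n → ℂ, fderiv ℝ (fun _ : Fin n → ℂ => v) (chartAt (Fin n → ℂ) p q) = 0 :=
      fun v => fderiv_const_apply v
    exact (congrArg₂ (fun (A B : (Fin n → ℂ) →L[ℝ] (Fin n → ℂ)) => A u - B v) (h1 v) (h1 u)).trans
      (sub_zero _)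
  exact (congrArg _ h0).trans (map_zero _)

variable {D : Connection n M}

theorem christoffel_symm (hD : IsSpecialComplex D) {y : Fin n → ℂ}
    (hy : y ∈ (chartAt (Fin n → ℂ) p).target) (u v : Fin n → ℂ) :
    christoffel D p y u v = christoffel D p y v u := by
  have hq := (chartAt (Fin n → ℂ) p).map_target hy
  have h := D.torsion_eq_zero_iff.1 hD.torsion_free (mdifferentiableAt_frame hq u)
    (mdifferentiableAt_frame hq v)
  rw [mlieBracket_frame hq, sub_eq_zero] at h
  rw [← fieldRep_nabla_frame D hy, ← fieldRep_nabla_frame D hy]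
  exact congrArg (coordMap p _) h

variable [T2Space M]

omit [T2Space M] in
theorem fieldRep_nabla_frame_eventuallyEq (hq : q ∈ (chartAt (Fin n → ℂ) p).source)
    (u v : Fin n → ℂ) : fieldRep p (nabla D (frame p u) (frame p v))
      =ᶠ[𝓝 (chartAt (Fin n → ℂ) p q)] fun y => christoffel D p y u v := by
  filter_upwards [(chartAt (Fin n → ℂ) p).open_target.mem_nhds
    ((chartAt (Fin n → ℂ) p).map_source hq)] with y hy using fieldRep_nabla_frame D hy u v

set_option synthInstance.maxHeartbeats 200000 in
theorem hasFDerivAt_christoffel (hD : IsSpecialComplex D) {y : Fin n → ℂ}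
    (hy : y ∈ (chartAt (Fin n → ℂ) p).target) :
    HasFDerivAt (christoffel D p) (fderiv ℝ (christoffel D p) y) y :=
  (((contDiffOn_christoffel hD.smooth p).contDiffAt
    ((chartAt (Fin n → ℂ) p).open_target.mem_nhds hy)).differentiableAt (by simp)).hasFDerivAt

set_option synthInstance.maxHeartbeats 200000 in
theorem hasFDerivAt_apply_apply {E F G H : Type*} [NormedAddCommGroup E] [NormedSpace ℝ E]
    [NormedAddCommGroup F] [NormedSpace ℝ F] [NormedAddCommGroup G] [NormedSpace ℝ G]
    [NormedAddCommGroup H] [NormedSpace ℝ H] {B : E → F →L[ℝ] G →L[ℝ] H}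
    {B' : E →L[ℝ] F →L[ℝ] G →L[ℝ] H} {y : E} (h : HasFDerivAt B B' y) (u : F) (v : G) (w : E) :
    fderiv ℝ (fun y => B y u v) y w = B' w u v := by
  have h1 := h.clm_apply (hasFDerivAt_const u y)
  have h2 := h1.clm_apply (hasFDerivAt_const v y)
  rw [h2.fderiv]
  simp

theorem christoffel_flat (hD : IsSpecialComplex D) {y : Fin n → ℂ}
    (hy : y ∈ (chartAt (Fin n → ℂ) p).target) (u v w : Fin n → ℂ) :
    fderiv ℝ (christoffel D p) y u v w + christoffel D p y u (christoffel D p y v w)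
      = fderiv ℝ (christoffel D p) y v u w + christoffel D p y v (christoffel D p y u w) := by
  obtain ⟨q, hq, rfl⟩ : ∃ q ∈ (chartAt (Fin n → ℂ) p).source, chartAt (Fin n → ℂ) p q = y :=
    ⟨_, (chartAt (Fin n → ℂ) p).map_target hy, (chartAt (Fin n → ℂ) p).right_inv hy⟩
  have h := hD.flat _ _ _ _ (chartAt (Fin n → ℂ) p).open_source (smoothOn_frame p u)
    (smoothOn_frame p v) (smoothOn_frame p w) q hq
  have hΓ := hasFDerivAt_christoffel hD hy
  have key : ∀ u v : Fin n → ℂ, coordMap p q (nabla D (frame p u) (nabla D (frame p v) (frame p w)) q)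
      = fderiv ℝ (christoffel D p) (chartAt (Fin n → ℂ) p q) u v w
        + christoffel D p (chartAt (Fin n → ℂ) p q) u (christoffel D p (chartAt (Fin n → ℂ) p q) v w) := by
    intro u v
    have he := fieldRep_nabla_frame_eventuallyEq (D := D) hq v w
    have hd : DifferentiableAt ℝ (fun y => christoffel D p y v w) (chartAt (Fin n → ℂ) p q) :=
      (((hΓ.differentiableAt.clm_apply (differentiableAt_const v))).clm_apply
        (differentiableAt_const w))
    have hZ := (mdifferentiableAt_field_iff_fieldRep hq).2 (he.differentiableAt_iff.2 hd)
    have h1 := coordMap_connection D hq hZ (frame p u q)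
    rw [coordMap_frame hq, he.fderiv_eq, hasFDerivAt_apply_apply hΓ] at h1
    rw [nabla, h1, ← fieldRep_chartAt hq, he.eq_of_nhds]
  have h2 : nabla D (mlieBracket 𝓘(ℝ, Fin n → ℂ) (frame p u : VField n M) (frame p v)) (frame p w) q
      = 0 := by
    rw [nabla, mlieBracket_frame hq, map_zero]
  rw [curvature, Pi.sub_apply, Pi.sub_apply, h2, sub_zero, sub_eq_zero] at h
  rw [← key, ← key, h]

-- J is constant in a holomorphic chart, so (∇_uJ)v = Γ(u,iv) − iΓ(u,v). Antisymmetrising cancels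
-- the second term because Γ is symmetric.
omit [T2Space M] in
theorem christoffel_I (hD : IsSpecialComplex D) {y : Fin n → ℂ}
    (hy : y ∈ (chartAt (Fin n → ℂ) p).target) (u v : Fin n → ℂ) :
    christoffel D p y u (Complex.I • v) = christoffel D p y v (Complex.I • u) := by
  obtain ⟨q, hq, rfl⟩ : ∃ q ∈ (chartAt (Fin n → ℂ) p).source, chartAt (Fin n → ℂ) p q = y :=
    ⟨_, (chartAt (Fin n → ℂ) p).map_target hy, (chartAt (Fin n → ℂ) p).right_inv hy⟩
  have h := hD.dNablaJ_eq_zero _ _ _ (chartAt (Fin n → ℂ) p).open_source (smoothOn_frame p u)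
    (smoothOn_frame p v) q hq
  have hJ : ∀ v : Fin n → ℂ, ∀ x ∈ (chartAt (Fin n → ℂ) p).source,
      (JField (frame p v) : VField n M) x = frame p (Complex.I • v) x := by
    intro v x hx
    apply coordMap_injective hx
    rw [JField, coordMap_J hx, coordMap_frame hx, coordMap_frame hx]
  have key : ∀ u v : Fin n → ℂ, coordMap p q (nablaJ D (frame p u) (frame p v) q)
      = christoffel D p (chartAt (Fin n → ℂ) p q) u (Complex.I • v)
        - Complex.I • christoffel D p (chartAt (Fin n → ℂ) p q) u v := by
    intro u v
    have he : ∀ᶠ x in 𝓝 q, frame p (Complex.I • v) x = (JField (frame p v) : VField n M) x := by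
      filter_upwards [(chartAt (Fin n → ℂ) p).open_source.mem_nhds hq] with x hx
      exact (hJ v x hx).symm
    have hd := mdifferentiableAt_frame hq (Complex.I • v)
    have hd' : MDifferentiableAt 𝓘(ℝ, Fin n → ℂ) (𝓘(ℝ, Fin n → ℂ).tangent)
      (fun x => (⟨x, JField (frame p v) x⟩ : TangentBundle 𝓘(ℝ, Fin n → ℂ) M)) q := by
      refine hd.congr_of_eventuallyEq ?_
      filter_upwards [he] with x hx
      rw [hx]
    have h1 := D.isCovariantDerivativeOn.congr_of_eventuallyEq (s := Set.univ) hd hd' univ_mem he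
    rw [nablaJ, Pi.sub_apply, map_sub, JField, coordMap_J hq, nabla, nabla, ← h1,
      coordMap_connection_frame D hq, coordMap_connection_frame D hq, coordMap_frame hq]
  rw [dNablaJ, Pi.sub_apply, sub_eq_zero] at h
  have h2 := congrArg (coordMap p q) h
  rw [key, key, christoffel_symm hD hy u v] at h2
  exact sub_left_injective h2

end TensorCoordinates

/-! ### The affine equation and parallel forms in a chart -/

section AffineCoordinates

open Filter Topology

variable {n : ℕ} {M : Type*} [TopologicalSpace M] [ChartedSpace (Fin n → ℂ) M]
  [IsManifold 𝓘(ℂ, Fin n → ℂ) ω M] {p q : M} {D : Connection n M}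

omit [IsManifold 𝓘(ℂ, Fin n → ℂ) ω M] in
theorem exists_chartAt_eq {y : Fin n → ℂ} (hy : y ∈ (chartAt (Fin n → ℂ) p).target) :
    ∃ q ∈ (chartAt (Fin n → ℂ) p).source, chartAt (Fin n → ℂ) p q = y :=
  ⟨_, (chartAt (Fin n → ℂ) p).map_target hy, (chartAt (Fin n → ℂ) p).right_inv hy⟩

omit [IsManifold 𝓘(ℂ, Fin n → ℂ) ω M] in
theorem tendsto_chartAt_symm (hq : q ∈ (chartAt (Fin n → ℂ) p).source) :
    Tendsto (chartAt (Fin n → ℂ) p).symm (𝓝 (chartAt (Fin n → ℂ) p q)) (𝓝 q) := by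
  have h := (chartAt (Fin n → ℂ) p).continuousAt_symm ((chartAt (Fin n → ℂ) p).map_source hq)
  rwa [ContinuousAt, (chartAt (Fin n → ℂ) p).left_inv hq] at h

omit [IsManifold 𝓘(ℂ, Fin n → ℂ) ω M] in
theorem funRep_chartAt {W : Type*} (hq : q ∈ (chartAt (Fin n → ℂ) p).source) (f : M → W) :
    funRep p f (chartAt (Fin n → ℂ) p q) = f q := by
  rw [funRep, (chartAt (Fin n → ℂ) p).left_inv hq]

section LieDerivative

variable {f : M → ℝ} {U : Set M}

theorem contDiffAt_funRep {W : Type*} [NormedAddCommGroup W] [NormedSpace ℝ W] {f : M → W}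
    (hf : ContMDiffOn 𝓘(ℝ, Fin n → ℂ) 𝓘(ℝ, W) ∞ f U) (hU : IsOpen U)
    (hq : q ∈ (chartAt (Fin n → ℂ) p).source) (hqU : q ∈ U) :
    ContDiffAt ℝ ∞ (funRep p f) (chartAt (Fin n → ℂ) p q) :=
  (contMDiffAt_iff_funRep hq).1 (hf.contMDiffAt (hU.mem_nhds hqU))

theorem funRep_lieD (hf : ContMDiffOn 𝓘(ℝ, Fin n → ℂ) 𝓘(ℝ, ℝ) ∞ f U) (hU : IsOpen U)
    (hq : q ∈ (chartAt (Fin n → ℂ) p).source) (hqU : q ∈ U) (Y : VField n M) :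
    funRep p (lieD Y f) =ᶠ[𝓝 (chartAt (Fin n → ℂ) p q)]
      fun y => fderiv ℝ (funRep p f) y (fieldRep p Y y) := by
  filter_upwards [(chartAt (Fin n → ℂ) p).open_target.mem_nhds
    ((chartAt (Fin n → ℂ) p).map_source hq), tendsto_chartAt_symm hq (hU.mem_nhds hqU)] with y hy hyU
  have hs := (chartAt (Fin n → ℂ) p).map_target hy
  have h := dAt_eq_fderiv hs ((hf.contMDiffAt (hU.mem_nhds hyU)).mdifferentiableAt (by simp))
    (Y ((chartAt (Fin n → ℂ) p).symm y))
  rw [(chartAt (Fin n → ℂ) p).right_inv hy] at h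
  exact h

/-- The product rule. The term containing the derivative of Y also occurs in (∇_XY)f, so the affine
condition reduces to the tensorial equation d²f = df∘Γ. -/
theorem lieD_lieD (hf : ContMDiffOn 𝓘(ℝ, Fin n → ℂ) 𝓘(ℝ, ℝ) ∞ f U) (hU : IsOpen U)
    (hq : q ∈ (chartAt (Fin n → ℂ) p).source) (hqU : q ∈ U) {Y : VField n M}
    (hY : DifferentiableAt ℝ (fieldRep p Y) (chartAt (Fin n → ℂ) p q)) (X : VField n M) :
    lieD X (lieD Y f) q = fderiv ℝ (fderiv ℝ (funRep p f)) (chartAt (Fin n → ℂ) p q)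
        (coordMap p q (X q)) (coordMap p q (Y q))
      + fderiv ℝ (funRep p f) (chartAt (Fin n → ℂ) p q)
        (fderiv ℝ (fieldRep p Y) (chartAt (Fin n → ℂ) p q) (coordMap p q (X q))) := by
  have h1 := funRep_lieD hf hU hq hqU Y
  have h2 : DifferentiableAt ℝ (fderiv ℝ (funRep p f)) (chartAt (Fin n → ℂ) p q) :=
    ((contDiffAt_funRep hf hU hq hqU).fderiv_right (m := 1) (by norm_cast)).differentiableAt (by simp)
  have h3 := h2.hasFDerivAt.clm_apply hY.hasFDerivAt
  have h4 := h3.congr_of_eventuallyEq h1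
  rw [lieD, dAt_eq_fderiv hq ((mdifferentiableAt_iff_funRep hq).2 h4.differentiableAt), h4.fderiv,
    ← fieldRep_chartAt hq Y]
  simp [add_comm]

theorem IsAffineOn.fderiv_fderiv (hf : IsAffineOn D f U) (hU : IsOpen U)
    (hq : q ∈ (chartAt (Fin n → ℂ) p).source) (hqU : q ∈ U) (u v : Fin n → ℂ) :
    fderiv ℝ (fderiv ℝ (funRep p f)) (chartAt (Fin n → ℂ) p q) u v
      = fderiv ℝ (funRep p f) (chartAt (Fin n → ℂ) p q)
          (christoffel D p (chartAt (Fin n → ℂ) p q) u v) := by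
  have h := hf.2 _ _ _ (hU.inter (chartAt (Fin n → ℂ) p).open_source) Set.inter_subset_left
    ((smoothOn_frame p u).mono Set.inter_subset_right)
    ((smoothOn_frame p v).mono Set.inter_subset_right) q ⟨hqU, hq⟩
  have hd := (mdifferentiableAt_field_iff_fieldRep hq).1 (mdifferentiableAt_frame hq v)
  rw [lieD_lieD hf.1 hU hq hqU hd, lieD, dAt_eq_fderiv hq
    ((hf.1.contMDiffAt (hU.mem_nhds hqU)).mdifferentiableAt (by simp)), nabla,
    coordMap_connection_frame D hq, (fieldRep_frame_eventuallyEq hq v).fderiv_eq] at h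
  simpa [coordMap_frame hq] using h

theorem isAffineOn_of_fderiv_fderiv (hU : IsOpen U)
    (hf : ContMDiffOn 𝓘(ℝ, Fin n → ℂ) 𝓘(ℝ, ℝ) ∞ f U)
    (h : ∀ q ∈ U, ∃ p, q ∈ (chartAt (Fin n → ℂ) p).source ∧ ∀ u v,
      fderiv ℝ (fderiv ℝ (funRep p f)) (chartAt (Fin n → ℂ) p q) u v
        = fderiv ℝ (funRep p f) (chartAt (Fin n → ℂ) p q)
          (christoffel D p (chartAt (Fin n → ℂ) p q) u v)) : IsAffineOn D f U := by
  refine ⟨hf, fun W X Y hW hWU hX hY q hqW => ?_⟩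
  obtain ⟨p, hq, h⟩ := h q (hWU hqW)
  have hZ := (hY.contMDiffAt (hW.mem_nhds hqW)).mdifferentiableAt (by simp)
  have hd := (mdifferentiableAt_field_iff_fieldRep hq).1 hZ
  rw [lieD_lieD hf hU hq (hWU hqW) hd, h, lieD, dAt_eq_fderiv hq
    ((hf.contMDiffAt (hU.mem_nhds (hWU hqW))).mdifferentiableAt (by simp)), nabla,
    coordMap_connection D hq hZ, map_add, add_comm]

end LieDerivative

section VectorValued

variable {ι : Type*} [Fintype ι]

omit [Fintype ι] in
theorem fderiv_apply_eq {E : Type*} [NormedAddCommGroup E] [NormedSpace ℝ E] {G : E → ι → ℝ} {y : E}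
    (hG : DifferentiableAt ℝ G y) (k : ι) (u : E) :
    fderiv ℝ (fun y => G y k) y u = fderiv ℝ G y u k := by
  rw [((hasFDerivAt_pi'.1 hG.hasFDerivAt) k).fderiv]
  rfl

theorem fderiv_fderiv_apply_eq {E : Type*} [NormedAddCommGroup E] [NormedSpace ℝ E] {G : E → ι → ℝ}
    {y : E} (hG : ContDiffAt ℝ ∞ G y) (k : ι) (u v : E) :
    fderiv ℝ (fderiv ℝ (fun y => G y k)) y u v = fderiv ℝ (fderiv ℝ G) y u v k := by
  have h1 : fderiv ℝ (fun y => G y k) =ᶠ[𝓝 y]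
      fun y => (ContinuousLinearMap.proj (R := ℝ) (φ := fun _ : ι => ℝ) k).comp (fderiv ℝ G y) := by
    filter_upwards [(hG.of_le (m := 1) (by norm_cast)).eventually (by simp)] with z hz
    ext1 u
    rw [fderiv_apply_eq (hz.differentiableAt (by simp))]
    rfl
  have h2 : DifferentiableAt ℝ (fderiv ℝ G) y :=
    (hG.fderiv_right (m := 1) (by norm_cast)).differentiableAt (by simp)
  have h3 := (hasFDerivAt_const
    (ContinuousLinearMap.proj (R := ℝ) (φ := fun _ : ι => ℝ) k) y).clm_comp h2.hasFDerivAt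
  rw [h1.fderiv_eq, h3.fderiv]
  simp

theorem dAt_apply_eq {U : Set M} {e : M → ι → ℝ} (hU : IsOpen U)
    (he : ContMDiffOn 𝓘(ℝ, Fin n → ℂ) 𝓘(ℝ, ι → ℝ) ∞ e U)
    (hq : q ∈ (chartAt (Fin n → ℂ) p).source) (hqU : q ∈ U) (k : ι)
    (u : TangentSpace 𝓘(ℝ, Fin n → ℂ) q) :
    dAt (fun r => e r k) q u
      = fderiv ℝ (funRep p e) (chartAt (Fin n → ℂ) p q) (coordMap p q u) k := by
  have h1 := contMDiffOn_pi_space.1 he k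
  rw [dAt_eq_fderiv hq ((h1.contMDiffAt (hU.mem_nhds hqU)).mdifferentiableAt (by simp))]
  exact fderiv_apply_eq ((contDiffAt_funRep he hU hq hqU).differentiableAt (by simp)) k _

theorem fderiv_fderiv_of_isAffineOn {U : Set M} {e : M → ι → ℝ} (hU : IsOpen U)
    (he : ContMDiffOn 𝓘(ℝ, Fin n → ℂ) 𝓘(ℝ, ι → ℝ) ∞ e U)
    (h : ∀ k, IsAffineOn D (fun q => e q k) U)
    (hq : q ∈ (chartAt (Fin n → ℂ) p).source) (hqU : q ∈ U) (u v : Fin n → ℂ) :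
    fderiv ℝ (fderiv ℝ (funRep p e)) (chartAt (Fin n → ℂ) p q) u v
      = fderiv ℝ (funRep p e) (chartAt (Fin n → ℂ) p q)
          (christoffel D p (chartAt (Fin n → ℂ) p q) u v) := by
  have hG := contDiffAt_funRep he hU hq hqU
  ext1 k
  have h1 := (h k).fderiv_fderiv hU hq hqU u v
  rw [← fderiv_fderiv_apply_eq hG, ← fderiv_apply_eq (hG.differentiableAt (by simp))]
  exact h1

theorem isAffineOn_apply {U : Set M} {e : M → ι → ℝ} (hU : IsOpen U)
    (he : ContMDiffOn 𝓘(ℝ, Fin n → ℂ) 𝓘(ℝ, ι → ℝ) ∞ e U)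
    (h : ∀ q ∈ U, ∃ p, q ∈ (chartAt (Fin n → ℂ) p).source ∧ ∀ u v,
      fderiv ℝ (fderiv ℝ (funRep p e)) (chartAt (Fin n → ℂ) p q) u v
        = fderiv ℝ (funRep p e) (chartAt (Fin n → ℂ) p q)
          (christoffel D p (chartAt (Fin n → ℂ) p q) u v)) (k : ι) :
    IsAffineOn D (fun q => e q k) U := by
  refine isAffineOn_of_fderiv_fderiv hU (contMDiffOn_pi_space.1 he k) fun q hqU => ?_
  obtain ⟨p, hq, h⟩ := h q hqU
  refine ⟨p, hq, fun u v => ?_⟩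
  have hG := contDiffAt_funRep he hU hq hqU
  have h1 := congrFun (h u v) k
  rw [← fderiv_fderiv_apply_eq hG, ← fderiv_apply_eq (hG.differentiableAt (by simp))] at h1
  exact h1

end VectorValued

section Form

variable {Ω : BilinField n M}

/-- The components of a field of bilinear forms in the preferred chart at `p`. -/
def formRep (Ω : BilinField n M) (p : M) (y : Fin n → ℂ) :
    (Fin n → ℂ) →L[ℝ] (Fin n → ℂ) →L[ℝ] ℝ :=
  LinearMap.toContinuousBilinearMap <| LinearMap.mk₂ ℝ
    (fun u v => Ω ((chartAt (Fin n → ℂ) p).symm y) (coordInv p _ u) (coordInv p _ v))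
    (fun _ _ _ => by simp only [map_add, _root_.add_apply])
    (fun _ _ _ => by simp only [map_smul, _root_.smul_apply])
    (fun _ _ _ => by simp only [map_add]) (fun _ _ _ => by simp only [map_smul])

theorem formRep_chartAt (hq : q ∈ (chartAt (Fin n → ℂ) p).source) (u v : TangentSpace 𝓘(ℝ, Fin n → ℂ) q) :
    formRep Ω p (chartAt (Fin n → ℂ) p q) (coordMap p q u) (coordMap p q v) = Ω q u v := by
  have key : ∀ q', q' = q → Ω q' (coordInv p q' (coordMap p q u)) (coordInv p q' (coordMap p q v))
      = Ω q u v := by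
    rintro _ rfl
    rw [coordInv_coordMap hq, coordInv_coordMap hq]
  exact key _ ((chartAt (Fin n → ℂ) p).left_inv hq)

set_option synthInstance.maxHeartbeats 200000 in
theorem contDiffOn_formRep (hΩ : IsSymplecticForm Ω) (p : M) :
    ContDiffOn ℝ ∞ (formRep Ω p) (chartAt (Fin n → ℂ) p).target := by
  rw [contDiffOn_clm_apply]
  intro u
  rw [contDiffOn_clm_apply]
  intro v y hy
  obtain ⟨q, hq, rfl⟩ := exists_chartAt_eq hy
  have h := hΩ.smooth _ _ _ (chartAt (Fin n → ℂ) p).open_source (smoothOn_frame p u)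
    (smoothOn_frame p v)
  exact (contDiffAt_funRep h (chartAt (Fin n → ℂ) p).open_source hq hq).contDiffWithinAt

set_option synthInstance.maxHeartbeats 200000 in
theorem fderiv_formRep (hΩ : IsSymplecticForm Ω) (hp : IsParallelForm D Ω) {y : Fin n → ℂ}
    (hy : y ∈ (chartAt (Fin n → ℂ) p).target) (w u v : Fin n → ℂ) :
    fderiv ℝ (formRep Ω p) y w u v
      = formRep Ω p y (christoffel D p y w u) v + formRep Ω p y u (christoffel D p y w v) := by
  obtain ⟨q, hq, rfl⟩ := exists_chartAt_eq hy
  have hs := (chartAt (Fin n → ℂ) p).open_source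
  have h := hp _ _ _ _ hs (smoothOn_frame p w) (smoothOn_frame p u) (smoothOn_frame p v) q hq
  have h1 := hΩ.smooth _ _ _ hs (smoothOn_frame p u) (smoothOn_frame p v)
  have h2 := (((contDiffOn_formRep hΩ p).contDiffAt
    ((chartAt (Fin n → ℂ) p).open_target.mem_nhds hy)).differentiableAt (by simp)).hasFDerivAt
  rw [lieD, dAt_eq_fderiv hq ((h1.contMDiffAt (hs.mem_nhds hq)).mdifferentiableAt (by simp)),
    evalForm, evalForm, ← formRep_chartAt hq, ← formRep_chartAt hq, nabla, nabla,
    coordMap_connection_frame D hq, coordMap_connection_frame D hq, coordMap_frame hq,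
    coordMap_frame hq, coordMap_frame hq] at h
  rw [← h, ← hasFDerivAt_apply_apply h2]
  rfl

end Form

end AffineCoordinates

/-! ### Local inverses, holomorphic extension, uniqueness of parallel forms -/

section LocalAnalysis

open Filter Topology

/-- The source is shrunk to where the derivative stays invertible, so that the inverse is regular on
its whole domain. A general field allows the use both for real coordinates and for holomorphic ones.
-/
theorem exists_local_inverse {𝕜 E F : Type*} [RCLike 𝕜] [NormedAddCommGroup E] [NormedSpace 𝕜 E]
    [NormedAddCommGroup F] [NormedSpace 𝕜 F] [CompleteSpace E] {G : E → F} {O : Set E} {y₀ : E}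
    {m : ℕ∞ω} (hm : m ≠ 0) (hO : IsOpen O) (hy₀ : y₀ ∈ O) (hG : ContDiffOn 𝕜 m G O)
    (ξ : E ≃L[𝕜] F) (hξ : fderiv 𝕜 G y₀ = ξ) :
    ∃ e : OpenPartialHomeomorph E F, y₀ ∈ e.source ∧ e.source ⊆ O ∧ (∀ y, e y = G y) ∧
      ContDiffOn 𝕜 m e.symm e.target := by
  have h0 : ContDiffAt 𝕜 m G y₀ := hG.contDiffAt (hO.mem_nhds hy₀)
  have h1 : HasFDerivAt G (ξ : E →L[𝕜] F) y₀ := hξ ▸ (h0.differentiableAt hm).hasFDerivAt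
  have hc : ContinuousAt (fderiv 𝕜 G) y₀ :=
    (h0.fderiv_right (m := 0) (by simpa using ENat.one_le_iff_ne_zero_withTop.2 hm)).continuousAt
  have h2 : ∀ᶠ y in 𝓝 y₀, ∃ η : E ≃L[𝕜] F, (η : E →L[𝕜] F) = fderiv 𝕜 G y := by
    have h3 := hc.eventually (p := fun L => L ∈ Set.range ((↑) : (E ≃L[𝕜] F) → (E →L[𝕜] F)))
      (by rw [hξ]; exact ContinuousLinearEquiv.nhds ξ)
    exact h3
  obtain ⟨O', hO'sub, hO', hyO'⟩ := mem_nhds_iff.1 h2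
  refine ⟨(h0.toOpenPartialHomeomorph G h1 hm).restrOpen (O ∩ O') (hO.inter hO'),
    ⟨h0.mem_toOpenPartialHomeomorph_source h1 hm, hy₀, hyO'⟩, fun y hy => hy.2.1, fun y => rfl, ?_⟩
  intro x hx
  set e := (h0.toOpenPartialHomeomorph G h1 hm).restrOpen (O ∩ O') (hO.inter hO') with he
  have hs : e.symm x ∈ O ∩ O' := (e.map_target hx).2
  obtain ⟨η, hη⟩ := hO'sub hs.2
  have h4 : ContDiffAt 𝕜 m G (e.symm x) := hG.contDiffAt (hO.mem_nhds hs.1)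
  refine (e.contDiffAt_symm (f₀' := η) hx ?_ h4).contDiffWithinAt
  rw [hη]
  exact (h4.differentiableAt hm).hasFDerivAt

/-- By the two identities for Γ the form dG∘i is closed; let H be a primitive. Then F = G − iH has
differential dG − i·dG∘i, which is complex linear. -/
theorem exists_holomorphic_extension {E ι : Type*} [NormedAddCommGroup E] [NormedSpace ℂ E]
    [FiniteDimensional ℂ E] [FiniteDimensional ℝ E] [Fintype ι]
    {G : E → ι → ℝ} {Γ : E → E →L[ℝ] E →L[ℝ] E} {y₀ : E} {R : ℝ} (hR : 0 < R)
    (hG : ContDiffOn ℝ ∞ G (Metric.ball y₀ R))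
    (hΓ : ∀ y ∈ Metric.ball y₀ R, ∀ u v, Γ y u (Complex.I • v) = Γ y v (Complex.I • u))
    (hGΓ : ∀ y ∈ Metric.ball y₀ R, ∀ u v, fderiv ℝ (fderiv ℝ G) y u v = fderiv ℝ G y (Γ y u v)) :
    ∃ r, 0 < r ∧ r ≤ R ∧ ∃ F : E → ι → ℂ, ContDiffOn ℂ 1 F (Metric.ball y₀ r) ∧
      (∀ y k, (F y k).re = G y k) ∧
      ∀ y ∈ Metric.ball y₀ r, ∀ v k, fderiv ℂ F y v k
        = fderiv ℝ G y v k - Complex.I * fderiv ℝ G y (Complex.I • v) k := by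
  let j : E →L[ℝ] E := Complex.I • ContinuousLinearMap.id ℝ E
  have hj : ∀ v, j v = Complex.I • v := fun v => rfl
  have hG' : ContDiffOn ℝ ∞ (fderiv ℝ G) (Metric.ball y₀ R) :=
    hG.fderiv_of_isOpen Metric.isOpen_ball (by norm_cast)
  have hα : ContDiffOn ℝ ∞ (fun y => (fderiv ℝ G y).comp j) (Metric.ball y₀ R) :=
    hG'.clm_comp contDiffOn_const
  have hαd : ∀ y ∈ Metric.ball y₀ R, ∀ u v, fderiv ℝ (fun y => (fderiv ℝ G y).comp j) y u v
      = fderiv ℝ (fderiv ℝ G) y u (Complex.I • v) := by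
    intro y hy u v
    have h1 : DifferentiableAt ℝ (fderiv ℝ G) y :=
      (hG'.contDiffAt (Metric.isOpen_ball.mem_nhds hy)).differentiableAt (by simp)
    rw [(h1.hasFDerivAt.clm_comp (hasFDerivAt_const j y)).fderiv]
    simp [hj]
  obtain ⟨r, hr, hrR, H, -, hH⟩ := exists_primitive_of_closed hR hα (fun y hy u v => by
    rw [hαd y hy, hαd y hy, hGΓ y hy, hGΓ y hy, hΓ y hy])
  have hsub : Metric.ball y₀ r ⊆ Metric.ball y₀ R := Metric.ball_subset_ball hrR
  let L : E → E →L[ℂ] ι → ℂ := fun y => ContinuousLinearMap.pi fun k =>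
    StrongDual.extendRCLike ((ContinuousLinearMap.proj (R := ℝ) (φ := fun _ : ι => ℝ) k).comp
      (fderiv ℝ G y))
  have hL : ∀ y v k, L y v k = fderiv ℝ G y v k - Complex.I * fderiv ℝ G y (Complex.I • v) k :=
    fun y v k => rfl
  let F : E → ι → ℂ := fun y k => (G y k : ℂ) - Complex.I * (H y k : ℂ)
  have hF : ∀ y ∈ Metric.ball y₀ r, HasFDerivAt F (L y) y := by
    intro y hy
    have hGy : HasFDerivAt G (fderiv ℝ G y) y := ((hG.contDiffAt
      (Metric.isOpen_ball.mem_nhds (hsub hy))).differentiableAt (by simp)).hasFDerivAt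
    rw [hasFDerivAt_pi']
    intro k
    have h1 : HasFDerivAt (fun y => (G y k : ℂ)) _ y := Complex.ofRealCLM.hasFDerivAt.comp y (hasFDerivAt_pi'.1 hGy k)
    have h2 : HasFDerivAt (fun y => (H y k : ℂ)) _ y := Complex.ofRealCLM.hasFDerivAt.comp y (hasFDerivAt_pi'.1 (hH y hy) k)
    refine hasFDerivAt_of_restrictScalars ℝ (h1.sub (h2.const_mul Complex.I)) ?_
    ext1 v
    exact hL y v k
  refine ⟨r, hr, hrR, F, ?_, fun y k => by simp [F], fun y hy v k => by rw [(hF y hy).fderiv, hL]⟩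
  -- Complex C¹ regularity, needed for the inverse function theorem, follows from continuity of the
  -- explicit differential.
  rw [show (1 : ℕ∞ω) = 0 + 1 by simp, contDiffOn_succ_iff_fderiv_of_isOpen Metric.isOpen_ball]
  refine ⟨fun y hy => (hF y hy).differentiableAt.differentiableWithinAt, by simp, ?_⟩
  rw [contDiffOn_zero]
  have hLc : ContinuousOn L (Metric.ball y₀ r) := by
    rw [continuousOn_clm_apply]
    intro v
    rw [continuousOn_pi]
    intro k
    have h3 : ∀ v, ContinuousOn (fun y => fderiv ℝ G y v k) (Metric.ball y₀ r) := fun v =>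
      continuousOn_pi.1 (continuousOn_clm_apply.1 (hG'.continuousOn.mono hsub) v) k
    simp only [hL]
    exact (Complex.continuous_ofReal.comp_continuousOn (h3 v)).sub
      (continuousOn_const.mul (Complex.continuous_ofReal.comp_continuousOn (h3 _)))
  exact hLc.congr fun y hy => (hF y hy).fderiv

section Parallel

variable {E F : Type*} [NormedAddCommGroup E] [NormedSpace ℝ E] [FiniteDimensional ℝ E]
  [NormedAddCommGroup F] [NormedSpace ℝ F]

-- The difference H of the forms satisfies the same linear equation, so ‖dH‖ ≤ 2(‖Γ y₀‖ + 1)‖H‖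
-- where Γ is bounded near `y₀`; vanishing at `y₀`, it vanishes on a ball.
omit [FiniteDimensional ℝ E] in
set_option synthInstance.maxHeartbeats 200000 in
theorem eq_of_parallel {Γ : E → E →L[ℝ] E →L[ℝ] E} {B₁ B₂ : E → E →L[ℝ] E →L[ℝ] ℝ} {y₀ : E} {R : ℝ}
    (hR : 0 < R) (hΓ : ContinuousAt Γ y₀) (h₁ : ContDiffOn ℝ ∞ B₁ (Metric.ball y₀ R))
    (h₂ : ContDiffOn ℝ ∞ B₂ (Metric.ball y₀ R))
    (p₁ : ∀ y ∈ Metric.ball y₀ R, ∀ w u v,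
      fderiv ℝ B₁ y w u v = B₁ y (Γ y w u) v + B₁ y u (Γ y w v))
    (p₂ : ∀ y ∈ Metric.ball y₀ R, ∀ w u v,
      fderiv ℝ B₂ y w u v = B₂ y (Γ y w u) v + B₂ y u (Γ y w v))
    (h₀ : B₁ y₀ = B₂ y₀) :
    ∃ r, 0 < r ∧ r ≤ R ∧ ∀ y ∈ Metric.ball y₀ r, B₁ y = B₂ y := by
  have hb : ∀ᶠ y in 𝓝 y₀, ‖Γ y‖ < ‖Γ y₀‖ + 1 := Filter.Tendsto.eventually_lt_const (lt_add_one _)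
    (ContinuousAt.norm (E := E →L[ℝ] E →L[ℝ] E) hΓ)
  obtain ⟨s, hs, hsb⟩ := Metric.eventually_nhds_iff_ball.1 hb
  refine ⟨min s R, lt_min hs hR, min_le_right _ _, fun y hy => sub_eq_zero.1 ?_⟩
  have hsub : Metric.ball y₀ (min s R) ⊆ Metric.ball y₀ R :=
    Metric.ball_subset_ball (min_le_right _ _)
  have hd₁ : ∀ y ∈ Metric.ball y₀ R, HasFDerivAt B₁ (fderiv ℝ B₁ y) y := fun y hy =>
    ((h₁.contDiffAt (Metric.isOpen_ball.mem_nhds hy)).differentiableAt (by simp)).hasFDerivAt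
  have hd₂ : ∀ y ∈ Metric.ball y₀ R, HasFDerivAt B₂ (fderiv ℝ B₂ y) y := fun y hy =>
    ((h₂.contDiffAt (Metric.isOpen_ball.mem_nhds hy)).differentiableAt (by simp)).hasFDerivAt
  have h₁₂ : ContDiffOn ℝ ∞ (fun y => B₁ y - B₂ y) (Metric.ball y₀ R) :=
    ContDiffOn.sub (F := E →L[ℝ] E →L[ℝ] ℝ) h₁ h₂
  have hd : ∀ y ∈ Metric.ball y₀ R, HasFDerivAt (fun y => B₁ y - B₂ y)
      (fderiv ℝ (fun y => B₁ y - B₂ y) y) y := fun y hy =>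
    ((h₁₂.contDiffAt (Metric.isOpen_ball.mem_nhds hy)).differentiableAt (by simp)).hasFDerivAt
  have hdiff : ∀ {B : E → E →L[ℝ] E →L[ℝ] ℝ} {y : E} {B' : E →L[ℝ] E →L[ℝ] E →L[ℝ] ℝ},
      HasFDerivAt B B' y → ∀ u v, DifferentiableAt ℝ (fun y => B y u v) y := fun h u v =>
    (h.differentiableAt.clm_apply (differentiableAt_const u)).clm_apply (differentiableAt_const v)
  refine eq_zero_of_norm_fderiv_le (H := fun y => B₁ y - B₂ y)
    (H' := fun y => fderiv ℝ (fun y => B₁ y - B₂ y) y) (K := 2 * (‖Γ y₀‖ + 1)) (convex_ball y₀ (min s R))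
    (Metric.mem_ball_self (lt_min hs hR)) (sub_eq_zero.2 h₀)
    (fun y hy => hd y (hsub hy)) (fun y hy => ?_) y hy
  have hΓy := (hsb y (Metric.ball_subset_ball (min_le_left _ _) hy)).le
  set H : E →L[ℝ] E →L[ℝ] ℝ := B₁ y - B₂ y with hH
  have hpos : 0 ≤ ‖Γ y₀‖ + 1 := by positivity
  refine ContinuousLinearMap.opNorm_le_bound _ (by positivity) fun w => ?_
  refine ContinuousLinearMap.opNorm_le_bound₂ _ (by positivity) fun u v => ?_
  have h3 : fderiv ℝ (fun y => B₁ y - B₂ y) y w u v = H (Γ y w u) v + H u (Γ y w v) := by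
    have ha := hdiff (hd₁ y (hsub hy)) u v
    have hb := hdiff (hd₂ y (hsub hy)) u v
    rw [← hasFDerivAt_apply_apply (hd y (hsub hy)) u v w]
    simp only [_root_.sub_apply]
    rw [fderiv_fun_sub ha hb, _root_.sub_apply, hasFDerivAt_apply_apply (hd₁ y (hsub hy)),
      hasFDerivAt_apply_apply (hd₂ y (hsub hy)), p₁ y (hsub hy), p₂ y (hsub hy)]
    simp only [hH, _root_.sub_apply]
    ring
  have hg : ∀ u, ‖Γ y w u‖ ≤ (‖Γ y₀‖ + 1) * ‖w‖ * ‖u‖ := fun u =>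
    ((Γ y).le_opNorm₂ w u).trans (by gcongr)
  rw [h3]
  calc ‖H (Γ y w u) v + H u (Γ y w v)‖ ≤ ‖H (Γ y w u) v‖ + ‖H u (Γ y w v)‖ := norm_add_le _ _
    _ ≤ ‖H‖ * ‖Γ y w u‖ * ‖v‖ + ‖H‖ * ‖u‖ * ‖Γ y w v‖ :=
        add_le_add (H.le_opNorm₂ _ _) (H.le_opNorm₂ _ _)
    _ ≤ ‖H‖ * ((‖Γ y₀‖ + 1) * ‖w‖ * ‖u‖) * ‖v‖ + ‖H‖ * ‖u‖ * ((‖Γ y₀‖ + 1) * ‖w‖ * ‖v‖) := by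
        gcongr
        · exact hg u
        · exact hg v
    _ = 2 * (‖Γ y₀‖ + 1) * ‖H‖ * ‖w‖ * ‖u‖ * ‖v‖ := by ring

/-- The pull-back of a bilinear form under the derivative of a map. -/
def pullForm (S : F →L[ℝ] F →L[ℝ] ℝ) (G : E → F) (y : E) : E →L[ℝ] E →L[ℝ] ℝ :=
  S.bilinearComp (fderiv ℝ G y) (fderiv ℝ G y)

omit [FiniteDimensional ℝ E] in
theorem pullForm_apply (S : F →L[ℝ] F →L[ℝ] ℝ) (G : E → F) (y u v : E) :
    pullForm S G y u v = S (fderiv ℝ G y u) (fderiv ℝ G y v) := rfl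

set_option synthInstance.maxHeartbeats 200000 in
theorem contDiffOn_pullForm (S : F →L[ℝ] F →L[ℝ] ℝ) {G : E → F} {U : Set E} (hU : IsOpen U)
    (hG : ContDiffOn ℝ ∞ G U) : ContDiffOn ℝ ∞ (pullForm S G) U := by
  have hG' : ContDiffOn ℝ ∞ (fderiv ℝ G) U := hG.fderiv_of_isOpen hU (by norm_cast)
  rw [contDiffOn_clm_apply]
  intro u
  rw [contDiffOn_clm_apply]
  intro v
  have h1 : ∀ u, ContDiffOn ℝ ∞ (fun y => fderiv ℝ G y u) U := fun u =>
    hG'.clm_apply contDiffOn_const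
  exact ((S.contDiff.comp_contDiffOn (h1 u)).clm_apply (h1 v))

-- Constant forms pull back to parallel forms under affine maps: differentiating S(dG u, dG v)
-- produces only second derivatives of G, which are dG∘Γ.
set_option synthInstance.maxHeartbeats 200000 in
theorem fderiv_pullForm (S : F →L[ℝ] F →L[ℝ] ℝ) {G : E → F} {U : Set E} (hU : IsOpen U)
    (hG : ContDiffOn ℝ ∞ G U) {Γ : E → E →L[ℝ] E →L[ℝ] E}
    (hGΓ : ∀ y ∈ U, ∀ u v, fderiv ℝ (fderiv ℝ G) y u v = fderiv ℝ G y (Γ y u v)) {y : E}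
    (hy : y ∈ U) (w u v : E) :
    fderiv ℝ (pullForm S G) y w u v = pullForm S G y (Γ y w u) v + pullForm S G y u (Γ y w v) := by
  have hG' : ContDiffOn ℝ ∞ (fderiv ℝ G) U := hG.fderiv_of_isOpen hU (by norm_cast)
  have h0 := ((hG'.contDiffAt (hU.mem_nhds hy)).differentiableAt (by simp)).hasFDerivAt
  have h1 : ∀ u, HasFDerivAt (fun y => fderiv ℝ G y u) ((fderiv ℝ (fderiv ℝ G) y).flip u) y := by
    intro u
    refine (h0.clm_apply (hasFDerivAt_const u y)).congr_fderiv ?_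
    ext; simp
  have h2 := ((((contDiffOn_pullForm S hU hG).contDiffAt (hU.mem_nhds hy))).differentiableAt
    (by simp)).hasFDerivAt
  rw [← hasFDerivAt_apply_apply h2 u v w]
  simp only [pullForm_apply]
  have h3 : HasFDerivAt (fun y => S (fderiv ℝ G y u)) (S.comp ((fderiv ℝ (fderiv ℝ G) y).flip u)) y :=
    S.hasFDerivAt.comp y (h1 u)
  rw [(h3.clm_apply (h1 v)).fderiv]
  simp [hGΓ y hy, add_comm]

end Parallel

end LocalAnalysis

/-! ### Existence of real special coordinates -/

section SpecialCoordinates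

open Filter Topology

variable {n : ℕ} {M : Type*} [TopologicalSpace M] [ChartedSpace (Fin n → ℂ) M]
  [IsManifold 𝓘(ℂ, Fin n → ℂ) ω M] {p q : M} {D : Connection n M} {Ω : BilinField n M}

variable (n) in
/-- The bilinear form `2 ∑ dxⁱ ∧ dyᵢ` on `ℝ²ⁿ`. -/
def stdForm : (Fin n ⊕ Fin n → ℝ) →L[ℝ] (Fin n ⊕ Fin n → ℝ) →L[ℝ] ℝ :=
  LinearMap.toContinuousBilinearMap <| LinearMap.mk₂ ℝ
    (fun a b => 2 * ∑ i : Fin n, (a (Sum.inl i) * b (Sum.inr i) - b (Sum.inl i) * a (Sum.inr i)))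
    (fun a a' b => by
      rw [← mul_add, ← Finset.sum_add_distrib]
      exact congrArg _ (Finset.sum_congr rfl fun i _ => by simp only [Pi.add_apply]; ring))
    (fun c a b => by
      rw [smul_eq_mul, mul_left_comm, Finset.mul_sum _ _ c]
      exact congrArg _ (Finset.sum_congr rfl fun i _ => by simp only [Pi.smul_apply, smul_eq_mul]; ring))
    (fun a b b' => by
      rw [← mul_add, ← Finset.sum_add_distrib]
      exact congrArg _ (Finset.sum_congr rfl fun i _ => by simp only [Pi.add_apply]; ring))
    (fun c a b => by
      rw [smul_eq_mul, mul_left_comm, Finset.mul_sum _ _ c]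
      exact congrArg _ (Finset.sum_congr rfl fun i _ => by simp only [Pi.smul_apply, smul_eq_mul]; ring))

theorem stdForm_apply (a b : Fin n ⊕ Fin n → ℝ) : stdForm n a b
    = 2 * ∑ i : Fin n, (a (Sum.inl i) * b (Sum.inr i) - b (Sum.inl i) * a (Sum.inr i)) := rfl

/-- The negative sign reflects the convention for `Matrix.J`, whose upper right block is −1. -/
theorem stdForm_eq_dotProduct (a b : Fin n ⊕ Fin n → ℝ) :
    stdForm n a b = -2 * (a ⬝ᵥ (Matrix.J (Fin n) ℝ *ᵥ b)) := by
  rw [stdForm_apply, Matrix.J, dotProduct, Fintype.sum_sum_type]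
  simp only [Matrix.fromBlocks_mulVec, Sum.elim_inl, Sum.elim_inr, Matrix.zero_mulVec,
    Matrix.neg_mulVec, Matrix.one_mulVec, Pi.neg_apply,
    Function.comp_apply, zero_add, add_zero]
  rw [← Finset.sum_add_distrib, neg_mul, ← mul_neg, ← Finset.sum_neg_distrib]
  exact congrArg _ (Finset.sum_congr rfl fun i _ => by ring)

theorem mem_symplecticGroup_iff_stdForm (A : Matrix (Fin n ⊕ Fin n) (Fin n ⊕ Fin n) ℝ) :
    A ∈ Matrix.symplecticGroup (Fin n) ℝ ↔
      ∀ a b, stdForm n (A *ᵥ a) (A *ᵥ b) = stdForm n a b := by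
  have h : ∀ a b, stdForm n (A *ᵥ a) (A *ᵥ b)
      = -2 * (a ⬝ᵥ ((A.transpose * Matrix.J (Fin n) ℝ * A) *ᵥ b)) := by
    intro a b
    rw [stdForm_eq_dotProduct, ← Matrix.mulVec_mulVec, ← Matrix.mulVec_mulVec,
      Matrix.dotProduct_mulVec _ A.transpose, Matrix.vecMul_transpose]
  rw [SymplecticGroup.mem_iff']
  constructor
  · intro hA a b
    rw [h, hA, stdForm_eq_dotProduct]
  · intro hA
    ext i j
    have := hA (Pi.single i 1) (Pi.single j 1)
    rw [h, stdForm_eq_dotProduct] at this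
    simpa using this

theorem dAt_formula_eq_stdForm {U : Set M} {e : M → Fin n ⊕ Fin n → ℝ} (hU : IsOpen U)
    (he : ContMDiffOn 𝓘(ℝ, Fin n → ℂ) 𝓘(ℝ, Fin n ⊕ Fin n → ℝ) ∞ e U)
    (hq : q ∈ (chartAt (Fin n → ℂ) p).source) (hqU : q ∈ U)
    (u v : TangentSpace 𝓘(ℝ, Fin n → ℂ) q) :
    2 * ∑ i : Fin n, (dAt (fun r => e r (Sum.inl i)) q u * dAt (fun r => e r (Sum.inr i)) q v
        - dAt (fun r => e r (Sum.inl i)) q v * dAt (fun r => e r (Sum.inr i)) q u)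
      = stdForm n (fderiv ℝ (funRep p e) (chartAt (Fin n → ℂ) p q) (coordMap p q u))
          (fderiv ℝ (funRep p e) (chartAt (Fin n → ℂ) p q) (coordMap p q v)) := by
  simp only [dAt_apply_eq hU he hq hqU]
  rfl

/-- A diffeomorphism of the domain of a chart that satisfies the affine equation gives rise to
an affine coordinate system. -/
theorem isAffineCoord_chartAt_trans {e₁ : OpenPartialHomeomorph (Fin n → ℂ) (Fin n ⊕ Fin n → ℝ)}
    (h₁ : ContDiffOn ℝ ∞ e₁ e₁.source) (h₂ : ContDiffOn ℝ ∞ e₁.symm e₁.target)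
    (h₃ : ∀ y ∈ e₁.source, ∀ u v,
      fderiv ℝ (fderiv ℝ e₁) y u v = fderiv ℝ e₁ y (christoffel D p y u v)) :
    IsAffineCoord D ((chartAt (Fin n → ℂ) p).trans e₁) := by
  have : IsManifold 𝓘(ℝ, Fin n → ℂ) ∞ M := IsManifold.of_le (n := ω) le_top
  have hsm : ContMDiffOn 𝓘(ℝ, Fin n → ℂ) 𝓘(ℝ, Fin n ⊕ Fin n → ℝ) ∞
      ((chartAt (Fin n → ℂ) p).trans e₁) ((chartAt (Fin n → ℂ) p).trans e₁).source :=
    h₁.contMDiffOn.comp (contMDiffOn_chart.mono fun q hq => hq.1) fun q hq => hq.2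
  refine ⟨hsm, ?_, isAffineOn_apply (OpenPartialHomeomorph.open_source _) hsm fun q hq => ?_⟩
  · exact contMDiffOn_chart_symm.comp (h₂.contMDiffOn.mono fun q hq => hq.1) fun q hq => hq.2
  · refine ⟨p, hq.1, fun u v => ?_⟩
    have he : funRep p ((chartAt (Fin n → ℂ) p).trans e₁) =ᶠ[𝓝 (chartAt (Fin n → ℂ) p q)] e₁ := by
      filter_upwards [(chartAt (Fin n → ℂ) p).open_target.mem_nhds
        ((chartAt (Fin n → ℂ) p).map_source hq.1)] with y hy
      simp [funRep, (chartAt (Fin n → ℂ) p).right_inv hy]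
    rw [he.fderiv.fderiv_eq, he.fderiv_eq]
    exact h₃ _ hq.2 u v

theorem isRealSpecial_chartAt_trans {e₁ : OpenPartialHomeomorph (Fin n → ℂ) (Fin n ⊕ Fin n → ℝ)}
    (h₁ : ContDiffOn ℝ ∞ e₁ e₁.source) (h₂ : ContDiffOn ℝ ∞ e₁.symm e₁.target)
    (h₃ : ∀ y ∈ e₁.source, ∀ u v,
      fderiv ℝ (fderiv ℝ e₁) y u v = fderiv ℝ e₁ y (christoffel D p y u v))
    (h₄ : ∀ y ∈ e₁.source, formRep Ω p y = pullForm (stdForm n) e₁ y) :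
    IsRealSpecial D Ω ((chartAt (Fin n → ℂ) p).trans e₁) := by
  have ha := isAffineCoord_chartAt_trans h₁ h₂ h₃
  refine ⟨ha, fun q hq u v => ?_⟩
  rw [dAt_formula_eq_stdForm (OpenPartialHomeomorph.open_source _) ha.smooth hq.1 hq,
    ← formRep_chartAt hq.1, h₄ (chartAt (Fin n → ℂ) p q) hq.2, pullForm_apply]
  have he : funRep p ((chartAt (Fin n → ℂ) p).trans e₁) =ᶠ[𝓝 (chartAt (Fin n → ℂ) p q)] e₁ := by
    filter_upwards [(chartAt (Fin n → ℂ) p).open_target.mem_nhds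
      ((chartAt (Fin n → ℂ) p).map_source hq.1)] with y hy
    simp [funRep, (chartAt (Fin n → ℂ) p).right_inv hy]
  rw [he.fderiv_eq]

omit [IsManifold 𝓘(ℂ, Fin n → ℂ) ω M] in
theorem exists_ball_subset_target (p : M) : ∃ R, 0 < R ∧
    Metric.ball (chartAt (Fin n → ℂ) p p) R ⊆ (chartAt (Fin n → ℂ) p).target :=
  Metric.isOpen_iff.1 (chartAt (Fin n → ℂ) p).open_target _ (mem_chart_target _ p)

/-- Every symplectic coframe at `p` is the differential at `p` of a system of affine functions
in which the parallel symplectic form has the standard expression. -/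
theorem exists_darboux [T2Space M] (hS : IsSpecialSymplectic D Ω) (p : M)
    (ξ : (Fin n → ℂ) →L[ℝ] (Fin n ⊕ Fin n → ℝ))
    (hξ : ∀ u v, formRep Ω p (chartAt (Fin n → ℂ) p p) u v = stdForm n (ξ u) (ξ v)) :
    ∃ r, 0 < r ∧ Metric.ball (chartAt (Fin n → ℂ) p p) r ⊆ (chartAt (Fin n → ℂ) p).target ∧
      ∃ G : (Fin n → ℂ) → Fin n ⊕ Fin n → ℝ,
        ContDiffOn ℝ ∞ G (Metric.ball (chartAt (Fin n → ℂ) p p) r) ∧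
        fderiv ℝ G (chartAt (Fin n → ℂ) p p) = ξ ∧
        (∀ y ∈ Metric.ball (chartAt (Fin n → ℂ) p p) r, ∀ u v,
          fderiv ℝ (fderiv ℝ G) y u v = fderiv ℝ G y (christoffel D p y u v)) ∧
        ∀ y ∈ Metric.ball (chartAt (Fin n → ℂ) p p) r,
          formRep Ω p y = pullForm (stdForm n) G y := by
  obtain ⟨R, hR, hRt⟩ := exists_ball_subset_target (n := n) p
  have hΓ := contDiffOn_christoffel hS.smooth p
  obtain ⟨r, hr, hrR, G, hG, hG0, hGΓ⟩ := exists_affine_of_flat hR (hΓ.mono hRt)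
    (fun y hy => christoffel_symm hS.toIsSpecialComplex (hRt hy))
    (fun y hy => christoffel_flat hS.toIsSpecialComplex (hRt hy)) ξ
  have hrt := (Metric.ball_subset_ball hrR).trans hRt
  have hy₀ := mem_chart_target (Fin n → ℂ) p
  obtain ⟨s, hs, hsr, hform⟩ := eq_of_parallel (B₁ := formRep Ω p) (B₂ := pullForm (stdForm n) G) hr
    ((hΓ.continuousOn.continuousAt ((chartAt (Fin n → ℂ) p).open_target.mem_nhds hy₀)))
    ((contDiffOn_formRep hS.symplectic p).mono hrt)
    (contDiffOn_pullForm (stdForm n) Metric.isOpen_ball hG)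
    (fun y hy => fderiv_formRep hS.symplectic hS.parallel (hrt hy))
    (fun y hy => fderiv_pullForm (stdForm n) Metric.isOpen_ball hG hGΓ hy)
    (by
      ext u v
      rw [hξ, pullForm_apply, hG0])
  have hsub := Metric.ball_subset_ball (x := chartAt (Fin n → ℂ) p p) hsr
  exact ⟨s, hs, hsub.trans hrt, G, hG.mono hsub, hG0, fun y hy => hGΓ y (hsub hy), hform⟩

theorem formRep_self (hΩ : IsSymplecticForm Ω) (p : M) (v : Fin n → ℂ) :
    formRep Ω p (chartAt (Fin n → ℂ) p p) v v = 0 := by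
  have h := formRep_chartAt (Ω := Ω) (mem_chart_source (Fin n → ℂ) p) (frame p v p) (frame p v p)
  rw [coordMap_frame (mem_chart_source _ p)] at h
  rw [h, hΩ.alternating]

theorem formRep_nondegenerate (hΩ : IsSymplecticForm Ω) (p : M) (v : Fin n → ℂ)
    (hv : ∀ w, formRep Ω p (chartAt (Fin n → ℂ) p p) v w = 0) : v = 0 := by
  have hp := mem_chart_source (Fin n → ℂ) p
  have h0 : frame p v p = 0 := hΩ.nondegenerate p _ fun w => by
    rw [← formRep_chartAt hp, coordMap_frame hp, hv]
  rw [← coordMap_frame hp v, h0, map_zero]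

theorem formRep_I (hS : IsSpecialKahler D Ω) (p : M) (u v : Fin n → ℂ) :
    formRep Ω p (chartAt (Fin n → ℂ) p p) (Complex.I • u) (Complex.I • v)
      = formRep Ω p (chartAt (Fin n → ℂ) p p) u v := by
  have hp := mem_chart_source (Fin n → ℂ) p
  have h := hS.J_invariant p (frame p u p) (frame p v p)
  rwa [← formRep_chartAt hp, ← formRep_chartAt hp, coordMap_J hp, coordMap_J hp, coordMap_frame hp,
    coordMap_frame hp] at h

theorem finrank_real_complexSpace (n : ℕ) : Module.finrank ℝ (Fin n → ℂ) = 2 * n := by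
  rw [Module.finrank_pi_fintype]
  simp [Complex.finrank_real_complex, mul_comm]

theorem exists_symplectic_frame (hΩ : IsSymplecticForm Ω) (p : M)
    {P : (Fin n → ℂ) → (Fin n → ℂ) → Prop}
    (hP : ∀ σ : (Fin n → ℂ) →L[ℝ] (Fin n → ℂ) →L[ℝ] ℝ, (∀ v, σ v v = 0) →
      (∀ v, (∀ w, σ v w = 0) → v = 0) →
      (∀ u v, σ u v = (1 / 2) * formRep Ω p (chartAt (Fin n → ℂ) p p) u v) → CanExtend σ P) :
    ∃ ξ : (Fin n → ℂ) ≃L[ℝ] (Fin n ⊕ Fin n → ℝ),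
      (∀ u v, formRep Ω p (chartAt (Fin n → ℂ) p p) u v = stdForm n (ξ u) (ξ v)) ∧
      ∀ i : Fin n, P (ξ.symm (Pi.single (Sum.inl i) 1)) (ξ.symm (Pi.single (Sum.inr i) 1)) := by
  -- Halving absorbs the factor 2 in ω = 2∑dxⁱ∧dyᵢ, since symplectic families are normalised to
  -- σ(a_i,b_i) = 1.
  let σ : (Fin n → ℂ) →L[ℝ] (Fin n → ℂ) →L[ℝ] ℝ :=
    (1 / 2 : ℝ) • formRep Ω p (chartAt (Fin n → ℂ) p p)
  have hσ : ∀ u v, σ u v = (1 / 2) * formRep Ω p (chartAt (Fin n → ℂ) p p) u v := fun _ _ => rfl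
  have h1 : ∀ v, σ v v = 0 := fun v => by rw [hσ, formRep_self hΩ, mul_zero]
  have h2 : ∀ v, (∀ w, σ v w = 0) → v = 0 := fun v hv =>
    formRep_nondegenerate hΩ p v fun w => by simpa [hσ] using hv w
  obtain ⟨ξ, hξ, hξP⟩ := exists_symplectic_equiv (finrank_real_complexSpace n) h1 (hP σ h1 h2 hσ)
  refine ⟨ξ, fun u v => ?_, hξP⟩
  rw [stdForm_apply, ← hξ, hσ]
  ring

/-- Existence of real special coordinates. -/
theorem exists_isRealSpecial [T2Space M] (hS : IsSpecialSymplectic D Ω) (p : M) :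
    ∃ e : RealCoord n M, p ∈ e.source ∧ IsRealSpecial D Ω e := by
  obtain ⟨ξ, hξ, -⟩ := exists_symplectic_frame hS.symplectic p
    (P := fun _ _ => True) fun σ h1 h2 _ => canExtend_of_nondegenerate h1 h2
  obtain ⟨r, hr, hrt, G, hG, hG0, hGΓ, hform⟩ := exists_darboux hS p ξ hξ
  obtain ⟨e₁, hm, hsub, he, hsymm⟩ := exists_local_inverse (by simp) Metric.isOpen_ball
    (Metric.mem_ball_self hr) hG ξ hG0
  have heq : ⇑e₁ = G := funext he
  refine ⟨(chartAt (Fin n → ℂ) p).trans e₁, ⟨mem_chart_source _ p, hm⟩,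
    isRealSpecial_chartAt_trans ?_ hsymm ?_ ?_⟩
  · rw [heq]; exact hG.mono hsub
  · rw [heq]; exact fun y hy => hGΓ y (hsub hy)
  · rw [heq]; exact fun y hy => hform y (hsub hy)

end SpecialCoordinates

/-! ### Uniqueness of real special coordinates up to affine symplectic maps -/

section Uniqueness

open Filter Topology

variable {n : ℕ} {M : Type*} [TopologicalSpace M] [ChartedSpace (Fin n → ℂ) M]
  [IsManifold 𝓘(ℂ, Fin n → ℂ) ω M] {p q : M} {D : Connection n M} {Ω : BilinField n M}

theorem contDiffAt_chartAt_comp_symm {e : RealCoord n M} (he : IsAffineCoord D e)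
    (hq : q ∈ e.source) : ContDiffAt ℝ ∞ (fun x => chartAt (Fin n → ℂ) q (e.symm x)) (e q) := by
  have : IsManifold 𝓘(ℝ, Fin n → ℂ) ∞ M := IsManifold.of_le (n := ω) le_top
  have h1 : ContMDiffAt 𝓘(ℝ, Fin n ⊕ Fin n → ℝ) 𝓘(ℝ, Fin n → ℂ) ∞ e.symm (e q) :=
    he.smooth_symm.contMDiffAt (e.open_target.mem_nhds (e.map_source hq))
  have h2 : ContMDiffAt 𝓘(ℝ, Fin n → ℂ) 𝓘(ℝ, Fin n → ℂ) ∞ (chartAt (Fin n → ℂ) q) (e.symm (e q)) := by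
    rw [e.left_inv hq]
    exact contMDiffOn_chart.contMDiffAt (chart_source_mem_nhds _ q)
  exact (h2.comp (e q) h1).contDiffAt

/-- The derivative of the inverse coordinates is a right inverse. Surjectivity lets arbitrary
vectors of ℝ²ⁿ be written as de(u), where the equations on the manifold apply. -/
theorem fderiv_funRep_surjective {e : RealCoord n M} (he : IsAffineCoord D e) (hq : q ∈ e.source) :
    Function.Surjective (fderiv ℝ (funRep q e) (chartAt (Fin n → ℂ) q q)) := by
  have hs := mem_chart_source (Fin n → ℂ) q
  have hK := ((contDiffAt_chartAt_comp_symm he hq).differentiableAt (by simp)).hasFDerivAt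
  have hG := ((contDiffAt_funRep he.smooth e.open_source hs hq).differentiableAt
    (by simp)).hasFDerivAt
  have hx : chartAt (Fin n → ℂ) q (e.symm (e q)) = chartAt (Fin n → ℂ) q q := by rw [e.left_inv hq]
  have hcomp : HasFDerivAt (fun x => funRep q e (chartAt (Fin n → ℂ) q (e.symm x))) _ (e q) :=
    HasFDerivAt.comp (g := funRep q e) (e q) (hx.symm ▸ hG) hK
  have hid : (fun x => funRep q e (chartAt (Fin n → ℂ) q (e.symm x))) =ᶠ[𝓝 (e q)] id := by
    have h1 : ContinuousAt e.symm (e q) := e.continuousAt_symm (e.map_source hq)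
    rw [ContinuousAt, e.left_inv hq] at h1
    filter_upwards [h1 (chart_source_mem_nhds (Fin n → ℂ) q), e.open_target.mem_nhds (e.map_source hq)]
      with x hx hxt
    rw [funRep_chartAt hx, e.right_inv hxt, id]
  have := hcomp.unique ((hasFDerivAt_id (e q)).congr_of_eventuallyEq hid)
  intro a
  refine ⟨fderiv ℝ (fun x => chartAt (Fin n → ℂ) q (e.symm x)) (e q) a, ?_⟩
  have h2 := congrArg (fun L => L a) this
  simp only [hx] at h2
  exact h2

/-- The coordinate change between affine coordinate systems is smooth. -/
theorem contDiffAt_coordChange {e e' : RealCoord n M} (he : IsAffineCoord D e)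
    (he' : IsAffineCoord D e') (hq : q ∈ e.source) (hq' : q ∈ e'.source) :
    ContDiffAt ℝ ∞ (fun x => e' (e.symm x)) (e q) := by
  have h1 : ContMDiffAt 𝓘(ℝ, Fin n ⊕ Fin n → ℝ) 𝓘(ℝ, Fin n → ℂ) ∞ e.symm (e q) :=
    he.smooth_symm.contMDiffAt (e.open_target.mem_nhds (e.map_source hq))
  have h2 : ContMDiffAt 𝓘(ℝ, Fin n → ℂ) 𝓘(ℝ, Fin n ⊕ Fin n → ℝ) ∞ e' (e.symm (e q)) := by
    rw [e.left_inv hq]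
    exact he'.smooth.contMDiffAt (e'.open_source.mem_nhds hq')
  exact (h2.comp (e q) h1).contDiffAt

omit [IsManifold 𝓘(ℂ, Fin n → ℂ) ω M] in
theorem funRep_coordChange {e e' : RealCoord n M} (hq : q ∈ e.source) :
    (fun y => e' (e.symm (funRep q e y))) =ᶠ[𝓝 (chartAt (Fin n → ℂ) q q)] funRep q e' := by
  filter_upwards [tendsto_chartAt_symm (mem_chart_source _ q) (e.open_source.mem_nhds hq)] with y hy
  have hy' : (chartAt (Fin n → ℂ) q).symm y ∈ e.source := hy
  simp only [funRep]
  rw [e.left_inv hy']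

theorem fderiv_funRep_coordChange {e e' : RealCoord n M} (he : IsAffineCoord D e)
    (he' : IsAffineCoord D e') (hq : q ∈ e.source) (hq' : q ∈ e'.source) :
    fderiv ℝ (funRep q e') (chartAt (Fin n → ℂ) q q)
      = (fderiv ℝ (fun x => e' (e.symm x)) (e q)).comp
        (fderiv ℝ (funRep q e) (chartAt (Fin n → ℂ) q q)) := by
  have hs := mem_chart_source (Fin n → ℂ) q
  have hG := ((contDiffAt_funRep he.smooth e.open_source hs hq).differentiableAt
    (by simp)).hasFDerivAt
  have hh := ((contDiffAt_coordChange he he' hq hq').differentiableAt (by simp)).hasFDerivAt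
  have hx : funRep q e (chartAt (Fin n → ℂ) q q) = e q := funRep_chartAt hs e
  exact ((HasFDerivAt.comp _ (hx.symm ▸ hh) hG).congr_of_eventuallyEq
    (funRep_coordChange hq).symm).fderiv.trans (by rw [hx])

/-- Differentiating e' = h∘e twice gives d²e' = d²h(de,de) + dh(d²e). Both systems satisfy d² = d∘Γ,
so the last term already equals d²e' and d²h(de,de) = 0. -/
theorem fderiv_fderiv_coordChange {e e' : RealCoord n M} (he : IsAffineCoord D e)
    (he' : IsAffineCoord D e') (hq : q ∈ e.source) (hq' : q ∈ e'.source) :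
    fderiv ℝ (fderiv ℝ (fun x => e' (e.symm x))) (e q) = 0 := by
  have hs := mem_chart_source (Fin n → ℂ) q
  set h : (Fin n ⊕ Fin n → ℝ) → Fin n ⊕ Fin n → ℝ := fun x => e' (e.symm x) with hh
  set y₀ := chartAt (Fin n → ℂ) q q with hy₀
  have hx : funRep q e y₀ = e q := funRep_chartAt hs e
  have hGs := contDiffAt_funRep he.smooth e.open_source hs hq
  have hhs : ContDiffAt ℝ ∞ h (funRep q e y₀) := hx.symm ▸ contDiffAt_coordChange he he' hq hq'
  have hev : fderiv ℝ (funRep q e') =ᶠ[𝓝 y₀]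
      fun y => (fderiv ℝ h (funRep q e y)).comp (fderiv ℝ (funRep q e) y) := by
    have h1 : ∀ᶠ y in 𝓝 y₀, ContDiffAt ℝ 1 (funRep q e) y :=
      (hGs.of_le (m := 1) (by norm_cast)).eventually (by simp)
    have h2 : ∀ᶠ y in 𝓝 y₀, ContDiffAt ℝ 1 h (funRep q e y) :=
      hGs.continuousAt.eventually ((hhs.of_le (m := 1) (by norm_cast)).eventually (by simp))
    filter_upwards [h1, h2, (funRep_coordChange (e' := e') hq).eventually_nhds] with y hy1 hy2 hy3
    have h3 := HasFDerivAt.comp y (hy2.differentiableAt (by simp)).hasFDerivAt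
      (hy1.differentiableAt (by simp)).hasFDerivAt
    exact (h3.congr_of_eventuallyEq (EventuallyEq.symm hy3)).fderiv
  have hdG := ((hGs.fderiv_right (m := 1) (by norm_cast)).differentiableAt (by simp)).hasFDerivAt
  have hdh := ((hhs.fderiv_right (m := 1) (by norm_cast)).differentiableAt (by simp)).hasFDerivAt
  have hG := (hGs.differentiableAt (by simp)).hasFDerivAt
  have hD := (HasFDerivAt.comp (g := fderiv ℝ h) y₀ hdh hG).clm_comp hdG
  have hD2 := hev.fderiv_eq.trans hD.fderiv
  have hsurj := fderiv_funRep_surjective he hq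
  rw [← hx]
  ext1 a
  ext1 b
  obtain ⟨u, rfl⟩ := hsurj a
  obtain ⟨v, rfl⟩ := hsurj b
  have h1 := fderiv_fderiv_of_isAffineOn e.open_source he.smooth he.affine hs hq u v
  have h2 := fderiv_fderiv_of_isAffineOn e'.open_source he'.smooth he'.affine hs hq' u v
  have h3 := congrArg (fun L => L u v) hD2
  simp only [← hy₀] at h1 h2
  rw [h2, fderiv_funRep_coordChange he he' hq hq', ← hy₀, ← hx] at h3
  simp only [ContinuousLinearMap.comp_apply, _root_.add_apply, ContinuousLinearMap.compL_apply,
    ContinuousLinearMap.flip_apply, Function.comp_apply, h1] at h3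
  exact left_eq_add.1 h3

/-- Affine coordinate systems differ by an affine map on connected open sets. -/
theorem exists_affine_coordChange {e e' : RealCoord n M} (he : IsAffineCoord D e)
    (he' : IsAffineCoord D e') {V : Set M} (hV : IsOpen V) (hVc : IsPreconnected V)
    (hVe : V ⊆ e.source) (hVe' : V ⊆ e'.source) :
    ∃ (L : (Fin n ⊕ Fin n → ℝ) →L[ℝ] (Fin n ⊕ Fin n → ℝ)) (b : Fin n ⊕ Fin n → ℝ), ∀ q ∈ V,
      e' q = L (e q) + b ∧ fderiv ℝ (fun x => e' (e.symm x)) (e q) = L := by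
  rcases V.eq_empty_or_nonempty with rfl | ⟨q₀, hq₀⟩
  · exact ⟨0, 0, by simp⟩
  have hO : IsOpen (e '' V) := e.isOpen_image_of_subset_source hV hVe
  have hOc : IsPreconnected (e '' V) := hVc.image e (e.continuousOn.mono hVe)
  set h : (Fin n ⊕ Fin n → ℝ) → Fin n ⊕ Fin n → ℝ := fun x => e' (e.symm x) with hh
  have hsm : ∀ q ∈ V, ContDiffAt ℝ ∞ h (e q) := fun q hq =>
    contDiffAt_coordChange he he' (hVe hq) (hVe' hq)
  set L := fderiv ℝ h (e q₀) with hL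
  have hconst : ∀ q ∈ V, fderiv ℝ h (e q) = L := by
    intro q hq
    refine hO.is_const_of_fderiv_eq_zero (𝕜 := ℝ) (f := fderiv ℝ h) hOc ?_ ?_
      (Set.mem_image_of_mem e hq) (Set.mem_image_of_mem e hq₀)
    · rintro _ ⟨q, hq, rfl⟩
      exact (((hsm q hq).fderiv_right (m := 1) (by norm_cast)).differentiableAt
        (by simp)).differentiableWithinAt
    · rintro _ ⟨q, hq, rfl⟩
      exact fderiv_fderiv_coordChange he he' (hVe hq) (hVe' hq)
  refine ⟨L, e' q₀ - L (e q₀), fun q hq => ⟨?_, hconst q hq⟩⟩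
  have hd : ∀ q ∈ V, HasFDerivAt (fun x => h x - L x) (fderiv ℝ h (e q) - L) (e q) := fun q hq =>
    ((hsm q hq).differentiableAt (by simp)).hasFDerivAt.sub L.hasFDerivAt
  have h1 := hO.is_const_of_fderiv_eq_zero (𝕜 := ℝ) (f := fun x => h x - L x) hOc
    (by
      rintro _ ⟨q, hq, rfl⟩
      exact (hd q hq).differentiableAt.differentiableWithinAt)
    (by
      rintro _ ⟨q, hq, rfl⟩
      rw [(hd q hq).fderiv, hconst q hq, sub_self]
      rfl)
    (Set.mem_image_of_mem e hq) (Set.mem_image_of_mem e hq₀)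
  simp only [hh, e.left_inv (hVe hq), e.left_inv (hVe hq₀)] at h1
  rw [← h1]
  abel

/-- The linear part is constant, so comparing the two expressions of the form at a single point
suffices; this is why the empty set is treated apart. -/
theorem exists_symplectic_coordChange {e e' : RealCoord n M} (he : IsRealSpecial D Ω e)
    (he' : IsRealSpecial D Ω e') {V : Set M} (hV : IsOpen V) (hVc : IsPreconnected V)
    (hVe : V ⊆ e.source) (hVe' : V ⊆ e'.source) :
    ∃ A ∈ Matrix.symplecticGroup (Fin n) ℝ, ∃ b : Fin n ⊕ Fin n → ℝ,
      ∀ q ∈ V, e' q = A *ᵥ e q + b := by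
  rcases V.eq_empty_or_nonempty with rfl | ⟨q, hq⟩
  · exact ⟨1, one_mem _, 0, by simp⟩
  obtain ⟨L, b, h⟩ := exists_affine_coordChange he.toIsAffineCoord he'.toIsAffineCoord hV hVc hVe hVe'
  have hLA : ∀ a, LinearMap.toMatrix' (L : (Fin n ⊕ Fin n → ℝ) →ₗ[ℝ] _) *ᵥ a = L a := fun a => by
    rw [LinearMap.toMatrix'_mulVec]; rfl
  refine ⟨LinearMap.toMatrix' L, (mem_symplecticGroup_iff_stdForm _).2 fun a b => ?_, b,
    fun q hq => by rw [hLA, (h q hq).1]⟩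
  rw [hLA, hLA]
  have hs := mem_chart_source (Fin n → ℂ) q
  have hsurj := fderiv_funRep_surjective he.toIsAffineCoord (hVe hq)
  obtain ⟨u, rfl⟩ := hsurj a
  obtain ⟨v, rfl⟩ := hsurj b
  have h1 := he.form_eq q (hVe hq) (frame q u q) (frame q v q)
  have h2 := he'.form_eq q (hVe' hq) (frame q u q) (frame q v q)
  rw [dAt_formula_eq_stdForm e.open_source he.smooth hs (hVe hq)] at h1
  rw [dAt_formula_eq_stdForm e'.open_source he'.smooth hs (hVe' hq), h1,
    fderiv_funRep_coordChange he.toIsAffineCoord he'.toIsAffineCoord (hVe hq) (hVe' hq),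
    (h q hq).2] at h2
  simp only [coordMap_frame hs] at h2
  exact h2.symm

/-- The affine homeomorphism of `ℝ²ⁿ` with invertible linear part `A` and translation `b`. -/
def affineHomeomorph {ι : Type*} [Fintype ι] [DecidableEq ι] (A : Matrix ι ι ℝ) (hA : IsUnit A.det)
    (b : ι → ℝ) : (ι → ℝ) ≃ₜ (ι → ℝ) where
  toFun x := A *ᵥ x + b
  invFun x := A⁻¹ *ᵥ (x - b)
  left_inv x := by simp [Matrix.mulVec_mulVec, Matrix.nonsing_inv_mul A hA]
  right_inv x := by simp [Matrix.mulVec_mulVec, Matrix.mul_nonsing_inv A hA]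
  continuous_toFun := (Continuous.matrix_mulVec continuous_const continuous_id).add continuous_const
  continuous_invFun := Continuous.matrix_mulVec continuous_const (continuous_id.sub continuous_const)

theorem isRealSpecial_affine_comp {e : RealCoord n M} (he : IsRealSpecial D Ω e)
    {A : Matrix (Fin n ⊕ Fin n) (Fin n ⊕ Fin n) ℝ} (hA : A ∈ Matrix.symplecticGroup (Fin n) ℝ)
    (b : Fin n ⊕ Fin n → ℝ) :
    IsRealSpecial D Ω (e.transHomeomorph
      (affineHomeomorph A (SymplecticGroup.symplectic_det hA) b)) := by
  set e' : RealCoord n M := e.transHomeomorph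
    (affineHomeomorph A (SymplecticGroup.symplectic_det hA) b) with he'
  let L : (Fin n ⊕ Fin n → ℝ) →L[ℝ] (Fin n ⊕ Fin n → ℝ) :=
    LinearMap.toContinuousLinearMap (Matrix.toLin' A)
  let L' : (Fin n ⊕ Fin n → ℝ) →L[ℝ] (Fin n ⊕ Fin n → ℝ) :=
    LinearMap.toContinuousLinearMap (Matrix.toLin' A⁻¹)
  have hf : ⇑e' = fun q => L (e q) + b := rfl
  have hf' : ⇑e'.symm = fun x => e.symm (L' (x - b)) := rfl
  have hsm : ContMDiffOn 𝓘(ℝ, Fin n → ℂ) 𝓘(ℝ, Fin n ⊕ Fin n → ℝ) ∞ e' e'.source := by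
    have h1 : ContDiff ℝ ∞ (fun x => L x + b) := L.contDiff.add contDiff_const
    exact h1.contMDiff.comp_contMDiffOn he.smooth
  have hrep : ∀ q ∈ e.source, fderiv ℝ (funRep q e') =ᶠ[𝓝 (chartAt (Fin n → ℂ) q q)]
      fun y => L.comp (fderiv ℝ (funRep q e) y) := by
    intro q hq
    have hG := contDiffAt_funRep he.smooth e.open_source (mem_chart_source (Fin n → ℂ) q) hq
    filter_upwards [(hG.of_le (m := 1) (by norm_cast)).eventually (by simp)] with y hy
    exact ((L.hasFDerivAt.comp y (hy.differentiableAt (by simp)).hasFDerivAt).add_const b).fderiv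
  refine ⟨⟨hsm, ?_, isAffineOn_apply e'.open_source hsm fun q hq => ⟨q, mem_chart_source _ q,
    fun u v => ?_⟩⟩, fun q hq u v => ?_⟩
  · have h1 : ContDiff ℝ ∞ (fun x => L' (x - b)) := L'.contDiff.comp (contDiff_id.sub contDiff_const)
    rw [hf']
    exact he.smooth_symm.comp h1.contMDiff.contMDiffOn fun x hx => hx
  · have hs := mem_chart_source (Fin n → ℂ) q
    have hG := contDiffAt_funRep he.smooth e.open_source hs hq
    have hdG := ((hG.fderiv_right (m := 1) (by norm_cast)).differentiableAt (by simp)).hasFDerivAt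
    have h2 := fderiv_fderiv_of_isAffineOn e.open_source he.smooth he.affine hs hq u v
    rw [(hrep q hq).eq_of_nhds, (hrep q hq).fderiv_eq,
      ((hasFDerivAt_const L _).clm_comp hdG).fderiv, ContinuousLinearMap.comp_apply, ← h2]
    simp
  · have hs := mem_chart_source (Fin n → ℂ) q
    have h1 := he.form_eq q hq u v
    rw [dAt_formula_eq_stdForm e.open_source he.smooth hs hq] at h1
    rw [h1, dAt_formula_eq_stdForm e'.open_source hsm hs hq, (hrep q hq).eq_of_nhds]
    exact ((mem_symplecticGroup_iff_stdForm A).1 hA _ _).symm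

end Uniqueness

/-! ### Holomorphic extensions and conjugate pairs -/

section Holomorphic

open Filter Topology

variable {n : ℕ} {M : Type*} [TopologicalSpace M] [ChartedSpace (Fin n → ℂ) M]
  [IsManifold 𝓘(ℂ, Fin n → ℂ) ω M] {p q : M} {D : Connection n M} {Ω : BilinField n M}

instance instIsManifoldOne : IsManifold 𝓘(ℂ, Fin n → ℂ) 1 M := IsManifold.of_le (n := ω) le_top

theorem mdifferentiableOn_comp_chartAt {W : Type*} [NormedAddCommGroup W] [NormedSpace ℂ W]
    {F : (Fin n → ℂ) → W} {U : Set (Fin n → ℂ)} (hF : DifferentiableOn ℂ F U) (p : M) :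
    MDifferentiableOn 𝓘(ℂ, Fin n → ℂ) 𝓘(ℂ, W) (fun q => F (chartAt (Fin n → ℂ) p q))
      ((chartAt (Fin n → ℂ) p).source ∩ chartAt (Fin n → ℂ) p ⁻¹' U) :=
  hF.mdifferentiableOn.comp
    ((mdifferentiableOn_atlas (chart_mem_atlas _ p)).mono fun _ hq => hq.1) fun _ hq => hq.2

/-- Affine coordinates have local holomorphic extensions. -/
theorem exists_isHolomorphicExtension [T2Space M] (hD : IsSpecialComplex D) {e : RealCoord n M}
    (he : IsAffineCoord D e) (hp : p ∈ e.source) :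
    ∃ V : Set M, IsOpen V ∧ p ∈ V ∧ V ⊆ e.source ∧
      ∃ F : M → (Fin n ⊕ Fin n → ℂ), IsHolomorphicExtension e V F := by
  have hs := mem_chart_source (Fin n → ℂ) p
  obtain ⟨R, hR, hsub⟩ := Metric.isOpen_iff.1
    ((chartAt (Fin n → ℂ) p).isOpen_inter_preimage_symm e.open_source) (chartAt (Fin n → ℂ) p p)
    ⟨mem_chart_target _ p, by simpa using hp⟩
  have hy : ∀ y ∈ Metric.ball (chartAt (Fin n → ℂ) p p) R,
      ∃ q ∈ (chartAt (Fin n → ℂ) p).source, q ∈ e.source ∧ chartAt (Fin n → ℂ) p q = y := fun y hy =>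
    ⟨_, (chartAt (Fin n → ℂ) p).map_target (hsub hy).1, (hsub hy).2,
      (chartAt (Fin n → ℂ) p).right_inv (hsub hy).1⟩
  obtain ⟨r, hr, hrR, F, hF, hre, -⟩ := exists_holomorphic_extension hR (G := funRep p e)
    (Γ := christoffel D p)
    (fun y hyR => by
      obtain ⟨q, hq, hqe, rfl⟩ := hy y hyR
      exact (contDiffAt_funRep he.smooth e.open_source hq hqe).contDiffWithinAt)
    (fun y hyR => christoffel_I hD (hsub hyR).1)
    (fun y hyR => by
      obtain ⟨q, hq, hqe, rfl⟩ := hy y hyR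
      exact fderiv_fderiv_of_isAffineOn e.open_source he.smooth he.affine hq hqe)
  refine ⟨(chartAt (Fin n → ℂ) p).source ∩
      chartAt (Fin n → ℂ) p ⁻¹' Metric.ball (chartAt (Fin n → ℂ) p p) r,
    (chartAt (Fin n → ℂ) p).isOpen_inter_preimage Metric.isOpen_ball,
    ⟨hs, Metric.mem_ball_self hr⟩, fun q hq => ?_, fun q => F (chartAt (Fin n → ℂ) p q),
    mdifferentiableOn_comp_chartAt (hF.differentiableOn (by simp)) p, fun q hq k => ?_⟩
  · have := (hsub (Metric.ball_subset_ball hrR hq.2)).2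
    rwa [Set.mem_preimage, (chartAt (Fin n → ℂ) p).left_inv hq.1] at this
  · rw [hre, funRep_chartAt hq.1]

/-- A holomorphic function with vanishing real part has vanishing differential. -/
theorem fderiv_eq_zero_of_re_eventuallyEq_zero {E : Type*} [NormedAddCommGroup E] [NormedSpace ℂ E]
    {f : E → ℂ} {y : E} (hf : DifferentiableAt ℂ f y) (hre : ∀ᶠ z in 𝓝 y, (f z).re = 0) :
    fderiv ℂ f y = 0 := by
  have h1 : HasFDerivAt (fun z => (f z).re) (Complex.reCLM.comp ((fderiv ℂ f y).restrictScalars ℝ)) y :=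
    Complex.reCLM.hasFDerivAt.comp y (hf.hasFDerivAt.restrictScalars ℝ)
  have h2 := h1.unique ((hasFDerivAt_const (0 : ℝ) y).congr_of_eventuallyEq hre)
  have h3 : ∀ v, (fderiv ℂ f y v).re = 0 := fun v => congrArg (fun L => L v) h2
  ext1 v
  refine Complex.ext (h3 v) ?_
  -- By complex linearity the real part at iv is minus the imaginary part at v.
  have h4 := h3 (Complex.I • v)
  rw [map_smul, smul_eq_mul, Complex.I_mul_re, neg_eq_zero] at h4
  exact h4

/-- On a ball in a chart the difference is holomorphic with zero real part, so its differential
vanishes there and it is constant. -/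
theorem eventually_eq_of_re_eq {F F' : M → (Fin n ⊕ Fin n → ℂ)} {V : Set M} (hV : IsOpen V)
    (hF : MDifferentiableOn 𝓘(ℂ, Fin n → ℂ) 𝓘(ℂ, Fin n ⊕ Fin n → ℂ) F V)
    (hF' : MDifferentiableOn 𝓘(ℂ, Fin n → ℂ) 𝓘(ℂ, Fin n ⊕ Fin n → ℂ) F' V)
    (hre : ∀ q ∈ V, ∀ k, (F' q k).re = (F q k).re) (hq : q ∈ V) :
    ∀ᶠ x in 𝓝 q, F' x - F x = F' q - F q := by
  have hs := mem_chart_source (Fin n → ℂ) q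
  obtain ⟨R, hR, hsub⟩ := Metric.isOpen_iff.1
    ((chartAt (Fin n → ℂ) q).isOpen_inter_preimage_symm hV) (chartAt (Fin n → ℂ) q q)
    ⟨mem_chart_target _ q, by simpa using hq⟩
  have hd : ∀ {F : M → (Fin n ⊕ Fin n → ℂ)},
      MDifferentiableOn 𝓘(ℂ, Fin n → ℂ) 𝓘(ℂ, Fin n ⊕ Fin n → ℂ) F V →
      ∀ k, DifferentiableOn ℂ (fun y => funRep q F y k) (Metric.ball (chartAt (Fin n → ℂ) q q) R) := by
    intro F hF k
    have h1 : MDifferentiableOn 𝓘(ℂ, Fin n → ℂ) 𝓘(ℂ, Fin n ⊕ Fin n → ℂ) (funRep q F)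
        (Metric.ball (chartAt (Fin n → ℂ) q q) R) :=
      hF.comp ((mdifferentiableOn_atlas_symm (chart_mem_atlas _ q)).mono fun y hy => (hsub hy).1)
        fun y hy => (hsub hy).2
    exact differentiableOn_pi.1 h1.differentiableOn k
  have hc : ∀ y ∈ Metric.ball (chartAt (Fin n → ℂ) q q) R, ∀ k,
      funRep q F' y k - funRep q F y k = F' q k - F q k := by
    intro y hy k
    have h1 := (hd hF' k).sub (hd hF k)
    have h2 := Metric.isOpen_ball.is_const_of_fderiv_eq_zero (𝕜 := ℂ)
      (convex_ball (chartAt (Fin n → ℂ) q q) R).isPreconnected h1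
      (fun z hz => fderiv_eq_zero_of_re_eventuallyEq_zero
        (h1.differentiableAt (Metric.isOpen_ball.mem_nhds hz)) (by
          filter_upwards [Metric.isOpen_ball.mem_nhds hz] with x hx
          have := hre _ (hsub hx).2 k
          simp [funRep, this])) hy (Metric.mem_ball_self hR)
    simp only [Pi.sub_apply, funRep_chartAt hs] at h2
    exact h2
  filter_upwards [chart_source_mem_nhds (Fin n → ℂ) q,
    (chartAt (Fin n → ℂ) q).continuousAt hs (Metric.ball_mem_nhds _ hR)] with x hx hxR
  ext k
  have := hc _ hxR k
  rwa [funRep_chartAt hx, funRep_chartAt hx] at this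

/-- Uniqueness of holomorphic extensions. -/
theorem exists_imaginary_translation {e : RealCoord n M} {V : Set M} (hV : IsOpen V)
    (hVc : IsPreconnected V) {F F' : M → (Fin n ⊕ Fin n → ℂ)}
    (hF : IsHolomorphicExtension e V F) (hF' : IsHolomorphicExtension e V F') :
    ∃ c : Fin n ⊕ Fin n → ℝ, ∀ q ∈ V, ∀ k, F' q k = F q k + (c k : ℂ) * Complex.I := by
  rcases V.eq_empty_or_nonempty with rfl | ⟨q₀, hq₀⟩
  · exact ⟨0, by simp⟩
  have hre : ∀ q ∈ V, ∀ k, (F' q k).re = (F q k).re := fun q hq k =>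
    (hF'.2 q hq k).trans (hF.2 q hq k).symm
  have hloc : IsLocallyConstant fun x : V => F' x - F x :=
    (IsLocallyConstant.iff_eventually_eq _).2 fun x =>
      continuous_subtype_val.continuousAt.eventually
        (eventually_eq_of_re_eq hV hF.1 hF'.1 hre x.2)
  have : PreconnectedSpace V := Subtype.preconnectedSpace hVc
  refine ⟨fun k => (F' q₀ k - F q₀ k).im, fun q hq k => ?_⟩
  have h1 : F' q - F q = F' q₀ - F q₀ :=
    hloc.apply_eq_of_isPreconnected (x := ⟨q, hq⟩) (y := ⟨q₀, hq₀⟩) isPreconnected_univ trivial trivial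
  have h2 : F' q k - F q k = F' q₀ k - F q₀ k := congrFun h1 k
  rw [← sub_eq_iff_eq_add', h2]
  refine Complex.ext ?_ (by simp)
  simp [hre q₀ hq₀ k]

omit [IsManifold 𝓘(ℂ, Fin n → ℂ) ω M] in
theorem isHolomorphicExtension_add_imaginary {e : RealCoord n M} {V : Set M}
    {F : M → (Fin n ⊕ Fin n → ℂ)} (hF : IsHolomorphicExtension e V F) (c : Fin n ⊕ Fin n → ℝ) :
    IsHolomorphicExtension e V (fun q k => F q k + (c k : ℂ) * Complex.I) := by
  refine ⟨?_, fun q hq k => by simp [hF.2 q hq k]⟩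
  have h : Differentiable ℂ fun (a : Fin n ⊕ Fin n → ℂ) k => a k + (c k : ℂ) * Complex.I := by fun_prop
  exact h.mdifferentiable.comp_mdifferentiableOn hF.1

/-- In a symplectic frame whose members are matched by the complex structure, a vector is
determined by the `xⁱ`-components of `v` and `i v`, and by their `yᵢ`-components. -/
theorem eq_zero_of_adapted_frame {ξ : (Fin n → ℂ) ≃L[ℝ] (Fin n ⊕ Fin n → ℝ)}
    (hP : ∀ i : Fin n, ∃ c : ℝ, ξ.symm (Pi.single (Sum.inr i) 1)
      = c • (Complex.I • ξ.symm (Pi.single (Sum.inl i) 1))) {v : Fin n → ℂ} :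
    ((∀ i, ξ v (Sum.inl i) = 0) → (∀ i, ξ (Complex.I • v) (Sum.inl i) = 0) → v = 0) ∧
    ((∀ i, ξ v (Sum.inr i) = 0) → (∀ i, ξ (Complex.I • v) (Sum.inr i) = 0) → v = 0) := by
  choose c hc using hP
  set a : Fin n → Fin n → ℂ := fun i => ξ.symm (Pi.single (Sum.inl i) 1) with ha
  have hξa : ∀ i, ξ (a i) = Pi.single (Sum.inl i) 1 := fun i => ξ.apply_symm_apply _
  have hξI : ∀ i, c i • ξ (Complex.I • a i) = Pi.single (Sum.inr i) 1 := fun i => by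
    rw [← map_smul, ← hc, ξ.apply_symm_apply]
  have hc0 : ∀ i, c i ≠ 0 := fun i h0 => by
    have := congrFun (hξI i) (Sum.inr i)
    simp [h0] at this
  have hξI' : ∀ i, ξ (Complex.I • a i) = (c i)⁻¹ • Pi.single (Sum.inr i) 1 := fun i => by
    rw [← hξI, smul_smul, inv_mul_cancel₀ (hc0 i), one_smul]
  have hv : v = ∑ i, ξ v (Sum.inl i) • a i + ∑ i, (ξ v (Sum.inr i) * c i) • (Complex.I • a i) := by
    apply ξ.injective
    simp only [map_add, map_sum, map_smul, hξa, mul_smul, hξI]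
    ext k
    rcases k with k | k <;> simp [Finset.sum_apply, Pi.single_apply]
  -- Multiplication by i interchanges the two halves of the frame up to nonzero factors, so the
  -- xⁱ-components of iv determine the yᵢ-components of v, and conversely.
  have hIv : ξ (Complex.I • v) = ∑ i, ξ v (Sum.inl i) • ((c i)⁻¹ • Pi.single (Sum.inr i) 1)
      - ∑ i, (ξ v (Sum.inr i) * c i) • Pi.single (Sum.inl i) 1 := by
    have h1 : Complex.I • v = ∑ i, ξ v (Sum.inl i) • (Complex.I • a i)
        - ∑ i, (ξ v (Sum.inr i) * c i) • a i := by
      conv_lhs => rw [hv]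
      rw [smul_add, Finset.smul_sum, Finset.smul_sum, sub_eq_add_neg, ← Finset.sum_neg_distrib]
      congr 1
      · exact Finset.sum_congr rfl fun i _ => smul_comm _ _ _
      · refine Finset.sum_congr rfl fun i _ => ?_
        rw [smul_comm, smul_smul Complex.I, Complex.I_mul_I, neg_smul, one_smul, smul_neg]
    rw [h1]
    simp only [map_sub, map_sum, map_smul, hξa, hξI']
  constructor
  · intro h0 h1
    have h2 : ∀ i, ξ v (Sum.inr i) = 0 := fun i => by
      have := h1 i
      rw [hIv] at this
      simpa [Finset.sum_apply, Pi.single_apply, hc0 i] using this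
    rw [hv]
    simp [h0, h2]
  · intro h0 h1
    have h2 : ∀ i, ξ v (Sum.inl i) = 0 := fun i => by
      have := h1 i
      rw [hIv] at this
      simpa [Finset.sum_apply, Pi.single_apply, hc0 i] using this
    rw [hv]
    simp [h0, h2]

theorem exists_equiv_of_injective (L : (Fin n → ℂ) →L[ℂ] (Fin n → ℂ)) (hL : ∀ v, L v = 0 → v = 0) :
    ∃ η : (Fin n → ℂ) ≃L[ℂ] (Fin n → ℂ), (η : (Fin n → ℂ) →L[ℂ] (Fin n → ℂ)) = L :=
  ⟨(LinearEquiv.ofInjectiveEndo (L : (Fin n → ℂ) →ₗ[ℂ] (Fin n → ℂ))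
    ((injective_iff_map_eq_zero _).2 hL)).toContinuousLinearEquiv, by ext1 v; rfl⟩

theorem isHolomorphicCoord_chartAt_trans {f : OpenPartialHomeomorph (Fin n → ℂ) (Fin n → ℂ)}
    (h₁ : DifferentiableOn ℂ f f.source) (h₂ : DifferentiableOn ℂ f.symm f.target) (p : M) :
    IsHolomorphicCoord ((chartAt (Fin n → ℂ) p).trans f) :=
  (mdifferentiable_of_mem_atlas (chart_mem_atlas _ p)).trans ⟨h₁.mdifferentiableOn, h₂.mdifferentiableOn⟩

/-- Existence of conjugate pairs of special coordinates. -/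
theorem exists_isConjugatePairExtending [T2Space M] (hS : IsSpecialKahler D Ω) (p : M) :
    ∃ (e : RealCoord n M) (z w : OpenPartialHomeomorph M (Fin n → ℂ)),
      p ∈ e.source ∧ IsConjugatePairExtending D Ω e z w := by
  obtain ⟨ξ, hξ, hP⟩ := exists_symplectic_frame hS.symplectic p
    (P := fun x y => ∃ c : ℝ, y = c • (Complex.I • x)) fun σ h1 h2 h3 =>
      canExtend_of_complexStructure h1 h2 (Complex.I • ContinuousLinearMap.id ℝ (Fin n → ℂ))
        (fun v => by
          change Complex.I • Complex.I • v = -v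
          rw [smul_smul, Complex.I_mul_I, neg_one_smul])
        (fun u v => by
          rw [h3, h3]
          exact congrArg _ (formRep_I hS p u v))
  obtain ⟨r, hr, hrt, G, hG, hG0, hGΓ, hform⟩ := exists_darboux hS.toIsSpecialSymplectic p ξ hξ
  obtain ⟨s, hs, hsr, F, hF, hre, hFd⟩ := exists_holomorphic_extension hr hG
    (fun y hy => christoffel_I hS.toIsSpecialComplex (hrt hy)) hGΓ
  set y₀ := chartAt (Fin n → ℂ) p p with hy₀
  have hys : y₀ ∈ Metric.ball y₀ s := Metric.mem_ball_self hs
  have hsub : Metric.ball y₀ s ⊆ Metric.ball y₀ r := Metric.ball_subset_ball hsr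
  have hcomp : ∀ ι : Fin n → Fin n ⊕ Fin n,
      ContDiffOn ℂ 1 (fun y i => F y (ι i)) (Metric.ball y₀ s) ∧
      ∀ v i, fderiv ℂ (fun y i => F y (ι i)) y₀ v i
        = ξ v (ι i) - Complex.I * ξ (Complex.I • v) (ι i) := by
    intro ι
    refine ⟨contDiffOn_pi.2 fun i => contDiffOn_pi.1 hF (ι i), fun v i => ?_⟩
    have hd : HasFDerivAt F (fderiv ℂ F y₀) y₀ :=
      ((hF.contDiffAt (Metric.isOpen_ball.mem_nhds hys)).differentiableAt (by simp)).hasFDerivAt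
    have h1 : HasFDerivAt (fun y i => F y (ι i)) (ContinuousLinearMap.pi fun i =>
        (ContinuousLinearMap.proj (R := ℂ) (φ := fun _ : Fin n ⊕ Fin n => ℂ) (ι i)).comp
          (fderiv ℂ F y₀)) y₀ :=
      hasFDerivAt_pi.2 fun i => hasFDerivAt_pi'.1 hd (ι i)
    rw [h1.fderiv]
    refine (hFd y₀ hys v (ι i)).trans ?_
    rw [hG0]
    rfl
  -- The i-th component of the differential at v has real part ξ(v) and imaginary part −ξ(iv) in the
  -- chosen slot. Its kernel is thus the space that the adapted frame shows to be zero.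
  have hinv : ∀ ι : Fin n → Fin n ⊕ Fin n,
      (∀ v, (∀ i, ξ v (ι i) = 0) → (∀ i, ξ (Complex.I • v) (ι i) = 0) → v = 0) →
      ∃ η : (Fin n → ℂ) ≃L[ℂ] (Fin n → ℂ), fderiv ℂ (fun y i => F y (ι i)) y₀ = η := by
    intro ι hι
    obtain ⟨η, hη⟩ := exists_equiv_of_injective (fderiv ℂ (fun y i => F y (ι i)) y₀) fun v hv => by
      have h1 : ∀ i, (ξ v (ι i) : ℂ) - Complex.I * ξ (Complex.I • v) (ι i) = 0 := fun i => by
        rw [← (hcomp ι).2, hv]; rfl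
      refine hι v (fun i => ?_) fun i => ?_
      · simpa using congrArg Complex.re (h1 i)
      · simpa using congrArg Complex.im (h1 i)
    exact ⟨η, hη.symm⟩
  obtain ⟨ηz, hηz⟩ := hinv Sum.inl fun v => (eq_zero_of_adapted_frame hP).1
  obtain ⟨ηw, hηw⟩ := hinv Sum.inr fun v => (eq_zero_of_adapted_frame hP).2
  -- The three local inverses are taken successively, each inside the source of the previous one.
  -- The last source is then common to all after restriction.
  obtain ⟨e₁, hm₁, hsub₁, he₁, hsymm₁⟩ := exists_local_inverse (by simp) Metric.isOpen_ball hys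
    (hG.mono hsub) ξ hG0
  obtain ⟨z₁, hmz, hsubz, hz₁, hsymmz⟩ := exists_local_inverse (by simp) e₁.open_source hm₁
    ((hcomp Sum.inl).1.mono hsub₁) ηz hηz
  obtain ⟨w₁, hmw, hsubw, hw₁, hsymmw⟩ := exists_local_inverse (by simp) z₁.open_source hmz
    ((hcomp Sum.inr).1.mono (hsubz.trans hsub₁)) ηw hηw
  set e₂ := e₁.restrOpen w₁.source w₁.open_source with he₂
  set z₂ := z₁.restrOpen w₁.source w₁.open_source with hz₂
  have hes : e₂.source = w₁.source := Set.inter_eq_right.2 (hsubw.trans hsubz)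
  have hzs : z₂.source = w₁.source := Set.inter_eq_right.2 hsubw
  have hws : w₁.source ⊆ Metric.ball y₀ s := (hsubw.trans hsubz).trans hsub₁
  have hee : ⇑e₂ = G := funext he₁
  have hze : ⇑z₂ = fun y i => F y (Sum.inl i) := funext hz₁
  have hwe : ⇑w₁ = fun y i => F y (Sum.inr i) := funext hw₁
  refine ⟨(chartAt (Fin n → ℂ) p).trans e₂, (chartAt (Fin n → ℂ) p).trans z₂,
    (chartAt (Fin n → ℂ) p).trans w₁, ⟨mem_chart_source _ p, by rw [hes]; exact hmw⟩, ?_⟩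
  have hsymmz₂ : DifferentiableOn ℂ z₂.symm z₂.target :=
    (hsymmz.differentiableOn (by simp)).mono fun x hx => hx.1
  refine
    { real_special := isRealSpecial_chartAt_trans ?_ (hsymm₁.mono fun x hx => hx.1) ?_ ?_
      holomorphic_z := isHolomorphicCoord_chartAt_trans ?_ hsymmz₂ p
      holomorphic_w := isHolomorphicCoord_chartAt_trans ?_ (hsymmw.differentiableOn (by simp)) p
      source_z := ?_
      source_w := ?_
      re_z := fun q hq i => ?_
      re_w := fun q hq i => ?_ }
  · rw [hee, hes]; exact hG.mono (hws.trans hsub)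
  · rw [hee, hes]; exact fun y hy => hGΓ y (hsub (hws hy))
  · rw [hee, hes]; exact fun y hy => hform y (hsub (hws hy))
  · rw [hze, hzs]; exact ((hcomp Sum.inl).1.mono hws).differentiableOn (by simp)
  · rw [hwe]; exact ((hcomp Sum.inr).1.mono hws).differentiableOn (by simp)
  · rw [OpenPartialHomeomorph.trans_source, OpenPartialHomeomorph.trans_source, hes, hzs]
  · rw [OpenPartialHomeomorph.trans_source, OpenPartialHomeomorph.trans_source, hes]
  · rw [OpenPartialHomeomorph.coe_trans, OpenPartialHomeomorph.coe_trans, Function.comp_apply,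
      Function.comp_apply, hze, hee, hre]
  · rw [OpenPartialHomeomorph.coe_trans, OpenPartialHomeomorph.coe_trans, Function.comp_apply,
      Function.comp_apply, hwe, hee, hre]

end Holomorphic
end SpecialGeometry

end

theorem theorem1 {n : ℕ} {M : Type*} [TopologicalSpace M] [T2Space M]
    [ChartedSpace (Fin n → ℂ) M] [IsManifold 𝓘(ℂ, Fin n → ℂ) ω M]
    (D : SpecialGeometry.Connection n M) :
    -- (i) special symplectic manifolds
    (∀ Ω : SpecialGeometry.BilinField n M, SpecialGeometry.IsSpecialSymplectic D Ω →
      (∀ p : M, ∃ e : SpecialGeometry.RealCoord n M,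
        p ∈ e.source ∧ SpecialGeometry.IsRealSpecial D Ω e) ∧
      (∀ e e' : SpecialGeometry.RealCoord n M,
        SpecialGeometry.IsRealSpecial D Ω e → SpecialGeometry.IsRealSpecial D Ω e' →
        ∀ V : Set M, IsOpen V → IsPreconnected V → V ⊆ e.source → V ⊆ e'.source →
          ∃ A ∈ Matrix.symplecticGroup (Fin n) ℝ, ∃ b : Fin n ⊕ Fin n → ℝ,
            ∀ q ∈ V, e' q = A *ᵥ e q + b) ∧
      (∀ e : SpecialGeometry.RealCoord n M, SpecialGeometry.IsRealSpecial D Ω e →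
        ∀ A ∈ Matrix.symplecticGroup (Fin n) ℝ, ∀ b : Fin n ⊕ Fin n → ℝ,
          ∃ e' : SpecialGeometry.RealCoord n M, e'.source = e.source ∧
            (∀ q ∈ e.source, e' q = A *ᵥ e q + b) ∧ SpecialGeometry.IsRealSpecial D Ω e')) ∧
    -- (ii) special complex manifolds
    (SpecialGeometry.IsSpecialComplex D →
      ∀ e : SpecialGeometry.RealCoord n M, SpecialGeometry.IsAffineCoord D e →
      (∀ p ∈ e.source, ∃ V : Set M, IsOpen V ∧ p ∈ V ∧ V ⊆ e.source ∧
        ∃ F : M → (Fin n ⊕ Fin n → ℂ), SpecialGeometry.IsHolomorphicExtension e V F) ∧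
      (∀ V : Set M, IsOpen V → IsPreconnected V → V ⊆ e.source →
        ∀ F F' : M → (Fin n ⊕ Fin n → ℂ),
          SpecialGeometry.IsHolomorphicExtension e V F →
          SpecialGeometry.IsHolomorphicExtension e V F' →
          ∃ c : Fin n ⊕ Fin n → ℝ, ∀ q ∈ V, ∀ k, F' q k = F q k + (c k : ℂ) * Complex.I) ∧
      (∀ V : Set M, IsOpen V → V ⊆ e.source → ∀ F : M → (Fin n ⊕ Fin n → ℂ),
        SpecialGeometry.IsHolomorphicExtension e V F → ∀ c : Fin n ⊕ Fin n → ℝ,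
          SpecialGeometry.IsHolomorphicExtension e V
            (fun q k => F q k + (c k : ℂ) * Complex.I))) ∧
    -- (iii) special Kähler manifolds
    (∀ Ω : SpecialGeometry.BilinField n M, SpecialGeometry.IsSpecialKahler D Ω →
      ∀ p : M, ∃ (e : SpecialGeometry.RealCoord n M)
        (z w : OpenPartialHomeomorph M (Fin n → ℂ)),
        p ∈ e.source ∧ SpecialGeometry.IsConjugatePairExtending D Ω e z w) := by
  refine ⟨fun Ω hS => ⟨SpecialGeometry.exists_isRealSpecial hS, ?_, ?_⟩, fun hD e he => ⟨?_, ?_, ?_⟩,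
    fun Ω hS p => SpecialGeometry.exists_isConjugatePairExtending hS p⟩
  · exact fun e e' he he' V hV hVc hVe hVe' =>
      SpecialGeometry.exists_symplectic_coordChange he he' hV hVc hVe hVe'
  · exact fun e he A hA b =>
      ⟨e.transHomeomorph (SpecialGeometry.affineHomeomorph A (SymplecticGroup.symplectic_det hA) b), rfl,
        fun _ _ => rfl, SpecialGeometry.isRealSpecial_affine_comp he hA b⟩
  · exact fun p hp => SpecialGeometry.exists_isHolomorphicExtension hD he hp
  · exact fun V hV hVc _ F F' hF hF' =>
      SpecialGeometry.exists_imaginary_translation hV hVc hF hF'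
  · exact fun V _ _ F hF c => SpecialGeometry.isHolomorphicExtension_add_imaginary hF c
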